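/- **Setting.** For $\delta>0$ let $\mathbb{R}^3_\delta=\{\xi\in\mathbb{C}^3: |\mathrm{Im}\,\xi_k|<\delta,\ k=1,2,3\}$. Let $g_j$ be a family of holomorphic functions on $\mathbb{R}^3_\delta$, real on $\mathbb{R}^3$, whose zero sets $\sigma_j=\{g_j=0\}$ form a locally finite family in $\mathbb{R}^3_\delta$; put $X=\mathbb{R}^3_\delta\setminus\bigcup_j\sigma_j$. Let $F$ be a possibly multivalued holomorphic function on $X$, i.e. a holomorphic function on a covering space $p:Y\to X$. For $z\in\mathbb{R}^3$ let $G(\cdot)=G(\cdot\,;z)$ be holomorphic on $\mathbb{R}^3_\delta$ with $\mathrm{Im}\,G\ge 0$ on $\mathbb{R}^3$. Let $\Gamma=\{x+i\eta_0(x):x\in\mathbb{R}^3\}$ with $\eta_0:\mathbb{R}^3\to\mathbb{R}^3$ smooth and $x+it\eta_0(x)\in X$ for all $x$ and all $t\in(0,1]$, and fix a branch of $F$ on $\Gamma$ (a continuous lift $s_0$ of $x\mapsto x+i\eta_0(x)$ to $Y$). Let $$u(z;\Lambda)=\int_\Gamma F(\xi)\,e^{i\Lambda G(\xi;z)}\,d\xi_1\wedge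 d\xi_2\wedge d\xi_3 .$$ **Deformations.** A *global allowed deformation* of $\Gamma$ is a smooth $\eta(x,\tau)$ with $\eta(x,0)=\eta_0(x)$ and $x+i\eta(x,\tau)\in X$ for all $x\in\mathbb{R}^3$, $\tau\in[0,1]$; it is *desired* over $A\subset\mathbb{R}^3$ if $\mathrm{Im}\,G(x+i\eta(x,1))>0$ for all $x\in A$. The branch of $F$ is continued continuously along the deformation. A *desired and allowed local deformation* at $x^*\in\mathbb{R}^3$ is a continuous path $c:[0,1]\to\mathbb{R}^3$, $c(0)=\eta_0(x^*)$, for which there are a neighbourhood $U$ of $x^*$ in $\mathbb{R}^3$ and $\varepsilon_0>0$ such that for all $x\in U$ and $0<\varepsilon\le\varepsilon_0$: $x+i\varepsilon c(\tau)\in X$ for all $\tau\in[0,1]$, and $\mathrm{Im}\,G(x+i\varepsilon c(1))>0$. A point $x^*\in\mathbb{R}^3$ is *special* (for the given $z$) if there is no such path at $x^*$. A real point is called *admissible* if each $\sigma_j$ through it is there either regular ($\nabla g_j\neq0$) or has a nondegenerate critical point (nonzero Hessian determinant of $g_j$, as at a conical point). *Tameness at infinity* (for the given $z$): there are $R$ and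 a smooth $h(x,\tau)$ such that for $\|x\|\ge R$ the path $h(x,\cdot)$ is a desired and allowed local deformation at $x$; for all $t\in(0,1]$, $x+ith(x,\tau)\in X$ for $\tau\in[0,1]$ and $\mathrm{Im}\,G(x+ith(x,1))>0$; $\mathrm{Im}\,G(x+ih(x,1))$ is bounded below by a positive constant and the first derivatives of $h$ in $(x,\tau)$ are bounded, for $\|x\|\ge R$, $\tau\in[0,1]$; and, for each sufficiently large $\Lambda$, $|F e^{i\Lambda G}|$ at $x+ih(x,\tau)$ (with $F$ continued along $h$ from $\Gamma$) is bounded, uniformly in $\tau$, by an integrable function of $x$. **Proposition.** (1) Fix $z$. Let $\nu_1,\dots,\nu_m\in\mathbb{R}^3$ be finitely many points with open neighbourhoods $N_1,\dots,N_m$ such that every $x\in\mathbb{R}^3\setminus\bigcup_k N_k$ is admissible and is not special. Then there is a global allowed deformation of $\Gamma$ which is desired over $\mathbb{R}^3\setminus\bigcup_k N_k$. (2) Fix $z$. Suppose that the set $S$ of special points is finite, that all points of $\mathbb{R}^3\setminus S$ are admissible, and that tameness at infinity holds. Then there are functions $u_\nu(\Lambda)$, $\nu\in S$, and $\zeta>0$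 with $$u(\Lambda)=\sum_{\nu\in S}u_\nu(\Lambda)+O(e^{-\zeta\Lambda}),\qquad \Lambda\to\infty,$$ and each $u_\nu$ is the contribution of an arbitrarily small neighbourhood of $\nu$: for every choice of pairwise disjoint open neighbourhoods $N_\nu\ni\nu$ ($\nu\in S$) there is a global allowed deformation $\eta$ of $\Gamma$, desired over $\mathbb{R}^3\setminus\bigcup_\nu N_\nu$, such that for each $\nu\in S$ the function $u_\nu(\Lambda)$ equals the integral of $Fe^{i\Lambda G}d\xi_1\wedge d\xi_2\wedge d\xi_3$ over $\{x+i\eta(x,1):x\in N_\nu\}$ up to $O(e^{-\zeta'\Lambda})$ with some $\zeta'>0$. (For large $\Lambda$ the integrals over $\Gamma$ and over the whole deformed domain converge absolutely.) (3) If the assumptions of (2) hold for almost all $z\in\mathbb{R}^3$, then for almost all $z$ the set of special points is finite and the conclusion of (2) holds. -/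

import Mathlib

open Set Filter Topology MeasureTheory
open scoped ContDiff

/-- Real three-dimensional space, and complex three-dimensional space. -/
abbrev R3 : Type := Fin 3 → ℝ

abbrev C3 : Type := Fin 3 → ℂ

/-- The complex point `x + i y`. -/
noncomputable def complexPoint (x y : R3) : C3 := fun k => (x k : ℂ) + Complex.I * (y k : ℂ)

/-- The `δ`-neighbourhood of real space: all `ξ` with `|Im ξ_k| < δ` for `k = 1, 2, 3`. -/
def realTube (δ : ℝ) : Set C3 := {ξ | ∀ k, |(ξ k).im| < δ}

/-- The tube with all singularity components `σ_j = {g_j = 0}` removed. -/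
def singularityFree {J : Type*} (δ : ℝ) (g : J → C3 → ℂ) : Set C3 :=
  {ξ | ξ ∈ realTube δ ∧ ∀ j, g j ξ ≠ 0}

/-- The matrix of second complex partial derivatives of `f` at `ξ`. -/
noncomputable def complexHessian (f : C3 → ℂ) (ξ : C3) : Matrix (Fin 3) (Fin 3) ℂ :=
  Matrix.of fun k l =>
    fderiv ℂ (fun ζ => fderiv ℂ f ζ (Pi.single k 1)) ξ (Pi.single l 1)

/-- At the real point `x`, every component `σ_j` through `x` is regular (`∇ g_j ≠ 0`) or has a
nondegenerate quadratic (conical) point. -/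
def RegularOrConicalAt {J : Type*} (g : J → C3 → ℂ) (x : R3) : Prop :=
  ∀ j, g j (complexPoint x 0) = 0 →
    fderiv ℂ (g j) (complexPoint x 0) ≠ 0 ∨ (complexHessian (g j) (complexPoint x 0)).det ≠ 0

/-- A desired and allowed local deformation at the real point `x` of the domain
`Γ = {x + i η₀(x)}`: a continuous family of displacement vectors `c τ`, constant in the space
variable on a neighbourhood `U` of `x`, which starts at the displacement vector of `Γ` at `x`. The
displacements are small compared with `U`, so the conditions are imposed on `ε c` for all small
`ε > 0`, with one and the same `U`. -/
structure IsLocalDeformation {J : Type*} (δ : ℝ) (g : J → C3 → ℂ) (G : C3 → ℂ) (η₀ : R3 → R3)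
    (x : R3) (c : ℝ → R3) : Prop where
  continuousOn : ContinuousOn c (Icc 0 1)
  initial : c 0 = η₀ x
  allowed_desired : ∃ U ∈ 𝓝 x, ∃ ε₀ > (0 : ℝ), ∀ x' ∈ U, ∀ ε ∈ Ioc 0 ε₀,
    (∀ τ ∈ Icc (0 : ℝ) 1, complexPoint x' (ε • c τ) ∈ singularityFree δ g) ∧
      0 < (G (complexPoint x' (ε • c 1))).im

/-- Special points: there is no desired and allowed deformation of `Γ` nearby. -/
def specialPoints {J : Type*} (δ : ℝ) (g : J → C3 → ℂ) (G : C3 → ℂ) (η₀ : R3 → R3) : Set R3 :=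
  {x | ¬ ∃ c, IsLocalDeformation δ g G η₀ x c}

/-- A (global) allowed deformation `Γ(τ) = {x + i η(x, τ)}`, `τ ∈ [0, 1]`, of
`Γ = {x + i η₀(x)}`: it stays in the tube and never meets the singularities. -/
structure IsAllowedDeformation {J : Type*} (δ : ℝ) (g : J → C3 → ℂ) (η₀ : R3 → R3)
    (η : R3 → ℝ → R3) : Prop where
  smooth : ContDiff ℝ ∞ (fun p : R3 × ℝ => η p.1 p.2)
  initial : ∀ x, η x 0 = η₀ x
  allowed : ∀ x, ∀ τ ∈ Icc (0 : ℝ) 1, complexPoint x (η x τ) ∈ singularityFree δ g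

/-- The deformation `η` is desired over the set `A`: `Im G > 0` at the points of the final domain
`Γ(1)` that lie over `A`. -/
def IsDesiredOn (G : C3 → ℂ) (η : R3 → ℝ → R3) (A : Set R3) : Prop :=
  ∀ x ∈ A, 0 < (G (complexPoint x (η x 1))).im

/-- The Jacobian `det (∂ξ / ∂x)` of `x ↦ ξ = x + i η(x)`, that is, the density of
`dξ₁ ∧ dξ₂ ∧ dξ₃` on `{x + i η(x)}` with respect to `dx`. -/
noncomputable def graphJacobian (η : R3 → R3) (x : R3) : ℂ :=
  (Matrix.of fun k l : Fin 3 =>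
    (if k = l then (1 : ℂ) else 0) +
      Complex.I * ((fderiv ℝ η x (Pi.single l 1) k : ℝ) : ℂ)).det

/-- `F` is a (possibly multivalued) holomorphic function on the base of the covering `p : Y → X`:
a function on `Y` that near each point is a holomorphic function of the base point. -/
def IsMultivaluedHolomorphic {X : Set C3} {Y : Type*} [TopologicalSpace Y] (p : Y → X)
    (F : Y → ℂ) : Prop :=
  ∀ y, ∃ φ : C3 → ℂ, AnalyticAt ℂ φ (p y : C3) ∧ ∀ᶠ y' in 𝓝 y, F y' = φ (p y' : C3)

/-- The integrand of `∫ F exp(i Λ G) dξ` over `{x + i η(x)}`, written in the parameter `x`; the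
branch of `F` on the domain is given by the lift `s` of `x ↦ x + i η(x)` to the covering space. -/
noncomputable def graphIntegrand {Y : Type*} (F : Y → ℂ) (G : C3 → ℂ) (η : R3 → R3) (s : R3 → Y)
    (Λ : ℝ) (x : R3) : ℂ :=
  F (s x) * Complex.exp (Complex.I * (Λ : ℂ) * G (complexPoint x (η x))) * graphJacobian η x

/-- `∫ F exp(i Λ G) dξ` over the part of `{x + i η(x)}` that lies over `A`. -/
noncomputable def graphIntegral {Y : Type*} (F : Y → ℂ) (G : C3 → ℂ) (η : R3 → R3) (s : R3 → Y)
    (A : Set R3) (Λ : ℝ) : ℂ :=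
  ∫ x in A, graphIntegrand F G η s Λ x

/-- Behaviour at infinity: for `‖x‖ ≥ R` there are desired and allowed local deformations `h x`
depending smoothly on `x`, with `Im G` bounded below on the final domain, and the integrand decays
(is dominated by an integrable function, for each large `Λ`) on the domains swept out. If `Γ` itself
is desired near infinity, one can take `h x τ = η₀ x`. -/
def TameAtInfinity {J : Type*} (δ : ℝ) (g : J → C3 → ℂ) {Y : Type*} [TopologicalSpace Y]
    (p : Y → singularityFree δ g) (F : Y → ℂ) (G : C3 → ℂ) (η₀ : R3 → R3) (s₀ : R3 → Y) : Prop :=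
  ∃ (R : ℝ) (h : R3 → ℝ → R3) (l : R3 × unitInterval → Y),
    ContDiff ℝ ∞ (fun q : R3 × ℝ => h q.1 q.2) ∧
    (∀ x, R ≤ ‖x‖ → IsLocalDeformation δ g G η₀ x (h x)) ∧
    (∀ x, R ≤ ‖x‖ → ∀ t ∈ Ioc (0 : ℝ) 1,
      (∀ τ ∈ Icc (0 : ℝ) 1, complexPoint x (t • h x τ) ∈ singularityFree δ g) ∧
        0 < (G (complexPoint x (t • h x 1))).im) ∧
    (∃ c > (0 : ℝ), ∀ x, R ≤ ‖x‖ → c ≤ (G (complexPoint x (h x 1))).im) ∧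
    (∃ M : ℝ, ∀ x, R ≤ ‖x‖ → ∀ τ ∈ Icc (0 : ℝ) 1,
      ‖fderiv ℝ (fun q : R3 × ℝ => h q.1 q.2) (x, τ)‖ ≤ M) ∧
    ContinuousOn l {q | R ≤ ‖q.1‖} ∧
    (∀ x, R ≤ ‖x‖ → l (x, 0) = s₀ x ∧
      ∀ τ : unitInterval, (p (l (x, τ)) : C3) = complexPoint x (h x τ)) ∧
    ∃ Λ₀ : ℝ, ∀ Λ ≥ Λ₀, ∃ b : R3 → ℝ, Integrable b ∧
      ∀ x, R ≤ ‖x‖ → ∀ τ : unitInterval,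
        ‖F (l (x, τ)) * Complex.exp (Complex.I * (Λ : ℂ) * G (complexPoint x (h x τ)))‖ ≤ b x

/-- `f₁` and `f₂` differ by `O(e^{-ζ Λ})`, `Λ → ∞`, for some `ζ > 0`. -/
def ExponentiallyClose (f₁ f₂ : ℝ → ℂ) : Prop :=
  ∃ ζ > (0 : ℝ), (fun Λ => f₁ Λ - f₂ Λ) =O[atTop] (fun Λ => Real.exp (-ζ * Λ))

/-- The principle of locality for the integral `u(Λ)` of `F exp(i Λ G) dξ` over
`Γ = {x + i η₀(x)}`, with finite set `S` of special points: `u` is, up to an exponentially small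
error, a sum of terms `u_ν`, `ν ∈ S`, and `u_ν` is, up to an exponentially small error, the integral
over the part over `N ν` of a global allowed deformation of `Γ` that is desired off all the `N ν`,
however small the disjoint neighbourhoods `N ν` are chosen. -/
def PrincipleOfLocality {J : Type*} (δ : ℝ) (g : J → C3 → ℂ) {Y : Type*} [TopologicalSpace Y]
    (p : Y → singularityFree δ g) (F : Y → ℂ) (G : C3 → ℂ) (η₀ : R3 → R3) (s₀ : R3 → Y)
    (S : Finset R3) : Prop :=
  ∃ u : R3 → ℝ → ℂ,
    (∀ᶠ Λ in atTop, Integrable (graphIntegrand F G η₀ s₀ Λ)) ∧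
    ExponentiallyClose (graphIntegral F G η₀ s₀ univ) (fun Λ => ∑ ν ∈ S, u ν Λ) ∧
    ∀ N : R3 → Set R3, (∀ ν ∈ S, IsOpen (N ν) ∧ ν ∈ N ν) →
      (S : Set R3).PairwiseDisjoint N →
      ∃ (η : R3 → ℝ → R3) (l : R3 × unitInterval → Y),
        IsAllowedDeformation δ g η₀ η ∧ IsDesiredOn G η (⋃ ν ∈ S, N ν)ᶜ ∧
        Continuous l ∧ (∀ x, l (x, 0) = s₀ x) ∧
        (∀ x (τ : unitInterval), (p (l (x, τ)) : C3) = complexPoint x (η x τ)) ∧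
        (∀ᶠ Λ in atTop, Integrable (graphIntegrand F G (fun x => η x 1) (fun x => l (x, 1)) Λ)) ∧
        ∀ ν ∈ S, ExponentiallyClose (u ν)
          (graphIntegral F G (fun x => η x 1) (fun x => l (x, 1)) (N ν))

/-! The local conditions on displacements are turned into linear or quadratic conditions on
directions, and these are convex enough to be glued by a partition of unity.

Call a direction `y` at a real point `x` transversal to `{f = 0}` if `f x ≠ 0`, or if `x` is a
regular zero and `df(y) ≠ 0`, or if `x` is a critical zero and `y` is timelike for the Hessian.
Transversal directions avoid `{f = 0}` uniformly in nearby base points, nearby directions and small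
scales (`TransversalDirection.eventually`). The converse at admissible points is the core of the
local theory (`TransversalDirection.of_eventually`). If `x' + iεy` misses `{f = 0}` for all `x'`
near `x` and all small `ε > 0`, then `s ↦ f(x' + s y)` has no zeros with `Im s > 0` near the origin.
If `y` violates transversality, suitable rescalings of such functions converge to a function with a
simple zero in the upper half-plane, against Hurwitz's theorem; the one borderline case is excluded
by nondegeneracy of the Hessian. In the same way, Hopf's boundary lemma turns `Im G > 0` near `x`
into the half-space condition `DesiredDirection`.

The components of the complement of a hyperplane, and of the set of timelike vectors, are convex.
Hence allowed directions joined by a path are joined by a segment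
(`segment_subset_stronglyAllowed`), desired directions form a convex set, and local deformations can
be averaged (`exists_glued_direction`). A smooth positive scale makes the result small enough
(`exists_glued_scale`), and `exists_glued_deformation` first shrinks the domain and then moves it
straight. This gives the global deformation; its final domain satisfies the hypotheses again, so
that the construction can be repeated.

For the asymptotics, `F exp(iΛG) dξ` is a closed form on the covering, so by Stokes' theorem
(`integral_box_deformation`) the integral over a box does not change under a deformation that is
fixed over the boundary. Dominated convergence extends this to the deformation near infinity. Once
the domain is desired off small balls about the special points, `Im G` is bounded below there and
only the balls matter; `u_ν` is the integral over a fixed ball about `ν`. For smaller neighbourhoods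
the domain is deformed further, only inside the balls and with their boundary fixed
(`IsBaseDeformation.exists_shrink`). The ball integrals are then unchanged, and ball and
neighbourhood differ only where `Im G` is bounded below. -/

/-! ### Real points, complex points and the tube. -/

/-- The inclusion of real space into complex space. -/
noncomputable def realPoint : R3 →L[ℝ] C3 :=
  ContinuousLinearMap.pi fun k => Complex.ofRealCLM.comp (ContinuousLinearMap.proj k)

@[simp] theorem realPoint_apply (x : R3) (k : Fin 3) : realPoint x k = (x k : ℂ) := rfl

theorem complexPoint_eq (x y : R3) : complexPoint x y = realPoint x + Complex.I • realPoint y := by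
  ext k; simp [complexPoint]

theorem complexPoint_zero_right (x : R3) : complexPoint x 0 = realPoint x := by
  ext k; simp [complexPoint]

theorem norm_realPoint (x : R3) : ‖realPoint x‖ = ‖x‖ := by
  simp only [Pi.norm_def]
  congr 1
  refine Finset.sup_congr rfl fun k _ => ?_
  ext; simp

theorem continuous_complexPoint : Continuous fun q : R3 × R3 => complexPoint q.1 q.2 := by
  simp only [complexPoint_eq]
  fun_prop

theorem realPoint_add_smul (x y : R3) (s : ℂ) :
    realPoint x + s • realPoint y = complexPoint (x + s.re • y) (s.im • y) := by
  ext k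
  simp only [complexPoint, Pi.add_apply, Pi.smul_apply, realPoint_apply, smul_eq_mul]
  conv_lhs => rw [← Complex.re_add_im s]
  push_cast
  ring

theorem realPoint_mem_realTube {δ : ℝ} (hδ : 0 < δ) (x : R3) : realPoint x ∈ realTube δ := by
  intro k; simpa using hδ

theorem isOpen_realTube (δ : ℝ) : IsOpen (realTube δ) := by
  simp only [realTube, Set.ofPred_forall]
  exact isOpen_iInter_of_finite fun k => isOpen_lt (by fun_prop) continuous_const

/-! ### Desired directions. -/

/-- Hopf's boundary point lemma for the imaginary part of a holomorphic function of one variable: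
if it is positive in the upper half of a disc and vanishes at the centre, then its normal
derivative there is positive. -/
theorem hopf_boundary_lemma {f : ℂ → ℂ} (hf : AnalyticAt ℂ f 0)
    (hup : ∀ᶠ s in 𝓝 (0 : ℂ), 0 < s.im → 0 < (f s).im) (h0 : (f 0).im = 0) :
    0 < (deriv f 0).re := by
  have hlim : ∀ θ ∈ Ioo 0 Real.pi,
      Tendsto (fun r : ℝ => (r : ℂ) * Complex.exp (θ * Complex.I)) (𝓝[>] 0) (𝓝 0) := by
    intro θ _
    have : Tendsto (fun r : ℝ => (r : ℂ) * Complex.exp (θ * Complex.I)) (𝓝 0)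
        (𝓝 (((0 : ℝ) : ℂ) * Complex.exp (θ * Complex.I))) :=
      ((Complex.continuous_ofReal.tendsto 0).mul_const _)
    simpa using this.mono_left nhdsWithin_le_nhds
  have him : ∀ (r θ : ℝ), ((r : ℂ) * Complex.exp (θ * Complex.I)).im = r * Real.sin θ := by
    intro r θ
    rw [Complex.im_ofReal_mul, Complex.exp_ofReal_mul_I_im]
  have hne : ¬ ∀ᶠ s in 𝓝 (0 : ℂ), f s - f 0 = 0 := by
    intro h
    have hpi : Real.pi / 2 ∈ Ioo 0 Real.pi := ⟨by positivity, by linarith [Real.pi_pos]⟩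
    have h1 := (hlim _ hpi).eventually (h.and hup)
    obtain ⟨r, ⟨h2, h3⟩, hr⟩ := (h1.and self_mem_nhdsWithin).exists
    have h4 := h3 (by rw [him]; simpa using hr)
    rw [sub_eq_zero.1 h2, h0] at h4
    exact lt_irrefl _ h4
  have hfa : AnalyticAt ℂ (fun s => f s - f 0) 0 := hf.sub analyticAt_const
  obtain ⟨n, g, hg, hg0, hfg⟩ := hfa.exists_eventuallyEq_pow_smul_nonzero_iff.2 hne
  simp only [sub_zero, smul_eq_mul] at hfg
  have hn : n ≠ 0 := by
    rintro rfl
    have := hfg.self_of_nhds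
    simp at this
    exact hg0 this.symm
  -- Divide by `r ^ n` along the ray with argument `θ` and let `r → 0`: only the leading coefficient
  -- `g 0` survives.
  have key : ∀ θ ∈ Ioo 0 Real.pi, 0 ≤ (Complex.exp (n * (θ * Complex.I)) * g 0).im := by
    intro θ hθ
    have ht : Tendsto (fun r : ℝ => (Complex.exp (n * (θ * Complex.I)) *
        g ((r : ℂ) * Complex.exp (θ * Complex.I))).im) (𝓝[>] 0)
        (𝓝 (Complex.exp (n * (θ * Complex.I)) * g 0).im) :=
      (Complex.continuous_im.tendsto _).comp
        ((hg.continuousAt.tendsto.comp (hlim θ hθ)).const_mul _)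
    refine ge_of_tendsto ht ?_
    filter_upwards [(hlim θ hθ).eventually (hfg.and hup), self_mem_nhdsWithin] with r hr hr0
    have hr0 : 0 < r := hr0
    have h1 := hr.2 (by rw [him]; exact mul_pos hr0 (Real.sin_pos_of_mem_Ioo hθ))
    have h2 : (f ((r : ℂ) * Complex.exp (θ * Complex.I)) - f 0).im =
        r ^ n * (Complex.exp (n * (θ * Complex.I)) *
          g ((r : ℂ) * Complex.exp (θ * Complex.I))).im := by
      rw [hr.1, mul_pow, ← Complex.exp_nat_mul, mul_assoc, ← Complex.ofReal_pow,
        Complex.im_ofReal_mul]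
    rw [Complex.sub_im, h0, sub_zero] at h2
    rw [h2] at h1
    exact (pos_of_mul_pos_right h1 (by positivity)).le
  have key' : ∀ θ ∈ Icc 0 Real.pi, 0 ≤ (Complex.exp (n * (θ * Complex.I)) * g 0).im := by
    intro θ hθ
    have hcl : IsClosed {θ : ℝ | 0 ≤ (Complex.exp (n * (θ * Complex.I)) * g 0).im} :=
      isClosed_le continuous_const (by fun_prop)
    have := closure_minimal key hcl
    rw [closure_Ioo Real.pi_pos.ne] at this
    exact this hθ
  have hE : ∀ t : ℝ, (Complex.exp (t * Complex.I) * g 0).im =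
      Real.cos t * (g 0).im + Real.sin t * (g 0).re := by
    intro t
    rw [Complex.mul_im, Complex.exp_ofReal_mul_I_re, Complex.exp_ofReal_mul_I_im]
  have key2 : ∀ θ ∈ Icc 0 Real.pi, 0 ≤ Real.cos (n * θ) * (g 0).im + Real.sin (n * θ) * (g 0).re := by
    intro θ hθ
    have := key' θ hθ
    rwa [← hE, show (((n : ℝ) * θ : ℝ) : ℂ) * Complex.I = n * (θ * Complex.I) by push_cast; ring]
  have hpi := Real.pi_pos
  have hn1 : (1 : ℝ) ≤ n := by exact_mod_cast Nat.one_le_iff_ne_zero.2 hn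
  have hn0 : (n : ℝ) ≠ 0 := by positivity
  -- The angles `0`, `π / n` and `π / (2n)` show that `g 0` is real and nonnegative.
  have a0 : 0 ≤ (g 0).im := by simpa using key2 0 ⟨le_rfl, hpi.le⟩
  have a1 : (g 0).im ≤ 0 := by
    have := key2 (Real.pi / n) ⟨by positivity, div_le_self hpi.le hn1⟩
    rw [mul_div_cancel₀ _ hn0] at this
    simpa using this
  have a2 : 0 ≤ (g 0).re := by
    have := key2 (Real.pi / 2 / n) ⟨by positivity, (div_le_self (by positivity) hn1).trans (by linarith)⟩
    rw [mul_div_cancel₀ _ hn0] at this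
    simpa using this
  have him0 : (g 0).im = 0 := le_antisymm a1 a0
  have hre : 0 < (g 0).re := by
    refine lt_of_le_of_ne a2 fun h => hg0 (Complex.ext h.symm him0)
  have hn_one : n = 1 := by
    by_contra hn1'
    have hn2 : (2 : ℝ) ≤ n := by
      have : 2 ≤ n := by omega
      exact_mod_cast this
    -- An order `n ≥ 2` brings the angle `3π / (2n)` into the half-disc, and there the leading term
    -- has negative imaginary part.
    have := key2 (3 * (Real.pi / 2) / n) ⟨by positivity, by
      rw [div_le_iff₀ (by positivity)]; nlinarith⟩
    rw [mul_div_cancel₀ _ hn0, him0] at this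
    have hs : Real.sin (3 * (Real.pi / 2)) = -1 := by
      rw [show 3 * (Real.pi / 2) = Real.pi / 2 + Real.pi by ring, Real.sin_add_pi, Real.sin_pi_div_two]
    rw [hs] at this
    linarith
  subst hn_one
  have hd : HasDerivAt f (g 0) 0 := by
    have h1 : HasDerivAt (fun s => s ^ 1 * g s + f 0) (g 0) 0 := by
      have := ((hasDerivAt_id (0 : ℂ)).mul hg.differentiableAt.hasDerivAt).add_const (f 0)
      simpa using! this
    refine h1.congr_of_eventuallyEq ?_
    filter_upwards [hfg] with s hs
    rw [← hs]; ring
  rwa [hd.deriv]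

/-- The condition on the direction `y` for `Im G > 0` to hold at `x' + i ε y'` for small `ε > 0`
and `(x', y')` near `(x, y)`, when `Im G ≥ 0` on real space. -/
def DesiredDirection (G : C3 → ℂ) (x y : R3) : Prop :=
  0 < (G (realPoint x)).im ∨ 0 < (fderiv ℂ G (realPoint x) (realPoint y)).re

/-- The real part of `s` only moves the base point. A condition on all `x'` near `x` and all small
`ε` therefore controls a whole half-disc of complex multiples `s` of one direction, which brings
one-variable function theory into play. -/
theorem tendsto_line (x y : R3) :
    Tendsto (fun s : ℂ => (x + s.re • y, s.im)) (𝓝[{s | 0 < s.im}] 0) (𝓝 x ×ˢ 𝓝[>] (0 : ℝ)) := by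
  refine Tendsto.prodMk ?_ ?_
  · have : Continuous fun s : ℂ => x + s.re • y := by fun_prop
    simpa using (this.tendsto 0).mono_left nhdsWithin_le_nhds
  · refine tendsto_nhdsWithin_iff.2 ⟨?_, eventually_mem_nhdsWithin⟩
    simpa using (Complex.continuous_im.tendsto 0).mono_left nhdsWithin_le_nhds

theorem hasDerivAt_line {f : C3 → ℂ} {ξ : C3} (s : ℂ) (w : C3)
    (hf : DifferentiableAt ℂ f (ξ + s • w)) :
    HasDerivAt (fun s : ℂ => f (ξ + s • w)) (fderiv ℂ f (ξ + s • w) w) s := by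
  have h1 : HasDerivAt (fun s : ℂ => ξ + s • w) w s := by
    simpa using ((hasDerivAt_id s).smul_const w).const_add ξ
  exact hf.hasFDerivAt.comp_hasDerivAt s h1

theorem analyticAt_line {E : Type*} [NormedAddCommGroup E] [NormedSpace ℂ E] {f : C3 → E} {ξ : C3}
    (w : C3) (hf : AnalyticAt ℂ f ξ) : AnalyticAt ℂ (fun s : ℂ => f (ξ + s • w)) 0 := by
  have h1 : AnalyticAt ℂ (fun s : ℂ => ξ + s • w) 0 := by fun_prop
  exact AnalyticAt.fun_comp (by simpa using hf) h1

/-- If `Im G` vanishes at `x`, Hopf's lemma applies to `s ↦ G(x + s y)`; otherwise there is nothing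
to prove. -/
theorem DesiredDirection.of_eventually {G : C3 → ℂ} {x y : R3} (hG : AnalyticAt ℂ G (realPoint x))
    (h0 : 0 ≤ (G (realPoint x)).im)
    (h : ∀ᶠ q : R3 × ℝ in 𝓝 x ×ˢ 𝓝[>] 0, 0 < (G (complexPoint q.1 (q.2 • y))).im) :
    DesiredDirection G x y := by
  rcases h0.eq_or_lt with h0 | h0
  · right
    have h2 := hasDerivAt_line (f := G) (ξ := realPoint x) 0 (realPoint y)
      (by simpa using hG.differentiableAt)
    simp only [zero_smul, add_zero] at h2
    rw [← h2.deriv]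
    refine hopf_boundary_lemma (analyticAt_line _ hG) ?_ (by simpa using h0.symm)
    have := (tendsto_line x y).eventually h
    rw [eventually_nhdsWithin_iff] at this
    filter_upwards [this] with s hs hs'
    rw [realPoint_add_smul]
    exact hs hs'
  · exact Or.inl h0

theorem isOpen_desiredDirection {G : C3 → ℂ} (hG : ∀ x, AnalyticAt ℂ G (realPoint x)) :
    IsOpen {q : R3 × R3 | DesiredDirection G q.1 q.2} := by
  have h1 : Continuous fun x : R3 => G (realPoint x) := continuous_iff_continuousAt.2 fun x =>
    (hG x).continuousAt.comp realPoint.continuous.continuousAt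
  have h2 : Continuous fun x : R3 => fderiv ℂ G (realPoint x) := continuous_iff_continuousAt.2
    fun x => (hG x).fderiv.continuousAt.comp (f := realPoint) realPoint.continuous.continuousAt
  have h3 : {q : R3 × R3 | DesiredDirection G q.1 q.2} = {q | 0 < (G (realPoint q.1)).im} ∪
      {q | 0 < (fderiv ℂ G (realPoint q.1) (realPoint q.2)).re} := rfl
  rw [h3]
  refine IsOpen.union (isOpen_lt continuous_const ?_) (isOpen_lt continuous_const ?_)
  · exact Complex.continuous_im.comp (h1.comp continuous_fst)
  · exact Complex.continuous_re.comp ((h2.comp continuous_fst).clm_apply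
      (realPoint.continuous.comp continuous_snd))

theorem DesiredDirection.smul {G : C3 → ℂ} {x y : R3} (h : DesiredDirection G x y) {t : ℝ}
    (ht : 0 < t) : DesiredDirection G x (t • y) := by
  refine h.imp id fun h => ?_
  have : realPoint (t • y) = (t : ℂ) • realPoint y := by ext; simp
  rw [this, map_smul, smul_eq_mul, Complex.re_ofReal_mul]
  positivity

theorem convex_desiredDirection (G : C3 → ℂ) (x : R3) : Convex ℝ {y | DesiredDirection G x y} := by
  by_cases h : 0 < (G (realPoint x)).im
  · simpa [DesiredDirection, h] using convex_univ
  · simp only [DesiredDirection, h, false_or]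
    refine convex_halfSpace_gt (f := fun y => (fderiv ℂ G (realPoint x) (realPoint y)).re) ?_ 0
    constructor
    · intro u v; simp
    · intro c u
      have : realPoint (c • u) = (c : ℂ) • realPoint u := by ext; simp
      rw [this, map_smul, smul_eq_mul, Complex.re_ofReal_mul, smul_eq_mul]

/-- Along an imaginary segment, the imaginary part of `f` is controlled by its derivative. -/
theorem exists_im_sub_eq {f : C3 → ℂ} {x y : R3} {ε : ℝ} (hε : 0 < ε)
    (hf : ∀ t ∈ Icc 0 ε, DifferentiableAt ℂ f (complexPoint x (t • y))) :
    ∃ t ∈ Ioo 0 ε, (f (complexPoint x (ε • y))).im - (f (realPoint x)).im =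
      ε * (fderiv ℂ f (complexPoint x (t • y)) (realPoint y)).re := by
  have hp : ∀ t : ℝ, complexPoint x (t • y) = realPoint x + (t : ℂ) • Complex.I • realPoint y := by
    intro t; ext k; simp [complexPoint]; ring
  have hd : ∀ t ∈ Icc 0 ε, HasDerivAt (fun t : ℝ => (f (complexPoint x (t • y))).im)
      (fderiv ℂ f (complexPoint x (t • y)) (realPoint y)).re t := by
    intro t ht
    have h1 := hasDerivAt_line (f := f) (ξ := realPoint x) t (Complex.I • realPoint y)
      (by rw [← hp]; exact hf t ht)
    have h2 := h1.comp_ofReal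
    simp only [← hp, map_smul] at h2
    have h3 := Complex.imCLM.hasFDerivAt.comp_hasDerivAt t h2
    simpa using! h3
  obtain ⟨t, ht, h⟩ := exists_hasDerivAt_eq_slope (fun t : ℝ => (f (complexPoint x (t • y))).im)
    (fun t => (fderiv ℂ f (complexPoint x (t • y)) (realPoint y)).re) hε
    (fun t ht => (hd t ht).continuousAt.continuousWithinAt)
    (fun t ht => hd t (Ioo_subset_Icc_self ht))
  refine ⟨t, ht, ?_⟩
  rw [h]
  simp only [zero_smul, complexPoint_zero_right, sub_zero]
  field_simp

theorem tendsto_complexPoint_smul (x y : R3) :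
    Tendsto (fun q : (R3 × R3) × ℝ => complexPoint q.1.1 (q.2 • q.1.2)) (𝓝 (x, y) ×ˢ 𝓝 0)
      (𝓝 (realPoint x)) := by
  have : Continuous fun q : (R3 × R3) × ℝ => complexPoint q.1.1 (q.2 • q.1.2) :=
    continuous_complexPoint.comp (f := fun q : (R3 × R3) × ℝ => (q.1.1, q.2 • q.1.2)) (by fun_prop)
  have h := this.tendsto ((x, y), 0)
  simpa [nhds_prod_eq, complexPoint_zero_right] using h

/-- Uniformly for small `ε`, the derivative along the imaginary segment is near that at `x`. -/
theorem eventually_forall_Icc_complexPoint {P : C3 → R3 → Prop} {x y : R3}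
    (h : ∀ᶠ q in 𝓝 (realPoint x, y), P q.1 q.2) :
    ∀ᶠ q : (R3 × R3) × ℝ in 𝓝 (x, y) ×ˢ 𝓝[>] 0,
      ∀ t ∈ Icc 0 q.2, P (complexPoint q.1.1 (t • q.1.2)) q.1.2 := by
  have h1 : Tendsto (fun q : (R3 × R3) × ℝ => (complexPoint q.1.1 (q.2 • q.1.2), q.1.2))
      (𝓝 (x, y) ×ˢ 𝓝 0) (𝓝 (realPoint x, y)) := by
    rw [nhds_prod_eq (x := realPoint x)]
    refine (tendsto_complexPoint_smul x y).prodMk ?_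
    exact (continuous_snd.tendsto (x, y)).comp tendsto_fst
  obtain ⟨A, hA, B, hB, hAB⟩ := eventually_prod_iff.1 (h1.eventually h)
  obtain ⟨r, hr, hrB⟩ := Metric.eventually_nhds_iff.1 hB
  refine eventually_prod_iff.2 ⟨A, hA, fun ε => ε ∈ Ioo 0 r, Ioo_mem_nhdsGT hr, ?_⟩
  rintro q hq ε ⟨hε0, hεr⟩ t ⟨ht0, htε⟩
  refine hAB hq (hrB (y := t) ?_)
  rw [Real.dist_eq, sub_zero, abs_of_nonneg ht0]
  exact htε.trans_lt hεr

/-- By the mean value theorem `Im G(x' + iεy')` exceeds `Im G(x')` by `ε` times a derivative that is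
positive near `x`. The base point varies, so `Im G ≥ 0` is needed at all real points, not only at
`x`. -/
theorem DesiredDirection.eventually {G : C3 → ℂ} {x y : R3} (hG : AnalyticAt ℂ G (realPoint x))
    (h0 : ∀ x, 0 ≤ (G (realPoint x)).im) (h : DesiredDirection G x y) :
    ∀ᶠ q : (R3 × R3) × ℝ in 𝓝 (x, y) ×ˢ 𝓝[>] 0,
      0 < (G (complexPoint q.1.1 (q.2 • q.1.2))).im := by
  rcases h with h | h
  · have h1 := (Complex.continuous_im.continuousAt.comp hG.continuousAt).eventually_const_lt h
    exact ((tendsto_complexPoint_smul x y).mono_left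
      (Filter.prod_mono le_rfl nhdsWithin_le_nhds)).eventually h1
  · have h1 : ContinuousAt (fun q : C3 × R3 => (fderiv ℂ G q.1 (realPoint q.2)).re)
        (realPoint x, y) := by
      refine Complex.continuous_re.continuousAt.comp (ContinuousAt.clm_apply ?_ ?_)
      · exact hG.fderiv.continuousAt.comp (f := Prod.fst) (x := (realPoint x, y)) continuousAt_fst
      · exact (realPoint.continuous.comp continuous_snd).continuousAt
    have h2 : ∀ᶠ q : C3 × R3 in 𝓝 (realPoint x, y), DifferentiableAt ℂ G q.1 :=
      (continuous_fst.tendsto (realPoint x, y)).eventually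
        (hG.eventually_analyticAt.mono fun _ h => h.differentiableAt)
    have h3 := eventually_forall_Icc_complexPoint
      (P := fun ξ y => DifferentiableAt ℂ G ξ ∧ 0 < (fderiv ℂ G ξ (realPoint y)).re)
      (h2.and (h1.eventually_const_lt h))
    have h4 : ∀ᶠ q : (R3 × R3) × ℝ in 𝓝 (x, y) ×ˢ 𝓝[>] 0, 0 < q.2 :=
      tendsto_snd.eventually self_mem_nhdsWithin
    filter_upwards [h3, h4] with q hq hε
    obtain ⟨t, ht, he⟩ := exists_im_sub_eq hε fun t ht => (hq t ht).1
    have := (hq t (Ioo_subset_Icc_self ht)).2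
    have h5 := h0 q.1.1
    nlinarith [mul_pos hε this]

/-! ### Directions avoiding a hypersurface: necessary conditions. -/

/-- A form of Hurwitz's theorem: a locally uniform limit of nonvanishing holomorphic functions that
vanishes at a point vanishes identically near that point. -/
theorem eventually_eq_zero_of_tendsto_of_ne_zero {ι : Type*} {l : Filter ι} [l.NeBot]
    {Φ : ι → ℂ → ℂ} {φ : ℂ → ℂ} {U : Set ℂ} {σ₀ : ℂ} (hU : IsOpen U) (hσ₀ : σ₀ ∈ U)
    (hφ : AnalyticAt ℂ φ σ₀) (hφc : ContinuousOn φ U) (hφ0 : φ σ₀ = 0)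
    (hd : ∀ σ ∈ U, ∀ᶠ p in l ×ˢ 𝓝 σ, DifferentiableAt ℂ (Φ p.1) p.2)
    (hne : ∀ σ ∈ U, ∀ᶠ p in l ×ˢ 𝓝 σ, Φ p.1 p.2 ≠ 0)
    (hlim : ∀ σ ∈ U, Tendsto (fun p => Φ p.1 p.2) (l ×ˢ 𝓝 σ) (𝓝 (φ σ))) :
    ∀ᶠ σ in 𝓝 σ₀, φ σ = 0 := by
  rcases hφ.eventually_eq_zero_or_eventually_ne_zero with h | h
  · exact h
  exfalso
  rw [eventually_nhdsWithin_iff] at h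
  obtain ⟨r, hr, hrU⟩ := Metric.nhds_basis_closedBall.eventually_iff.1
    (h.and (hU.eventually_mem hσ₀))
  have hKU : Metric.closedBall σ₀ r ⊆ U := fun σ hσ => (hrU hσ).2
  have hsph : ∀ σ ∈ Metric.sphere σ₀ r, φ σ ≠ 0 := fun σ hσ =>
    (hrU (Metric.sphere_subset_closedBall hσ)).1 (by
      rintro rfl
      simp at hσ
      exact hr.ne hσ)
  have hcs : ContinuousOn (fun σ => ‖φ σ‖) (Metric.sphere σ₀ r) :=
    (hφc.mono (Metric.sphere_subset_closedBall.trans hKU)).norm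
  obtain ⟨σ₁, hσ₁, hmin⟩ := (isCompact_sphere σ₀ r).exists_isMinOn
    (NormedSpace.sphere_nonempty.2 hr.le) hcs
  set m := ‖φ σ₁‖ with hm
  have hm0 : 0 < m := norm_pos_iff.2 (hsph _ hσ₁)
  have hclose : ∀ σ ∈ U, ∀ᶠ p in l ×ˢ 𝓝 σ, ‖Φ p.1 p.2 - φ p.2‖ < m / 2 := by
    intro σ hσ
    have h1 : Tendsto (fun p : ι × ℂ => φ p.2) (l ×ˢ 𝓝 σ) (𝓝 (φ σ)) :=
      (hφc.continuousAt (hU.mem_nhds hσ)).tendsto.comp tendsto_snd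
    have h2 := ((hlim σ hσ).sub h1).norm
    rw [sub_self, norm_zero] at h2
    exact h2.eventually_lt_const (by positivity)
  have hall : ∀ᶠ p in l ×ˢ 𝓝ˢ (Metric.closedBall σ₀ r),
      DifferentiableAt ℂ (Φ p.1) p.2 ∧ Φ p.1 p.2 ≠ 0 ∧ ‖Φ p.1 p.2 - φ p.2‖ < m / 2 :=
    (isCompact_closedBall σ₀ r).mem_prod_nhdsSet_of_forall fun σ hσ =>
      (hd σ (hKU hσ)).and ((hne σ (hKU hσ)).and (hclose σ (hKU hσ)))
  obtain ⟨i, hi⟩ := hall.curry.exists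
  have hi' : ∀ σ ∈ Metric.closedBall σ₀ r,
      DifferentiableAt ℂ (Φ i) σ ∧ Φ i σ ≠ 0 ∧ ‖Φ i σ - φ σ‖ < m / 2 :=
    fun σ hσ => hi.self_of_nhdsSet σ hσ
  -- Maximum principle for `1 / Φ i`: on the circle `|Φ i|` is at least `m / 2`, hence also at the
  -- centre, where it is within `m / 2` of `φ σ₀ = 0`.
  have hdc : DiffContOnCl ℂ (fun σ => (Φ i σ)⁻¹) (Metric.ball σ₀ r) := by
    refine DifferentiableOn.diffContOnCl_ball (U := Metric.closedBall σ₀ r) ?_ subset_rfl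
    exact fun σ hσ => ((hi' σ hσ).1.inv (hi' σ hσ).2.1).differentiableWithinAt
  have hb := Complex.norm_le_of_forall_mem_frontier_norm_le Metric.isBounded_ball hdc
    (C := (m / 2)⁻¹) (by
      intro σ hσ
      rw [frontier_ball σ₀ hr.ne'] at hσ
      have h1 := (hi' σ (Metric.sphere_subset_closedBall hσ)).2.2
      have h2 : m ≤ ‖φ σ‖ := hmin hσ
      have h3 : ‖φ σ‖ ≤ ‖Φ i σ‖ + ‖Φ i σ - φ σ‖ := by
        rw [norm_sub_rev]
        simpa using norm_add_le (Φ i σ) (φ σ - Φ i σ)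
      rw [norm_inv]
      exact inv_anti₀ (by positivity) (by linarith))
    (subset_closure (Metric.mem_ball_self hr))
  obtain ⟨-, h1, h2⟩ := hi' σ₀ (Metric.mem_closedBall_self hr.le)
  rw [hφ0, sub_zero] at h2
  rw [norm_inv, inv_le_inv₀ (norm_pos_iff.2 h1) (by positivity)] at hb
  linarith

/-- The derivative is locally Lipschitz, so the quadratic remainder has one constant for all nearby
base points. This uniformity is needed because the expansions below are made at moving points `x + s
y`. -/
theorem AnalyticAt.exists_norm_sub_sub_fderiv_le {f : C3 → ℂ} {ξ₀ : C3} (hf : AnalyticAt ℂ f ξ₀) :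
    ∃ C : ℝ, ∀ᶠ q : C3 × C3 in 𝓝 (ξ₀, ξ₀),
      ‖f q.2 - f q.1 - fderiv ℂ f q.1 (q.2 - q.1)‖ ≤ C * ‖q.2 - q.1‖ ^ 2 := by
  obtain ⟨K, t, ht, hK⟩ := (hf.fderiv.contDiffAt (n := 1)).exists_lipschitzOnWith
  have h1 := hf.eventually_analyticAt
  obtain ⟨r, hr, hrt⟩ := Metric.eventually_nhds_iff_ball.1 (h1.and ht)
  refine ⟨K, ?_⟩
  have h2 : Metric.ball ξ₀ r ×ˢ Metric.ball ξ₀ r ∈ 𝓝 (ξ₀, ξ₀) :=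
    prod_mem_nhds (Metric.ball_mem_nhds _ hr) (Metric.ball_mem_nhds _ hr)
  filter_upwards [h2] with q hq
  have hs : segment ℝ q.1 q.2 ⊆ Metric.ball ξ₀ r := (convex_ball ξ₀ r).segment_subset hq.1 hq.2
  have h3 := (convex_segment (𝕜 := ℝ) q.1 q.2).norm_image_sub_le_of_norm_hasFDerivWithin_le'
    (𝕜 := ℂ) (f := f) (f' := fderiv ℂ f) (φ := fderiv ℂ f q.1) (C := K * ‖q.2 - q.1‖)
    (fun z hz => (hrt z (hs hz)).1.differentiableAt.hasFDerivAt.hasFDerivWithinAt)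
    (fun z hz => by
      refine (hK.norm_sub_le (hrt z (hs hz)).2 (hrt _ hq.1).2).trans ?_
      gcongr
      obtain ⟨θ, hθ, rfl⟩ := (segment_eq_image' ℝ q.1 q.2) ▸ hz
      rw [add_sub_cancel_left, norm_smul, Real.norm_of_nonneg hθ.1]
      exact mul_le_of_le_one_left (norm_nonneg _) hθ.2)
    (left_mem_segment ℝ _ _) (right_mem_segment ℝ _ _)
  linarith

/-- A `2n`-th root of `c ^ 2`, whose argument is chosen in `(0, 2π]`, has argument in `(0, π / n]`;
this lies inside `(0, π)` since `n ≥ 2`. The free sign is what makes room for a root in the upper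
half-plane. -/
theorem exists_pow_sq_eq {c : ℂ} (hc : c ≠ 0) {n : ℕ} (hn : 2 ≤ n) :
    ∃ σ : ℂ, 0 < σ.im ∧ (σ ^ n = c ∨ σ ^ n = -c) := by
  obtain ⟨θ, hθ, hθc⟩ : ∃ θ ∈ Ioc 0 (2 * Real.pi),
      Complex.exp (Complex.log ‖c ^ 2‖ + θ * Complex.I) = c ^ 2 := by
    have h0 : (‖c ^ 2‖ : ℂ) ≠ 0 := by simpa using hc
    have h1 := Complex.norm_mul_exp_arg_mul_I (c ^ 2)
    have h2 := Complex.neg_pi_lt_arg (c ^ 2)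
    have h3 := Complex.arg_le_pi (c ^ 2)
    have hpi := Real.pi_pos
    rcases le_or_gt (Complex.arg (c ^ 2)) 0 with h | h
    · refine ⟨Complex.arg (c ^ 2) + 2 * Real.pi, ⟨by linarith, by linarith⟩, ?_⟩
      rw [Complex.exp_add, Complex.exp_log h0]
      push_cast
      rw [add_mul, Complex.exp_add, Complex.exp_two_pi_mul_I, mul_one, h1]
    · exact ⟨Complex.arg (c ^ 2), ⟨h, by linarith⟩, by rw [Complex.exp_add, Complex.exp_log h0, h1]⟩
  have hn0 : (n : ℂ) ≠ 0 := by
    have : n ≠ 0 := by omega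
    exact_mod_cast this
  have hn2 : (2 : ℝ) ≤ n := by exact_mod_cast hn
  refine ⟨Complex.exp ((Complex.log ‖c ^ 2‖ + θ * Complex.I) / (2 * n)), ?_, ?_⟩
  · have h1 : (Complex.log ‖c ^ 2‖ + θ * Complex.I) / (2 * n) =
        ((Real.log ‖c ^ 2‖ / (2 * n) : ℝ) : ℂ) + ((θ / (2 * n) : ℝ) : ℂ) * Complex.I := by
      rw [← Complex.ofReal_log (norm_nonneg _)]
      push_cast
      ring
    rw [h1, Complex.exp_add, ← Complex.ofReal_exp, Complex.im_ofReal_mul,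
      Complex.exp_ofReal_mul_I_im]
    refine mul_pos (Real.exp_pos _) (Real.sin_pos_of_mem_Ioo ⟨?_, ?_⟩)
    · have := hθ.1
      positivity
    · rw [div_lt_iff₀ (by positivity)]
      nlinarith [hθ.2, Real.pi_pos]
  · apply sq_eq_sq_iff_eq_or_eq_neg.1
    rw [← pow_mul, ← Complex.exp_nat_mul]
    refine Eq.trans ?_ hθc
    congr 1
    push_cast
    field_simp

/-- The zeros of `t ↦ f (x + t v + s y)`, which are of the order of a power `s ^ p` with `p ≥ 2`,
cannot all avoid the real line for nonreal `s`. -/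
theorem false_of_order_lt {f : C3 → ℂ} {x y v : R3} (hf : AnalyticAt ℂ f (realPoint x))
    (hw : ∀ᶠ q : R3 × ℝ in 𝓝 x ×ˢ 𝓝[>] 0, f (complexPoint q.1 (q.2 • y)) ≠ 0)
    {k m : ℕ} (hkm : m + 2 ≤ k) (hmk : 2 * m < k) {e d : ℂ → ℂ} (hec : ContinuousAt e 0)
    (hdc : ContinuousAt d 0) (he0 : e 0 ≠ 0) (hd0 : d 0 ≠ 0)
    (he : ∀ᶠ s in 𝓝 (0 : ℂ), f (realPoint x + s • realPoint y) = s ^ k * e s)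
    (hd : ∀ᶠ s in 𝓝 (0 : ℂ),
      fderiv ℂ f (realPoint x + s • realPoint y) (realPoint v) = s ^ m * d s) : False := by
  obtain ⟨p, rfl⟩ : ∃ p, k = m + p := ⟨k - m, by omega⟩
  have hp : 2 ≤ p := by omega
  obtain ⟨σ₀, hσ₀, hσ⟩ := exists_pow_sq_eq (div_ne_zero hd0 he0) hp
  -- The sign of the perturbation along `v` is chosen so that the limit function has a zero in the
  -- upper half-plane.
  obtain ⟨ς, hς, hς0⟩ : ∃ ς : ℝ, e 0 * σ₀ ^ p + ς * d 0 = 0 ∧ ς ≠ 0 := by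
    rcases hσ with h | h
    · exact ⟨-1, by rw [h]; field_simp; push_cast; ring, by norm_num⟩
    · exact ⟨1, by rw [h]; field_simp; push_cast; ring, by norm_num⟩
  set φ : ℂ → ℂ := fun σ => σ ^ m * (e 0 * σ ^ p + ς * d 0) with hφ
  have hφa : AnalyticAt ℂ φ σ₀ := by simp only [hφ]; fun_prop
  have hσne : σ₀ ≠ 0 := by rintro rfl; simp at hσ₀
  -- With `s = tσ` and a real shift of size `t ^ p` along `v`, the terms `s ^ (m + p) e` and `t ^ p
  -- s ^ m d` have the same order `t ^ (m + p)`. The limit after division is `φ`.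
  set Φ : ℝ → ℂ → ℂ := fun t σ => ((t : ℂ) ^ (m + p))⁻¹ *
    f (realPoint x + (t * σ) • realPoint y + ((ς * t ^ p : ℝ) : ℂ) • realPoint v) with hΦ
  obtain ⟨C, hC⟩ := hf.exists_norm_sub_sub_fderiv_le
  have hA : ∀ σ : ℂ, Tendsto (fun q : ℝ × ℂ => (q.1 : ℂ) * q.2) (𝓝[>] 0 ×ˢ 𝓝 σ) (𝓝 0) := by
    intro σ
    have : Continuous fun q : ℝ × ℂ => (q.1 : ℂ) * q.2 := by fun_prop
    have h1 := this.tendsto (0, σ)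
    rw [nhds_prod_eq] at h1
    simpa using h1.mono_left (Filter.prod_mono nhdsWithin_le_nhds le_rfl)
  have hB : ∀ σ : ℂ, Tendsto (fun q : ℝ × ℂ => realPoint x + (q.1 * q.2) • realPoint y)
      (𝓝[>] 0 ×ˢ 𝓝 σ) (𝓝 (realPoint x)) := by
    intro σ
    simpa using ((hA σ).smul_const (realPoint y)).const_add (realPoint x)
  have hB' : ∀ σ : ℂ, Tendsto (fun q : ℝ × ℂ => realPoint x + (q.1 * q.2) • realPoint y +
      ((ς * q.1 ^ p : ℝ) : ℂ) • realPoint v) (𝓝[>] 0 ×ˢ 𝓝 σ) (𝓝 (realPoint x)) := by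
    intro σ
    have : Continuous fun q : ℝ × ℂ => ((ς * q.1 ^ p : ℝ) : ℂ) • realPoint v := by fun_prop
    have h1 := this.tendsto (0, σ)
    rw [nhds_prod_eq] at h1
    have h2 := (hB σ).add (h1.mono_left (Filter.prod_mono nhdsWithin_le_nhds le_rfl))
    simpa [show p ≠ 0 by omega] using h2
  have hpos : ∀ σ : ℂ, ∀ᶠ q : ℝ × ℂ in 𝓝[>] 0 ×ˢ 𝓝 σ, 0 < q.1 := fun σ =>
    tendsto_fst.eventually self_mem_nhdsWithin
  have hz := eventually_eq_zero_of_tendsto_of_ne_zero (l := 𝓝[>] (0 : ℝ)) (Φ := Φ) (φ := φ)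
    (U := {σ | 0 < σ.im}) (isOpen_lt continuous_const Complex.continuous_im) hσ₀ hφa
    (by simp only [hφ]; fun_prop) (by simp [hφ, hς]) ?_ ?_ ?_
  · have h1 : ∀ᶠ σ in 𝓝 σ₀, e 0 * σ ^ p + ς * d 0 = 0 := by
      filter_upwards [hz, isOpen_ne.eventually_mem hσne] with σ h2 h3
      exact (mul_eq_zero.1 h2).resolve_left (pow_ne_zero _ h3)
    have h2 : HasDerivAt (fun σ : ℂ => e 0 * σ ^ p + ς * d 0) (e 0 * (p * σ₀ ^ (p - 1))) σ₀ :=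
      ((hasDerivAt_pow p σ₀).const_mul (e 0)).add_const _
    have h3 : HasDerivAt (fun _ : ℂ => (0 : ℂ)) (e 0 * (p * σ₀ ^ (p - 1))) σ₀ :=
      h2.congr_of_eventuallyEq (h1.mono fun _ h => h.symm)
    have h4 := h3.unique (hasDerivAt_const σ₀ (0 : ℂ))
    have h5 : (p : ℂ) ≠ 0 := by
      have : p ≠ 0 := by omega
      exact_mod_cast this
    exact mul_ne_zero he0 (mul_ne_zero h5 (pow_ne_zero _ hσne)) h4
  · intro σ _
    filter_upwards [(hB' σ).eventually hf.eventually_analyticAt] with q hq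
    have := hq.differentiableAt
    simp only [hΦ]
    refine DifferentiableAt.const_mul ?_ _
    exact DifferentiableAt.fun_comp' (g := f) q.2 this (by fun_prop)
  · intro σ hσ
    have h1 : Tendsto (fun q : ℝ × ℂ => (x + (ς * q.1 ^ p) • v + (q.1 * q.2 : ℂ).re • y,
        (q.1 * q.2 : ℂ).im)) (𝓝[>] 0 ×ˢ 𝓝 σ) (𝓝 x ×ˢ 𝓝[>] 0) := by
      refine Tendsto.prodMk ?_ (tendsto_nhdsWithin_iff.2 ⟨?_, ?_⟩)
      · have : Continuous fun q : ℝ × ℂ => x + (ς * q.1 ^ p) • v + (q.1 * q.2 : ℂ).re • y := by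
          fun_prop
        have h1 := this.tendsto (0, σ)
        rw [nhds_prod_eq] at h1
        simpa [show p ≠ 0 by omega] using
          h1.mono_left (Filter.prod_mono nhdsWithin_le_nhds le_rfl)
      · have h1 := (Complex.continuous_im.tendsto 0).comp (hA σ)
        rwa [Complex.zero_im] at h1
      · have h2 : ∀ᶠ q : ℝ × ℂ in 𝓝[>] 0 ×ˢ 𝓝 σ, 0 < q.2.im := tendsto_snd.eventually
          ((isOpen_lt continuous_const Complex.continuous_im).eventually_mem hσ)
        filter_upwards [h2, hpos σ] with q h3 h4
        rw [mem_Ioi, Complex.im_ofReal_mul]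
        positivity
    filter_upwards [h1.eventually hw, hpos σ] with q h2 h3
    refine mul_ne_zero (inv_ne_zero (pow_ne_zero _ (by exact_mod_cast h3.ne'))) ?_
    convert h2 using 2
    rw [← realPoint_add_smul]
    ext i
    simp
    ring
  · intro σ _
    have hR : Tendsto (fun q : ℝ × ℂ => Φ q.1 q.2 - (q.2 ^ (m + p) * e (q.1 * q.2) +
        ς * q.2 ^ m * d (q.1 * q.2))) (𝓝[>] 0 ×ˢ 𝓝 σ) (𝓝 0) := by
      -- The remainder is quadratic in the shift, of order `t ^ (2p)`. It is negligible against `t ^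
      -- (m + p)` because `2m < k` means `m < p`.
      have h1 : Tendsto (fun q : ℝ × ℂ => C * (|ς| * ‖v‖) ^ 2 * q.1 ^ (p - m)) (𝓝[>] 0 ×ˢ 𝓝 σ)
          (𝓝 0) := by
        have : Continuous fun t : ℝ => C * (|ς| * ‖v‖) ^ 2 * t ^ (p - m) := by fun_prop
        have h2 := (this.tendsto 0).mono_left (nhdsWithin_le_nhds (s := Ioi 0))
        rw [zero_pow (by omega), mul_zero] at h2
        exact h2.comp tendsto_fst
      refine squeeze_zero_norm' ?_ h1
      filter_upwards [((hB σ).prodMk_nhds (hB' σ)).eventually hC, (hA σ).eventually he,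
        (hA σ).eventually hd, hpos σ] with q h2 h3 h4 h5
      have h5' : (q.1 : ℂ) ≠ 0 := by exact_mod_cast h5.ne'
      rw [add_sub_cancel_left, map_smul, h3, h4, norm_smul, norm_realPoint, Complex.norm_real,
        Real.norm_eq_abs, abs_mul, abs_of_nonneg (by positivity : 0 ≤ q.1 ^ p)] at h2
      have h6 : Φ q.1 q.2 - (q.2 ^ (m + p) * e (q.1 * q.2) + ς * q.2 ^ m * d (q.1 * q.2)) =
          ((q.1 : ℂ) ^ (m + p))⁻¹ * (f (realPoint x + (q.1 * q.2) • realPoint y +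
            ((ς * q.1 ^ p : ℝ) : ℂ) • realPoint v) - (q.1 * q.2) ^ (m + p) * e (q.1 * q.2) -
            ((ς * q.1 ^ p : ℝ) : ℂ) • ((q.1 * q.2) ^ m * d (q.1 * q.2))) := by
        simp only [hΦ, smul_eq_mul]
        push_cast
        field_simp
        ring
      rw [h6, norm_mul, norm_inv, norm_pow, Complex.norm_real, Real.norm_of_nonneg h5.le]
      calc (q.1 ^ (m + p))⁻¹ * _ ≤ (q.1 ^ (m + p))⁻¹ * (C * (|ς| * q.1 ^ p * ‖v‖) ^ 2) := by
            gcongr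
        _ = C * (|ς| * ‖v‖) ^ 2 * q.1 ^ (p - m) := by
            obtain ⟨r, rfl⟩ : ∃ r, p = m + r := ⟨p - m, by omega⟩
            rw [Nat.add_sub_cancel_left]
            field_simp
            ring
    have hM : Tendsto (fun q : ℝ × ℂ => q.2 ^ (m + p) * e (q.1 * q.2) +
        ς * q.2 ^ m * d (q.1 * q.2)) (𝓝[>] 0 ×ˢ 𝓝 σ) (𝓝 (σ ^ (m + p) * e 0 + ς * σ ^ m * d 0)) := by
      have h1 : Tendsto (fun q : ℝ × ℂ => q.2) (𝓝[>] 0 ×ˢ 𝓝 σ) (𝓝 σ) := tendsto_snd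
      exact ((h1.pow _).mul (hec.tendsto.comp (hA σ))).add
        (((h1.pow _).const_mul _).mul (hdc.tendsto.comp (hA σ)))
    have := hR.add hM
    simp only [sub_add_cancel] at this
    convert this using 2
    simp only [hφ]
    ring

theorem AnalyticAt.exists_eq_pow_mul {h : ℂ → ℂ} (hh : AnalyticAt ℂ h 0)
    (hne : ¬ ∀ᶠ s in 𝓝 (0 : ℂ), h s = 0) :
    ∃ (n : ℕ) (e : ℂ → ℂ), AnalyticAt ℂ e 0 ∧ e 0 ≠ 0 ∧ ∀ᶠ s in 𝓝 (0 : ℂ), h s = s ^ n * e s := by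
  obtain ⟨n, e, he, he0, hhe⟩ := hh.exists_eventuallyEq_pow_smul_nonzero_iff.2 hne
  exact ⟨n, e, he, he0, by simpa using hhe⟩

theorem deriv_of_eq_pow_mul {h e : ℂ → ℂ} {n : ℕ} (hn : n ≠ 0) (he : AnalyticAt ℂ e 0)
    (hhe : ∀ᶠ s in 𝓝 (0 : ℂ), h s = s ^ n * e s) :
    ∀ᶠ s in 𝓝 (0 : ℂ), deriv h s = s ^ (n - 1) * (n * e s + s * deriv e s) := by
  filter_upwards [hhe.eventually_nhds, he.eventually_analyticAt] with s hs hes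
  rw [EventuallyEq.deriv_eq (show h =ᶠ[𝓝 s] fun s => s ^ n * e s from hs)]
  have := (hasDerivAt_pow n s).mul hes.differentiableAt.hasDerivAt
  obtain ⟨r, rfl⟩ : ∃ r, n = r + 1 := ⟨n - 1, by omega⟩
  rw [HasDerivAt.deriv (f := fun s => s ^ (r + 1) * e s) this]
  simp only [Nat.add_sub_cancel]
  ring

theorem two_le_of_eq_pow_mul {h e : ℂ → ℂ} {n : ℕ} (he : AnalyticAt ℂ e 0) (he0 : e 0 ≠ 0)
    (hhe : ∀ᶠ s in 𝓝 (0 : ℂ), h s = s ^ n * e s) (h0 : h 0 = 0) (h1 : deriv h 0 = 0) : 2 ≤ n := by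
  have hn : n ≠ 0 := by
    rintro rfl
    have := hhe.self_of_nhds
    simp [h0] at this
    exact he0 this.symm
  by_contra hn2
  obtain rfl : n = 1 := by omega
  have := (deriv_of_eq_pow_mul one_ne_zero he hhe).self_of_nhds
  simp [h1] at this
  exact he0 this.symm

theorem three_le_of_eq_pow_mul {h e : ℂ → ℂ} {n : ℕ} (he : AnalyticAt ℂ e 0) (he0 : e 0 ≠ 0)
    (hhe : ∀ᶠ s in 𝓝 (0 : ℂ), h s = s ^ n * e s) (h0 : h 0 = 0) (h1 : deriv h 0 = 0)
    (h2 : deriv (deriv h) 0 = 0) : 3 ≤ n := by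
  have hn := two_le_of_eq_pow_mul he he0 hhe h0 h1
  have hd := deriv_of_eq_pow_mul (by omega) he hhe
  have := two_le_of_eq_pow_mul (h := deriv h) (e := fun s => n * e s + s * deriv e s) (n := n - 1)
    ((analyticAt_const.mul he).add (analyticAt_id.mul he.deriv))
    (by simpa using ⟨by omega, he0⟩) hd h1 h2
  omega

theorem eq_one_of_eq_pow_mul {h e : ℂ → ℂ} {n : ℕ} (he : AnalyticAt ℂ e 0) (he0 : e 0 ≠ 0)
    (hhe : ∀ᶠ s in 𝓝 (0 : ℂ), h s = s ^ n * e s) (h0 : h 0 = 0) (h1 : deriv h 0 ≠ 0) : n = 1 := by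
  have hn : n ≠ 0 := by
    rintro rfl
    have := hhe.self_of_nhds
    simp [h0] at this
    exact he0 this.symm
  by_contra hn2
  have := (deriv_of_eq_pow_mul hn he hhe).self_of_nhds
  rw [zero_pow (by omega), zero_mul] at this
  exact h1 this

theorem realPoint_smul (t : ℝ) (x : R3) : realPoint (t • x) = (t : ℂ) • realPoint x := by
  ext; simp

theorem exists_realPoint_ne_zero {A : C3 →L[ℂ] ℂ} (hA : A ≠ 0) : ∃ v : R3, A (realPoint v) ≠ 0 := by
  by_contra! h
  refine hA (ContinuousLinearMap.ext fun w => ?_)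
  have h1 : w = realPoint (fun k => (w k).re) + Complex.I • realPoint (fun k => (w k).im) := by
    ext k
    simp [mul_comm Complex.I, Complex.re_add_im]
  rw [h1, map_add, map_smul, h, h]
  simp

section Directions

variable {f : C3 → ℂ} {x y : R3}

theorem not_eventually_line_eq_zero
    (hw : ∀ᶠ q : R3 × ℝ in 𝓝 x ×ˢ 𝓝[>] 0, f (complexPoint q.1 (q.2 • y)) ≠ 0) :
    ¬ ∀ᶠ s in 𝓝 (0 : ℂ), f (realPoint x + s • realPoint y) = 0 := by
  intro h
  have h1 := ((tendsto_line x y).eventually hw)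
  have h2 : (𝓝[{s : ℂ | 0 < s.im}] 0).NeBot := by
    refine mem_closure_iff_nhdsWithin_neBot.1 ?_
    rw [Complex.closure_setOfPred_lt_im]
    simp
  obtain ⟨s, h3, h4⟩ := (h1.and (h.filter_mono nhdsWithin_le_nhds)).exists
  rw [realPoint_add_smul] at h4
  exact h3 h4

/-- At a regular point of `{f = 0}`, the directions that locally avoid `{f = 0}` are transversal. -/
theorem fderiv_realPoint_ne_zero (hf : AnalyticAt ℂ f (realPoint x)) (h0 : f (realPoint x) = 0)
    (hd : fderiv ℂ f (realPoint x) ≠ 0)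
    (hw : ∀ᶠ q : R3 × ℝ in 𝓝 x ×ˢ 𝓝[>] 0, f (complexPoint q.1 (q.2 • y)) ≠ 0) :
    fderiv ℂ f (realPoint x) (realPoint y) ≠ 0 := by
  intro hy
  obtain ⟨v, hv⟩ := exists_realPoint_ne_zero hd
  obtain ⟨k, e, he, he0, hfe⟩ := (analyticAt_line (realPoint y) hf).exists_eq_pow_mul
    (not_eventually_line_eq_zero hw)
  have h1 := (hasDerivAt_line (f := f) (ξ := realPoint x) 0 (realPoint y)
    (by simpa using hf.differentiableAt)).deriv
  have hk := two_le_of_eq_pow_mul he he0 hfe (by simpa using h0) (by rw [h1]; simpa using hy)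
  -- For a tangential direction `f` has order at least two along the line, while the derivative
  -- along `v` does not vanish at `x`, hence has order `0`.
  refine false_of_order_lt hf hw (m := 0) (v := v) (by omega) (by omega) he.continuousAt
    (d := fun s => fderiv ℂ f (realPoint x + s • realPoint y) (realPoint v)) ?_ he0 (by simpa) hfe
    (by simp)
  exact ((analyticAt_line (realPoint y) hf.fderiv).continuousAt).clm_apply continuousAt_const

theorem deriv_fderiv_line (hf : AnalyticAt ℂ f (realPoint x)) (u v : C3) :
    deriv (fun s : ℂ => fderiv ℂ f (realPoint x + s • u) v) 0 =
      fderiv ℂ (fderiv ℂ f) (realPoint x) u v := by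
  have h1 : HasDerivAt (fun s : ℂ => realPoint x + s • u) u 0 := by
    simpa using ((hasDerivAt_id (0 : ℂ)).smul_const u).const_add (realPoint x)
  have h2 : HasFDerivAt (fderiv ℂ f) (fderiv ℂ (fderiv ℂ f) (realPoint x))
      (realPoint x + (0 : ℂ) • u) := by simpa using hf.fderiv.differentiableAt.hasFDerivAt
  have h3 : HasDerivAt (fun s : ℂ => fderiv ℂ f (realPoint x + s • u))
      (fderiv ℂ (fderiv ℂ f) (realPoint x) u) 0 := h2.comp_hasDerivAt 0 h1
  exact (h3.clm_apply (hasDerivAt_const 0 v)).deriv.trans (by rw [map_zero, add_zero])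

/-- At a nondegenerate critical point of `f`, directions that locally avoid `{f = 0}` are not
isotropic for the Hessian. -/
theorem hessian_self_ne_zero (hf : AnalyticAt ℂ f (realPoint x)) (h0 : f (realPoint x) = 0)
    (hd : fderiv ℂ f (realPoint x) = 0)
    (hH : ∀ u : R3, u ≠ 0 →
      ∃ v : R3, fderiv ℂ (fderiv ℂ f) (realPoint x) (realPoint u) (realPoint v) ≠ 0)
    (hw : ∀ᶠ q : R3 × ℝ in 𝓝 x ×ˢ 𝓝[>] 0, f (complexPoint q.1 (q.2 • y)) ≠ 0) :
    fderiv ℂ (fderiv ℂ f) (realPoint x) (realPoint y) (realPoint y) ≠ 0 := by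
  intro hyy
  have hne := not_eventually_line_eq_zero hw
  have hy : y ≠ 0 := by
    rintro rfl
    simp [h0] at hne
  obtain ⟨v, hv⟩ := hH y hy
  obtain ⟨k, e, he, he0, hfe⟩ := (analyticAt_line (realPoint y) hf).exists_eq_pow_mul hne
  have h1 : deriv (fun s : ℂ => f (realPoint x + s • realPoint y)) =ᶠ[𝓝 0]
      fun s => fderiv ℂ f (realPoint x + s • realPoint y) (realPoint y) := by
    have : Tendsto (fun s : ℂ => realPoint x + s • realPoint y) (𝓝 0) (𝓝 (realPoint x)) := by
      have : Continuous fun s : ℂ => realPoint x + s • realPoint y := by fun_prop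
      simpa using this.tendsto 0
    filter_upwards [this.eventually hf.eventually_analyticAt] with s hs
    exact (hasDerivAt_line s (realPoint y) hs.differentiableAt).deriv
  have hk := three_le_of_eq_pow_mul he he0 hfe (by simpa using h0)
    (by rw [h1.self_of_nhds]; simp [hd]) (by rw [h1.deriv_eq, deriv_fderiv_line hf, hyy])
  have hDa : AnalyticAt ℂ (fun s : ℂ => fderiv ℂ f (realPoint x + s • realPoint y) (realPoint v)) 0 :=
    (ContinuousLinearMap.apply ℂ ℂ (realPoint v)).analyticAt _ |>.fun_comp
      (analyticAt_line (realPoint y) hf.fderiv)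
  have hDd := deriv_fderiv_line hf (realPoint y) (realPoint v)
  -- For an isotropic direction `f` has order at least three along the line, while `df(v)` has order
  -- exactly one since the Hessian pairs `y` and `v` nontrivially.
  obtain ⟨m, d, hda, hd0, hde⟩ := hDa.exists_eq_pow_mul (by
    intro h
    have := EventuallyEq.deriv_eq (f := fun _ : ℂ => (0 : ℂ)) h
    rw [hDd, deriv_const] at this
    exact hv this)
  obtain rfl := eq_one_of_eq_pow_mul hda hd0 hde (by simp [hd]) (by rwa [hDd])
  exact false_of_order_lt hf hw (m := 1) (by omega) (by omega) he.continuousAt hda.continuousAt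
    he0 hd0 hfe hde

/-- Second order Taylor expansion at a critical zero. -/
theorem isLittleO_sub_hessian {ξ : C3} (hf : AnalyticAt ℂ f ξ) (h0 : f ξ = 0)
    (hd : fderiv ℂ f ξ = 0) :
    (fun w => f (ξ + w) - (1 / 2 : ℂ) * fderiv ℂ (fderiv ℂ f) ξ w w) =o[𝓝 0] fun w => ‖w‖ ^ 2 := by
  set D := fderiv ℂ (fderiv ℂ f) ξ with hD
  rw [Asymptotics.isLittleO_iff]
  intro c hc
  have h1 : (fun w => fderiv ℂ f (ξ + w) - D w) =o[𝓝 0] fun w => w := by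
    have := hasFDerivAt_iff_isLittleO_nhds_zero.1 hf.fderiv.differentiableAt.hasFDerivAt
    simpa [hd] using this
  have h2 : Tendsto (fun w => ξ + w) (𝓝 0) (𝓝 ξ) := by
    simpa using (continuous_const_add ξ).tendsto 0
  have h3 := (Asymptotics.isLittleO_iff.1 h1 hc).and (h2.eventually hf.eventually_analyticAt)
  obtain ⟨r, hr, hrw⟩ := Metric.eventually_nhds_iff_ball.1 h3
  filter_upwards [Metric.ball_mem_nhds 0 hr] with w hw
  have hmem : ∀ t ∈ Icc (0 : ℝ) 1, (t : ℂ) • w ∈ Metric.ball (0 : C3) r := by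
    intro t ht
    rw [mem_ball_zero_iff] at hw ⊢
    rw [norm_smul, Complex.norm_real, Real.norm_of_nonneg ht.1]
    exact (mul_le_of_le_one_left (norm_nonneg _) ht.2).trans_lt hw
  have hder : ∀ t ∈ Icc (0 : ℝ) 1,
      HasDerivAt (fun t : ℝ => f (ξ + (t : ℂ) • w) - (1 / 2 : ℂ) * (t ^ 2 * D w w))
        (fderiv ℂ f (ξ + (t : ℂ) • w) w - t * D w w) t := by
    intro t ht
    have h4 := (hasDerivAt_line (t : ℂ) w (hrw _ (hmem t ht)).2.differentiableAt).sub
      ((((hasDerivAt_id (t : ℂ)).pow 2).mul_const (D w w)).const_mul (1 / 2 : ℂ))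
    have h5 := h4.comp_ofReal
    refine h5.congr_deriv ?_
    simp
    ring
  have := norm_image_sub_le_of_norm_deriv_le_segment_01' (C := c * ‖w‖ ^ 2)
    (fun t ht => (hder t ht).hasDerivWithinAt) (fun t ht => by
      have h4 := (hrw _ (hmem t (Ico_subset_Icc_self ht))).1
      have h5 : fderiv ℂ f (ξ + (t : ℂ) • w) w - t * D w w =
          (fderiv ℂ f (ξ + (t : ℂ) • w) - D ((t : ℂ) • w)) w := by simp
      rw [h5]
      refine ((fderiv ℂ f (ξ + (t : ℂ) • w) - D ((t : ℂ) • w)).le_opNorm w).trans ?_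
      rw [norm_smul, Complex.norm_real, Real.norm_of_nonneg ht.1] at h4
      have h6 : t * ‖w‖ ≤ ‖w‖ := mul_le_of_le_one_left (norm_nonneg _) ht.2.le
      calc _ ≤ (c * (t * ‖w‖)) * ‖w‖ := by gcongr
        _ ≤ c * ‖w‖ * ‖w‖ := by gcongr
        _ = _ := by ring)
  simpa [h0] using this

end Directions

/-! ### Timelike vectors. -/

/-- `y` is timelike for the quadratic form `q`: `q` is nonzero at `y` and has the opposite sign on
the orthogonal complement of `y`. -/
def IsTimelike {V : Type*} [AddCommGroup V] [Module ℝ V] (q : V →ₗ[ℝ] V →ₗ[ℝ] ℝ) (y : V) : Prop :=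
  q y y ≠ 0 ∧ ∀ v, v ≠ 0 → q v y = 0 → q v v * q y y < 0

section Timelike

variable {V : Type*} [AddCommGroup V] [Module ℝ V] {q : V →ₗ[ℝ] V →ₗ[ℝ] ℝ}

/-- If some `v ≠ 0` orthogonal to `w` had the weakly wrong sign, the form would be semidefinite,
with the sign of `q y y`, on the span of `v` and `w`. That span contains a vector orthogonal to `y`,
where the sign must be the opposite one. -/
theorem IsTimelike.of_mul_pos (hq : ∀ u v, q u v = q v u) {y w : V} (hy : IsTimelike q y)
    (hw : 0 < q w w * q y y) : IsTimelike q w := by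
  have hww : q w w ≠ 0 := by rintro h; simp [h] at hw
  have hw0 : w ≠ 0 := by rintro rfl; simp at hww
  refine ⟨hww, fun v hv hvw => ?_⟩
  by_contra! hcon
  have hvv : 0 ≤ q v v * q y y := by
    by_contra! h
    nlinarith [mul_neg_of_neg_of_pos h hw, mul_nonneg hcon (mul_self_nonneg (q y y))]
  -- This combination is orthogonal to `y`.
  set u := q w y • v - q v y • w with hu
  have huy : q u y = 0 := by simp [hu]; ring
  have hwv : q w v = 0 := by rw [hq, hvw]
  have huu : q u u = q w y ^ 2 * q v v + q v y ^ 2 * q w w := by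
    simp [hu, hvw, hwv]; ring
  by_cases hu0 : u = 0
  · have hwy : q w y ≠ 0 := fun h => by nlinarith [hy.2 w hw0 h]
    have h1 : q u w = 0 := by rw [hu0]; simp
    simp [hu, hvw, hww] at h1
    rw [hu, h1, zero_smul, sub_zero] at hu0
    exact hv ((smul_eq_zero.1 hu0).resolve_left hwy)
  · have := hy.2 u hu0 huy
    rw [huu] at this
    nlinarith [mul_nonneg (sq_nonneg (q w y)) hvv, mul_nonneg (sq_nonneg (q v y)) hw.le]

theorem mul_pos_of_continuous_of_ne_zero {X : Type*} [TopologicalSpace X] [PreconnectedSpace X]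
    {g : X → ℝ} (hg : Continuous g) (h0 : ∀ t, g t ≠ 0) (s t : X) : 0 < g s * g t := by
  by_contra! h
  have h1 : (0 : ℝ) ∈ range g := by
    rcases le_or_gt (g s) 0 with hs | hs
    · rcases le_or_gt 0 (g t) with ht | ht
      · exact mem_range_of_exists_le_of_exists_ge hg ⟨s, hs⟩ ⟨t, ht⟩
      · have := mul_pos_of_neg_of_neg (lt_of_le_of_ne hs (h0 s)) ht
        linarith
    · refine mem_range_of_exists_le_of_exists_ge hg ⟨t, ?_⟩ ⟨s, hs.le⟩
      by_contra! ht
      nlinarith [mul_pos hs ht]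
  obtain ⟨u, hu⟩ := h1
  exact h0 u hu

/-- Along a timelike path neither `q (γ t) (γ t)` nor `q (γ t) y₁` can change sign, the latter
because a vector orthogonal to `y₁` has the wrong sign. So the endpoints lie in the same nappe of
the cone, and `q` has no cancellation on the segment between them. -/
theorem IsTimelike.segment_subset [TopologicalSpace V] (hq : ∀ u v, q u v = q v u)
    (hqc : Continuous fun p : V × V => q p.1 p.2) {y₁ y₂ : V}
    (h : JoinedIn {y | IsTimelike q y} y₁ y₂) : segment ℝ y₁ y₂ ⊆ {y | IsTimelike q y} := by
  obtain ⟨γ, hγ⟩ := h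
  have hγ0 : IsTimelike q y₁ := by simpa using hγ 0
  have h1 := fun t => mul_pos_of_continuous_of_ne_zero (g := fun t => q (γ t) (γ t))
    (hqc.comp (f := fun t => (γ t, γ t)) (by fun_prop)) (fun t => (hγ t).1) t 0
  simp only [γ.source] at h1
  have h2 := mul_pos_of_continuous_of_ne_zero (g := fun t => q (γ t) y₁)
    (hqc.comp (f := fun t => (γ t, y₁)) (by fun_prop)) (fun t ht => by
      have hne : γ t ≠ 0 := by
        intro h
        have := (hγ t).1
        simp [h] at this
      linarith [hγ0.2 _ hne ht, h1 t]) 1 0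
  have h3 := h1 1
  simp only [γ.source, γ.target] at h2 h3
  rintro y ⟨a, b, ha, hb, hab, rfl⟩
  refine hγ0.of_mul_pos hq ?_
  have h4 : q (a • y₁ + b • y₂) (a • y₁ + b • y₂) * q y₁ y₁ =
      a ^ 2 * (q y₁ y₁ * q y₁ y₁) + 2 * (a * b) * (q y₂ y₁ * q y₁ y₁) +
        b ^ 2 * (q y₂ y₂ * q y₁ y₁) := by
    simp [hq y₁ y₂]; ring
  rw [h4]
  have h5 := mul_self_pos.2 hγ0.1
  rcases ha.eq_or_lt with rfl | ha
  · obtain rfl : b = 1 := by linarith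
    simpa using h3
  · have := mul_pos (pow_pos ha 2) h5
    have := mul_nonneg (mul_nonneg ha.le hb) h2.le
    have := mul_nonneg (sq_nonneg b) h3.le
    linarith

end Timelike

/-! ### Transversal directions, and why avoidance implies transversality. -/

/-- The Hessian of `f`, real on real space, at a real point, as a real bilinear form. -/
noncomputable def realHessian (f : C3 → ℂ) (x : R3) : R3 →ₗ[ℝ] R3 →ₗ[ℝ] ℝ :=
  LinearMap.mk₂ ℝ (fun u v => (fderiv ℂ (fderiv ℂ f) (realPoint x) (realPoint u) (realPoint v)).re)
    (by simp) (by simp) (by simp) (by simp)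

theorem realHessian_apply (f : C3 → ℂ) (x u v : R3) : realHessian f x u v =
    (fderiv ℂ (fderiv ℂ f) (realPoint x) (realPoint u) (realPoint v)).re := rfl

theorem continuous_realHessian (f : C3 → ℂ) (x : R3) :
    Continuous fun p : R3 × R3 => realHessian f x p.1 p.2 := by
  simp only [realHessian_apply]
  fun_prop

/-- The direction `y` avoids `{f = 0}` near the real point `x`, to first or second order. -/
def TransversalDirection (f : C3 → ℂ) (x y : R3) : Prop :=
  f (realPoint x) ≠ 0 ∨
    (fderiv ℂ f (realPoint x) ≠ 0 ∧ (fderiv ℂ f (realPoint x) (realPoint y)).re ≠ 0) ∨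
    (fderiv ℂ f (realPoint x) = 0 ∧ IsTimelike (realHessian f x) y)

section Directions

variable {f : C3 → ℂ} {x y : R3}

theorem realHessian_comm (hf : AnalyticAt ℂ f (realPoint x)) (u v : R3) :
    realHessian f x u v = realHessian f x v u := by
  rw [realHessian_apply, realHessian_apply]
  have h := (hf.contDiffAt (n := ω)).isSymmSndFDerivAt (by simp)
  rw [h.eq]

/-- In the three cases the set of directions is everything, the complement of a hyperplane, or the
set of timelike vectors. Each has convex path components. -/
theorem TransversalDirection.segment_subset (hf : AnalyticAt ℂ f (realPoint x)) {y₁ y₂ : R3}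
    (h : JoinedIn {y | TransversalDirection f x y} y₁ y₂) :
    segment ℝ y₁ y₂ ⊆ {y | TransversalDirection f x y} := by
  intro y hy
  by_cases h0 : f (realPoint x) = 0
  · by_cases h1 : fderiv ℂ f (realPoint x) = 0
    · have h2 : {y | TransversalDirection f x y} = {y | IsTimelike (realHessian f x) y} := by
        ext y; simp [TransversalDirection, h0, h1]
      rw [h2] at h ⊢
      exact IsTimelike.segment_subset (realHessian_comm hf) (continuous_realHessian f x) h hy
    · have h2 : {y | TransversalDirection f x y} =
          {y | (fderiv ℂ f (realPoint x) (realPoint y)).re ≠ 0} := by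
        ext y; simp [TransversalDirection, h0, h1]
      rw [h2] at h ⊢
      obtain ⟨γ, hγ⟩ := h
      have h3 := mul_pos_of_continuous_of_ne_zero
        (g := fun t => (fderiv ℂ f (realPoint x) (realPoint (γ t))).re) (by fun_prop) hγ 0 1
      simp only [γ.source, γ.target] at h3
      obtain ⟨a, b, ha, hb, hab, rfl⟩ := hy
      simp only [Set.mem_ofPred_eq, map_add, map_smul, ContinuousLinearMap.map_smul_of_tower,
        Complex.add_re, Complex.smul_re, smul_eq_mul]
      set r := (fderiv ℂ f (realPoint x) (realPoint y₁)).re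
      set s := (fderiv ℂ f (realPoint x) (realPoint y₂)).re
      intro h4
      have h5 : a * (r * r) + b * (r * s) = 0 := by linear_combination r * h4
      have hr : r ≠ 0 := by rintro h; simp [h] at h3
      have h6 := mul_self_pos.2 hr
      have h7 := mul_nonneg ha h6.le
      have h8 := mul_nonneg hb h3.le
      rcases ha.eq_or_lt with rfl | ha
      · obtain rfl : b = 1 := by linarith
        linarith
      · have := mul_pos ha h6
        linarith
  · exact Or.inl h0

theorem im_fderiv_realPoint (hf : AnalyticAt ℂ f (realPoint x))
    (hr : ∀ x, (f (realPoint x)).im = 0) (v : R3) :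
    (fderiv ℂ f (realPoint x) (realPoint v)).im = 0 := by
  have h1 := hasDerivAt_line (f := f) (ξ := realPoint x) ((0 : ℝ) : ℂ) (realPoint v)
    (by simpa using hf.differentiableAt)
  have h2 := Complex.imCLM.hasFDerivAt.comp_hasDerivAt (0 : ℝ) h1.comp_ofReal
  have h3 : (Complex.imCLM ∘ fun s : ℝ => f (realPoint x + (s : ℂ) • realPoint v)) = fun _ => 0 := by
    funext s
    simp only [Function.comp_apply, Complex.imCLM_apply, ← realPoint_smul, ← map_add, hr]
  rw [h3] at h2
  have := h2.unique (hasDerivAt_const (0 : ℝ) (0 : ℝ))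
  simpa using this

theorem im_hessian_realPoint (hf : AnalyticAt ℂ f (realPoint x))
    (hr : ∀ x, (f (realPoint x)).im = 0) (u v : R3) :
    (fderiv ℂ (fderiv ℂ f) (realPoint x) (realPoint u) (realPoint v)).im = 0 := by
  have h1 : HasDerivAt (fun s : ℂ => realPoint x + s • realPoint u) (realPoint u) ((0 : ℝ) : ℂ) := by
    simpa using ((hasDerivAt_id (((0 : ℝ) : ℂ))).smul_const (realPoint u)).const_add (realPoint x)
  have h2 : HasFDerivAt (fderiv ℂ f) (fderiv ℂ (fderiv ℂ f) (realPoint x))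
      (realPoint x + ((0 : ℝ) : ℂ) • realPoint u) := by
    simpa using hf.fderiv.differentiableAt.hasFDerivAt
  have h3 : HasDerivAt (fun s : ℂ => fderiv ℂ f (realPoint x + s • realPoint u))
      (fderiv ℂ (fderiv ℂ f) (realPoint x) (realPoint u)) ((0 : ℝ) : ℂ) := h2.comp_hasDerivAt _ h1
  have h4 := (h3.clm_apply (hasDerivAt_const _ (realPoint v)))
  rw [map_zero, add_zero] at h4
  have h5 := Complex.imCLM.hasFDerivAt.comp_hasDerivAt (0 : ℝ) h4.comp_ofReal
  have h6 : (Complex.imCLM ∘ fun s : ℝ =>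
      fderiv ℂ f (realPoint x + (s : ℂ) • realPoint u) (realPoint v)) =ᶠ[𝓝 0] fun _ => 0 := by
    have : Continuous fun s : ℝ => realPoint (x + s • u) := by fun_prop
    have h7 := this.tendsto 0
    simp only [zero_smul, add_zero] at h7
    filter_upwards [h7.eventually hf.eventually_analyticAt] with s hs
    simp only [Function.comp_apply, Complex.imCLM_apply, ← realPoint_smul, ← map_add]
    exact im_fderiv_realPoint hs hr v
  have := h5.unique ((hasDerivAt_const (0 : ℝ) (0 : ℝ)).congr_of_eventuallyEq h6)
  simpa using this

theorem hessian_eq_ofReal (hf : AnalyticAt ℂ f (realPoint x))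
    (hr : ∀ x, (f (realPoint x)).im = 0) (u v : R3) :
    fderiv ℂ (fderiv ℂ f) (realPoint x) (realPoint u) (realPoint v) = realHessian f x u v :=
  Complex.ext (by simp [realHessian_apply]) (by simp [im_hessian_realPoint hf hr])

/-- At a nondegenerate critical point, directions that locally avoid `{f = 0}` are timelike for the
Hessian. -/
theorem isTimelike_realHessian (hf : AnalyticAt ℂ f (realPoint x))
    (hr : ∀ x, (f (realPoint x)).im = 0) (h0 : f (realPoint x) = 0)
    (hd : fderiv ℂ f (realPoint x) = 0)
    (hH : ∀ u : R3, u ≠ 0 → ∃ v : R3, realHessian f x u v ≠ 0)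
    (hw : ∀ᶠ q : R3 × ℝ in 𝓝 x ×ˢ 𝓝[>] 0, f (complexPoint q.1 (q.2 • y)) ≠ 0) :
    IsTimelike (realHessian f x) y := by
  set q := realHessian f x with hq
  have hDq := hessian_eq_ofReal hf hr
  rw [← hq] at hDq
  have hsymm := realHessian_comm hf
  rw [← hq] at hsymm
  have hyy : q y y ≠ 0 := by
    have := hessian_self_ne_zero hf h0 hd (fun u hu => by
      obtain ⟨v, hv⟩ := hH u hu
      exact ⟨v, by rw [hDq]; exact_mod_cast hv⟩) hw
    rw [hDq] at this
    exact_mod_cast this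
  -- Suppose `v` is orthogonal to `y` and `q v v`, `q y y` have the same sign. Blowing up by `t ^ 2`
  -- along `v + σ y` gives the limit `(q v v + σ ^ 2 q y y) / 2`, with the simple zero `σ = iρ` in
  -- the upper half-plane, against Hurwitz's theorem.
  have hle : ∀ v, q v y = 0 → q v v * q y y ≤ 0 := by
    intro v hv
    by_contra! hcon
    set D := fderiv ℂ (fderiv ℂ f) (realPoint x) with hD
    have hlo := isLittleO_sub_hessian hf h0 hd
    rw [← hD] at hlo
    set φ : ℂ → ℂ := fun σ => (1 / 2 : ℂ) * (q v v + σ ^ 2 * q y y) with hφ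
    have hDφ : ∀ σ : ℂ, (1 / 2 : ℂ) *
        D (realPoint v + σ • realPoint y) (realPoint v + σ • realPoint y) = φ σ := by
      intro σ
      simp only [map_add, map_smul, add_apply, smul_apply,
        hDq, hφ, smul_eq_mul, hv, hsymm y v]
      push_cast
      ring
    set Φ : ℝ → ℂ → ℂ := fun t σ => ((t : ℂ) ^ 2)⁻¹ *
      f (realPoint x + (t : ℂ) • (realPoint v + σ • realPoint y)) with hΦ
    have hr0 : 0 < q v v / q y y := by
      rw [← mul_div_mul_right _ _ hyy]
      exact div_pos hcon (mul_self_pos.2 hyy)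
    set ρ := Real.sqrt (q v v / q y y) with hρ
    have hρ0 : 0 < ρ := Real.sqrt_pos.2 hr0
    have hρ2 : ρ ^ 2 * q y y = q v v := by
      rw [hρ, Real.sq_sqrt hr0.le]
      field_simp
    have hW : ∀ σ : ℂ, Tendsto (fun p : ℝ × ℂ => (p.1 : ℂ) • (realPoint v + p.2 • realPoint y))
        (𝓝[>] 0 ×ˢ 𝓝 σ) (𝓝 0) := by
      intro σ
      have : Continuous fun p : ℝ × ℂ => (p.1 : ℂ) • (realPoint v + p.2 • realPoint y) := by fun_prop
      have h1 := this.tendsto (0, σ)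
      rw [nhds_prod_eq] at h1
      simpa using h1.mono_left (Filter.prod_mono nhdsWithin_le_nhds le_rfl)
    have hpos : ∀ σ : ℂ, ∀ᶠ p : ℝ × ℂ in 𝓝[>] 0 ×ˢ 𝓝 σ, 0 < p.1 := fun σ =>
      tendsto_fst.eventually self_mem_nhdsWithin
    have hz := eventually_eq_zero_of_tendsto_of_ne_zero (l := 𝓝[>] (0 : ℝ)) (Φ := Φ) (φ := φ)
      (U := {σ | 0 < σ.im}) (σ₀ := ρ * Complex.I)
      (isOpen_lt continuous_const Complex.continuous_im) (by simpa using hρ0)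
      (by simp only [hφ]; fun_prop) (by simp only [hφ]; fun_prop)
      (by simp only [hφ, mul_pow, Complex.I_sq, ← hρ2]; push_cast; ring) ?_ ?_ ?_
    · have h2 : HasDerivAt φ ((1 / 2 : ℂ) * (2 * (ρ * Complex.I) * q y y)) (ρ * Complex.I) := by
        have := ((((hasDerivAt_id (ρ * Complex.I)).pow 2).mul_const (q y y : ℂ)).const_add
          (q v v : ℂ)).const_mul (1 / 2 : ℂ)
        refine HasDerivAt.congr_deriv (f := φ) this ?_
        simp
      have h3 := (h2.congr_of_eventuallyEq (hz.mono fun _ h => h.symm)).unique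
        (hasDerivAt_const _ (0 : ℂ))
      have : (q y y : ℂ) ≠ 0 := by exact_mod_cast hyy
      have : (ρ : ℂ) ≠ 0 := by exact_mod_cast hρ0.ne'
      simp_all
    · intro σ _
      have h1 : Tendsto (fun p : ℝ × ℂ => realPoint x +
          (p.1 : ℂ) • (realPoint v + p.2 • realPoint y)) (𝓝[>] 0 ×ˢ 𝓝 σ) (𝓝 (realPoint x)) := by
        simpa using (hW σ).const_add (realPoint x)
      filter_upwards [h1.eventually hf.eventually_analyticAt] with p hp
      have := hp.differentiableAt
      simp only [hΦ]
      refine DifferentiableAt.const_mul ?_ _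
      exact DifferentiableAt.fun_comp' (g := f) p.2 this (by fun_prop)
    · intro σ hσ
      have hσ : 0 < σ.im := hσ
      have h1 : Tendsto (fun p : ℝ × ℂ => (x + p.1 • v + (p.1 * p.2.re) • y, p.1 * p.2.im))
          (𝓝[>] 0 ×ˢ 𝓝 σ) (𝓝 x ×ˢ 𝓝[>] 0) := by
        refine Tendsto.prodMk ?_ (tendsto_nhdsWithin_iff.2 ⟨?_, ?_⟩)
        · have : Continuous fun p : ℝ × ℂ => x + p.1 • v + (p.1 * p.2.re) • y := by fun_prop
          have h1 := this.tendsto (0, σ)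
          rw [nhds_prod_eq] at h1
          simpa using h1.mono_left (Filter.prod_mono nhdsWithin_le_nhds le_rfl)
        · have : Continuous fun p : ℝ × ℂ => p.1 * p.2.im := by fun_prop
          have h1 := this.tendsto (0, σ)
          rw [nhds_prod_eq] at h1
          simpa using h1.mono_left (Filter.prod_mono nhdsWithin_le_nhds le_rfl)
        · have h2 : ∀ᶠ p : ℝ × ℂ in 𝓝[>] 0 ×ˢ 𝓝 σ, 0 < p.2.im := tendsto_snd.eventually
            ((isOpen_lt continuous_const Complex.continuous_im).eventually_mem hσ)
          filter_upwards [h2, hpos σ] with p h3 h4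
          exact mul_pos h4 h3
      filter_upwards [h1.eventually hw, hpos σ] with p h2 h3
      refine mul_ne_zero (inv_ne_zero (pow_ne_zero _ (by exact_mod_cast h3.ne'))) ?_
      convert h2 using 2
      ext i
      apply Complex.ext <;> simp [complexPoint] <;> ring
    · intro σ _
      have h1 := hlo.comp_tendsto (hW σ)
      have h2 : (fun p : ℝ × ℂ => ‖(p.1 : ℂ) • (realPoint v + p.2 • realPoint y)‖ ^ 2)
          =O[𝓝[>] 0 ×ˢ 𝓝 σ] fun p => (p.1 : ℂ) ^ 2 := by
        have h3 : Tendsto (fun p : ℝ × ℂ => ‖realPoint v + p.2 • realPoint y‖ ^ 2)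
            (𝓝[>] 0 ×ˢ 𝓝 σ) (𝓝 (‖realPoint v + σ • realPoint y‖ ^ 2)) := by
          have : Continuous fun s : ℂ => ‖realPoint v + s • realPoint y‖ ^ 2 := by fun_prop
          exact (this.tendsto σ).comp tendsto_snd
        have h4 := (Asymptotics.isBigO_refl (fun p : ℝ × ℂ => ‖(p.1 : ℂ) ^ 2‖)
          (𝓝[>] 0 ×ˢ 𝓝 σ)).mul (h3.isBigO_one ℝ)
        refine (h4.congr (fun p => ?_) (fun p => mul_one _)).of_norm_right
        rw [norm_smul, mul_pow, norm_pow]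
      have h3 := (h1.trans_isBigO h2).tendsto_div_nhds_zero
      have h4 : Tendsto (fun p : ℝ × ℂ => φ p.2) (𝓝[>] 0 ×ˢ 𝓝 σ) (𝓝 (φ σ)) := by
        have : Continuous φ := by simp only [hφ]; fun_prop
        exact (this.tendsto σ).comp tendsto_snd
      have h5 := h3.add h4
      rw [zero_add] at h5
      refine h5.congr' ?_
      filter_upwards [hpos σ] with p hp
      have hp' : (p.1 : ℂ) ≠ 0 := by exact_mod_cast hp.ne'
      simp only [Function.comp_apply, hΦ, map_smul, smul_apply, smul_eq_mul]
      rw [← hDφ]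
      field_simp
      ring
  refine ⟨hyy, fun v hv hvy => lt_of_le_of_ne (hle v hvy) fun h => ?_⟩
  have hvv : q v v = 0 := (mul_eq_zero.1 h).resolve_right hyy
  -- On the orthogonal complement of `y` the form is semidefinite, so an isotropic vector there is
  -- orthogonal to the whole complement. It is also orthogonal to `y`, hence lies in the radical.
  have hrad : ∀ u, q u y = 0 → q v u = 0 := by
    intro u huy
    by_contra hne
    have h1 : ∀ t : ℝ, (2 * t * q v u + t ^ 2 * q u u) * q y y ≤ 0 := by
      intro t
      have := hle (v + t • u) (by simp [hvy, huy])
      simp only [map_add, map_smul, LinearMap.add_apply, LinearMap.smul_apply, smul_eq_mul, hvv,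
        hsymm u v] at this
      linarith
    set A := q v u * q y y with hA
    have hA0 : A ≠ 0 := mul_ne_zero hne hyy
    set B := q u u * q y y with hB
    have h2 : ∀ t : ℝ, 2 * t * A + t ^ 2 * B ≤ 0 := fun t => by
      have := h1 t
      rw [hA, hB]
      linarith
    -- A multiple of `A` small enough for the linear term to dominate the quadratic one.
    have h3 := h2 (A / (1 + |B|))
    have h4 : 0 < 1 + |B| := by positivity
    have h5 : 2 * (A / (1 + |B|)) * A + (A / (1 + |B|)) ^ 2 * B =
        (A / (1 + |B|)) ^ 2 * (2 * (1 + |B|) + B) := by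
      field_simp
    rw [h5] at h3
    have h6 : 0 < 2 * (1 + |B|) + B := by linarith [neg_abs_le B, abs_nonneg B]
    have h7 : 0 < (A / (1 + |B|)) ^ 2 := by positivity
    linarith [mul_pos h7 h6]
  obtain ⟨u, hu⟩ := hH v hv
  have h1 : q v (u - (q u y / q y y) • y) = 0 := by
    apply hrad
    simp
    field_simp
    simp
  simp [hvy] at h1
  exact hu h1

end Directions

/-! ### Transversal directions avoid the hypersurface uniformly. -/

/-- The Hessian at `v + iεy'` has real part `q v v - ε² q y' y'` and imaginary part `2ε q v y'`. The
combination of the real part with `q v y'` estimated here is positive definite in `(v, ε)`: for `v =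
w + α y` with `w` orthogonal to `y` it equals `(α² + ε²) (q y y)² - q w w * q y y` at `y' = y`.
Compactness of the unit sphere and homogeneity make the bound uniform near `y`. -/
theorem IsTimelike.exists_pos_le {q : R3 →ₗ[ℝ] R3 →ₗ[ℝ] ℝ} (hq : ∀ u v, q u v = q v u)
    (hqc : Continuous fun p : R3 × R3 => q p.1 p.2) {y : R3} (hy : IsTimelike q y) :
    ∃ c > 0, ∀ᶠ y' in 𝓝 y, ∀ z : R3 × ℝ,
      c * ‖z‖ ^ 2 ≤ 2 * q z.1 y' ^ 2 - q y' y' * (q z.1 z.1 - z.2 ^ 2 * q y' y') := by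
  set E : R3 → R3 × ℝ → ℝ :=
    fun y' z => 2 * q z.1 y' ^ 2 - q y' y' * (q z.1 z.1 - z.2 ^ 2 * q y' y') with hE
  have hEc : Continuous fun p : R3 × (R3 × ℝ) => E p.1 p.2 := by
    have h1 : Continuous fun p : R3 × (R3 × ℝ) => q p.2.1 p.1 :=
      hqc.comp (f := fun p : R3 × (R3 × ℝ) => (p.2.1, p.1)) (by fun_prop)
    have h2 : Continuous fun p : R3 × (R3 × ℝ) => q p.1 p.1 :=
      hqc.comp (f := fun p : R3 × (R3 × ℝ) => (p.1, p.1)) (by fun_prop)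
    have h3 : Continuous fun p : R3 × (R3 × ℝ) => q p.2.1 p.2.1 :=
      hqc.comp (f := fun p : R3 × (R3 × ℝ) => (p.2.1, p.2.1)) (by fun_prop)
    simp only [hE]
    fun_prop
  have hpos : ∀ z : R3 × ℝ, z ≠ 0 → 0 < E y z := by
    rintro ⟨v, ε⟩ hz
    set α := q v y / q y y with hα
    set w := v - α • y with hw
    have hα' : α * q y y = q v y := by
      have := hy.1
      rw [hα]
      field_simp
    have hwy : q w y = 0 := by simp [hw, ← hα']
    have hv : v = w + α • y := by simp [hw]
    have hvv : q v v = q w w + α ^ 2 * q y y := by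
      rw [hv]
      simp [hq y w, hwy]
      ring
    have hEz : E y (v, ε) = (α ^ 2 + ε ^ 2) * q y y ^ 2 - q w w * q y y := by
      simp only [hE, hvv, ← hα']
      ring
    rw [hEz]
    have hyy : 0 < q y y ^ 2 := by have := hy.1; positivity
    by_cases hw0 : w = 0
    · rw [hw0]
      simp only [map_zero, zero_mul, sub_zero]
      refine mul_pos ?_ hyy
      by_contra! h
      have h1 : α = 0 := by nlinarith [sq_nonneg α, sq_nonneg ε]
      have h2 : ε = 0 := by nlinarith [sq_nonneg α, sq_nonneg ε]
      refine hz (Prod.ext ?_ h2)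
      simp [hv, hw0, h1]
    · have := hy.2 w hw0 hwy
      nlinarith [mul_nonneg (add_nonneg (sq_nonneg α) (sq_nonneg ε)) hyy.le]
  obtain ⟨z₀, hz₀, hmin⟩ := (isCompact_sphere (0 : R3 × ℝ) 1).exists_isMinOn
    (NormedSpace.sphere_nonempty.2 zero_le_one) (f := E y)
    (hEc.comp (f := fun z => (y, z)) (by fun_prop)).continuousOn
  have hz₀' : z₀ ≠ 0 := by
    rintro rfl
    simp at hz₀
  have hc := hpos z₀ hz₀'
  refine ⟨E y z₀ / 2, by positivity, ?_⟩
  have h1 := (isCompact_sphere (0 : R3 × ℝ) 1).eventually_forall_of_forall_eventually (x₀ := y)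
    (P := fun y' z => E y z₀ / 2 < E y' z) (fun z hz =>
      hEc.continuousAt.eventually_const_lt (show E y z₀ / 2 < E y z from by
        have : E y z₀ ≤ E y z := hmin hz
        linarith))
  filter_upwards [h1] with y' hy' z
  by_cases hz : z = 0
  · simp [hz]
  have hn : 0 < ‖z‖ := norm_pos_iff.2 hz
  have h2 := hy' (‖z‖⁻¹ • z) (by simp [norm_smul, hn.ne'])
  have h3 : E y' z = ‖z‖ ^ 2 * E y' (‖z‖⁻¹ • z) := by
    simp only [hE, Prod.smul_fst, Prod.smul_snd, map_smul, LinearMap.smul_apply, smul_eq_mul]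
    field_simp
  calc E y z₀ / 2 * ‖z‖ ^ 2 ≤ ‖z‖ ^ 2 * E y' (‖z‖⁻¹ • z) := by
        rw [mul_comm]
        gcongr
    _ = E y' z := h3.symm

section Directions

variable {f : C3 → ℂ} {x y : R3}

/-- At a zero `x' + iεy'` both `q v v - ε² q y' y'` and `q v y'`, where `v = x' - x`, are as small
as the Taylor errors permit. The positive definite form of `IsTimelike.exists_pos_le` would then be
too small. -/
theorem eventually_ne_zero_of_isTimelike (hf : AnalyticAt ℂ f (realPoint x))
    (hr : ∀ x, (f (realPoint x)).im = 0) (h0 : f (realPoint x) = 0)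
    (hd : fderiv ℂ f (realPoint x) = 0) (hy : IsTimelike (realHessian f x) y) :
    ∀ᶠ p : (R3 × R3) × ℝ in 𝓝 (x, y) ×ˢ 𝓝[>] 0, f (complexPoint p.1.1 (p.2 • p.1.2)) ≠ 0 := by
  set q := realHessian f x with hq
  have hDq := hessian_eq_ofReal hf hr
  rw [← hq] at hDq
  have hsymm := realHessian_comm hf
  have hqc := continuous_realHessian f x
  rw [← hq] at hsymm hqc
  set D := fderiv ℂ (fderiv ℂ f) (realPoint x) with hD
  obtain ⟨c, hc, hE⟩ := hy.exists_pos_le hsymm hqc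
  set M := ‖y‖ + 2 with hM
  have hM0 : 0 < M := by positivity
  set Q := |q y y| + 1 with hQ
  have hQ0 : 0 < Q := by positivity
  -- The Taylor errors are measured by `κ`; this choice keeps their total contribution to the
  -- quadratic form below `c`.
  obtain ⟨κ, hκ0, hκ1, hκ⟩ : ∃ κ > 0, κ ≤ 1 ∧ κ * (2 * M ^ 4 + 2 * Q * M ^ 2) < c := by
    have h1 : 0 < 2 * M ^ 4 + 2 * Q * M ^ 2 := by positivity
    refine ⟨min 1 (c / (2 * (2 * M ^ 4 + 2 * Q * M ^ 2))), by positivity, min_le_left _ _, ?_⟩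
    calc _ ≤ c / (2 * (2 * M ^ 4 + 2 * Q * M ^ 2)) * (2 * M ^ 4 + 2 * Q * M ^ 2) := by
          gcongr; exact min_le_right _ _
      _ = c / 2 := by field_simp
      _ < c := by linarith
  have hT1 : ∀ᶠ w in 𝓝 (0 : C3), ‖f (realPoint x + w) - (1 / 2 : ℂ) * D w w‖ ≤ κ * ‖w‖ ^ 2 := by
    have := Asymptotics.isLittleO_iff.1 (isLittleO_sub_hessian hf h0 hd) hκ0
    simpa using this
  have hT2 : ∀ᶠ w in 𝓝 (0 : C3), ‖fderiv ℂ f (realPoint x + w) - D w‖ ≤ κ * ‖w‖ := by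
    have := Asymptotics.isLittleO_iff.1
      (hasFDerivAt_iff_isLittleO_nhds_zero.1 hf.fderiv.differentiableAt.hasFDerivAt) hκ0
    simpa [hd] using this
  have hT0 : ∀ᶠ w in 𝓝 (0 : C3), DifferentiableAt ℂ f (realPoint x + w) := by
    have : Tendsto (fun w => realPoint x + w) (𝓝 0) (𝓝 (realPoint x)) := by
      simpa using (continuous_const_add (realPoint x)).tendsto 0
    exact this.eventually (hf.eventually_analyticAt.mono fun _ h => h.differentiableAt)
  have hT : ∀ᶠ ξ in 𝓝 (realPoint x),
      ‖f ξ - (1 / 2 : ℂ) * D (ξ - realPoint x) (ξ - realPoint x)‖ ≤ κ * ‖ξ - realPoint x‖ ^ 2 ∧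
      ‖fderiv ℂ f ξ - D (ξ - realPoint x)‖ ≤ κ * ‖ξ - realPoint x‖ ∧ DifferentiableAt ℂ f ξ := by
    have : Tendsto (fun ξ => ξ - realPoint x) (𝓝 (realPoint x)) (𝓝 0) := by
      have h : Continuous fun ξ : C3 => ξ - realPoint x := by fun_prop
      simpa using h.tendsto (realPoint x)
    simpa using this.eventually (hT1.and (hT2.and hT0))
  have hP := eventually_forall_Icc_complexPoint (x := x) (y := y) (P := fun ξ _ =>
      ‖f ξ - (1 / 2 : ℂ) * D (ξ - realPoint x) (ξ - realPoint x)‖ ≤ κ * ‖ξ - realPoint x‖ ^ 2 ∧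
      ‖fderiv ℂ f ξ - D (ξ - realPoint x)‖ ≤ κ * ‖ξ - realPoint x‖ ∧ DifferentiableAt ℂ f ξ)
    ((continuous_fst.tendsto (realPoint x, y)).eventually hT)
  have hy1 : ∀ᶠ y' in 𝓝 y, ‖y'‖ < ‖y‖ + 1 :=
    continuous_norm.continuousAt.eventually_lt_const (by linarith)
  have hy2 : ∀ᶠ y' in 𝓝 y, |q y' y'| < Q := by
    have : Continuous fun y' : R3 => |q y' y'| :=
      (hqc.comp (f := fun y' : R3 => (y', y')) (by fun_prop)).abs
    exact this.continuousAt.eventually_lt_const (by rw [hQ]; linarith)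
  have hsnd : Tendsto (fun p : (R3 × R3) × ℝ => p.1.2) (𝓝 (x, y) ×ˢ 𝓝[>] 0) (𝓝 y) :=
    (continuous_snd.tendsto (x, y)).comp tendsto_fst
  have hpos : ∀ᶠ p : (R3 × R3) × ℝ in 𝓝 (x, y) ×ˢ 𝓝[>] 0, 0 < p.2 :=
    tendsto_snd.eventually self_mem_nhdsWithin
  filter_upwards [hP, hsnd.eventually (hE.and (hy1.and hy2)), hpos] with
    ⟨⟨x', y'⟩, ε⟩ hp ⟨hE', hy1', hy2'⟩ hε hzero
  simp only at hp hE' hy1' hy2' hε hzero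
  set v := x' - x with hv
  set z : R3 × ℝ := (v, ε) with hz
  have hzv : ‖v‖ ≤ ‖z‖ := norm_fst_le z
  have hzε : ε ≤ ‖z‖ := (le_abs_self ε).trans (norm_snd_le z)
  have hz0 : 0 < ‖z‖ := hε.trans_le hzε
  have hw : ∀ t : ℝ, complexPoint x' (t • y') - realPoint x =
      realPoint v + (t * Complex.I) • realPoint y' := by
    intro t; ext k; simp [complexPoint, hv]; ring
  have hwn : ∀ t ∈ Icc 0 ε, ‖complexPoint x' (t • y') - realPoint x‖ ≤ M * ‖z‖ := by
    intro t ht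
    rw [hw]
    refine (norm_add_le _ _).trans ?_
    rw [norm_smul, norm_realPoint, norm_realPoint]
    simp only [norm_mul, Complex.norm_real, Complex.norm_I, mul_one, Real.norm_of_nonneg ht.1]
    have h1 : t * ‖y'‖ ≤ ‖z‖ * (‖y‖ + 1) := by
      have := ht.1
      have := ht.2.trans hzε
      gcongr
    rw [hM]
    linarith
  have hre : |q v v - ε ^ 2 * q y' y'| ≤ 2 * κ * M ^ 2 * ‖z‖ ^ 2 := by
    have h1 := (hp ε ⟨hε.le, le_rfl⟩).1
    rw [hzero, zero_sub, norm_neg] at h1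
    have h2 := (Complex.abs_re_le_norm _).trans h1
    have h3 : ((1 / 2 : ℂ) * D (complexPoint x' (ε • y') - realPoint x)
        (complexPoint x' (ε • y') - realPoint x)).re = (1 / 2) * (q v v - ε ^ 2 * q y' y') := by
      rw [hw]
      simp only [map_add, map_smul, add_apply, smul_apply, hDq, smul_eq_mul, hsymm y' v]
      have : (1 / 2 : ℂ) * (((q v v : ℝ) : ℂ) + ε * Complex.I * (q v y' : ℝ) +
          ε * Complex.I * ((q v y' : ℝ) + ε * Complex.I * (q y' y' : ℝ))) =
          ((1 / 2 * (q v v - ε ^ 2 * q y' y') : ℝ) : ℂ) +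
            ((ε * q v y' : ℝ) : ℂ) * Complex.I := by
        push_cast
        linear_combination (ε : ℂ) ^ 2 * (q y' y' : ℂ) / 2 * Complex.I_sq
      refine (congrArg Complex.re (Eq.trans ?_ this)).trans
        (by rw [Complex.add_re, Complex.ofReal_re, Complex.re_ofReal_mul]; simp)
      ring
    rw [h3, abs_mul, abs_of_pos (by norm_num : (0 : ℝ) < 1 / 2)] at h2
    have h4 : κ * ‖complexPoint x' (ε • y') - realPoint x‖ ^ 2 ≤ κ * (M * ‖z‖) ^ 2 := by
      gcongr
      exact hwn ε ⟨hε.le, le_rfl⟩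
    nlinarith
  -- The imaginary part of the second order expansion would bound only `ε q v y'`, which is useless
  -- for `ε` much smaller than `v`. Since `f` is real at `x'`, the mean value theorem removes the
  -- factor `ε` exactly and leaves a bound on `q v y'` itself.
  have him : |q v y'| ≤ κ * M ^ 2 * ‖z‖ := by
    obtain ⟨t, ht, h1⟩ := exists_im_sub_eq (f := f) (x := x') (y := y') hε fun t ht => (hp t ht).2.2
    have ht' : t ∈ Icc 0 ε := Ioo_subset_Icc_self ht
    rw [hzero, hr, Complex.zero_im, sub_zero] at h1
    have h2 := (mul_eq_zero.1 h1.symm).resolve_left hε.ne'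
    have h3 := (fderiv ℂ f (complexPoint x' (t • y')) -
      D (complexPoint x' (t • y') - realPoint x)).le_opNorm (realPoint y')
    have h4 := (Complex.abs_re_le_norm _).trans h3
    have h5 : (D (complexPoint x' (t • y') - realPoint x) (realPoint y')).re = q v y' := by
      rw [hw]
      simp only [map_add, map_smul, add_apply, smul_apply, hDq, smul_eq_mul]
      simp
    rw [norm_realPoint, sub_apply, Complex.sub_re, h2, h5, zero_sub, abs_neg] at h4
    have h6 := (hp t ht').2.1
    have h7 := hwn t ht'
    have h8 : ‖y'‖ ≤ M := by rw [hM]; linarith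
    calc |q v y'| ≤ _ := h4
      _ ≤ (κ * (M * ‖z‖)) * M := by
          gcongr
          exact h6.trans (by gcongr)
      _ = _ := by ring
  have h1 := hE' z
  simp only [hz] at h1
  rw [← hz] at h1
  have h2 : q v y' ^ 2 ≤ (κ * M ^ 2 * ‖z‖) ^ 2 := sq_le_sq' (by linarith [neg_abs_le (q v y')])
    ((le_abs_self _).trans him)
  have h3 : -(q y' y' * (q v v - ε ^ 2 * q y' y')) ≤ Q * (2 * κ * M ^ 2 * ‖z‖ ^ 2) := by
    refine (neg_le_abs _).trans ?_
    rw [abs_mul]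
    gcongr
  have h4 : 2 * (κ * M ^ 2 * ‖z‖) ^ 2 ≤ κ * (2 * M ^ 4) * ‖z‖ ^ 2 := by
    have : κ ^ 2 ≤ κ := by nlinarith
    calc 2 * (κ * M ^ 2 * ‖z‖) ^ 2 = κ ^ 2 * (2 * M ^ 4 * ‖z‖ ^ 2) := by ring
      _ ≤ κ * (2 * M ^ 4 * ‖z‖ ^ 2) := by gcongr
      _ = _ := by ring
  have h5 : κ * (2 * M ^ 4 + 2 * Q * M ^ 2) * ‖z‖ ^ 2 < c * ‖z‖ ^ 2 := by gcongr
  nlinarith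

/-- Transversal directions avoid `{f = 0}` uniformly. -/
theorem TransversalDirection.eventually (hf : AnalyticAt ℂ f (realPoint x))
    (hr : ∀ x, (f (realPoint x)).im = 0) (hy : TransversalDirection f x y) :
    ∀ᶠ p : (R3 × R3) × ℝ in 𝓝 (x, y) ×ˢ 𝓝[>] 0, f (complexPoint p.1.1 (p.2 • p.1.2)) ≠ 0 := by
  by_cases h0 : f (realPoint x) = 0
  swap
  · exact ((tendsto_complexPoint_smul x y).mono_left
      (Filter.prod_mono le_rfl nhdsWithin_le_nhds)).eventually (hf.continuousAt.eventually_ne h0)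
  rcases hy with h | ⟨-, h⟩ | ⟨h1, h⟩
  · exact absurd h0 h
  · have h1 : ContinuousAt (fun q : C3 × R3 => (fderiv ℂ f q.1 (realPoint q.2)).re)
        (realPoint x, y) := by
      refine Complex.continuous_re.continuousAt.comp (ContinuousAt.clm_apply ?_ ?_)
      · exact hf.fderiv.continuousAt.comp (f := Prod.fst) (x := (realPoint x, y)) continuousAt_fst
      · exact (realPoint.continuous.comp continuous_snd).continuousAt
    have h2 : ∀ᶠ q : C3 × R3 in 𝓝 (realPoint x, y), DifferentiableAt ℂ f q.1 :=
      (continuous_fst.tendsto (realPoint x, y)).eventually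
        (hf.eventually_analyticAt.mono fun _ h => h.differentiableAt)
    have h3 := eventually_forall_Icc_complexPoint
      (P := fun ξ y => DifferentiableAt ℂ f ξ ∧ (fderiv ℂ f ξ (realPoint y)).re ≠ 0)
      (h2.and (h1.eventually_ne h))
    have h4 : ∀ᶠ q : (R3 × R3) × ℝ in 𝓝 (x, y) ×ˢ 𝓝[>] 0, 0 < q.2 :=
      tendsto_snd.eventually self_mem_nhdsWithin
    filter_upwards [h3, h4] with q hq hε h
    obtain ⟨t, ht, he⟩ := exists_im_sub_eq hε fun t ht => (hq t ht).1
    rw [h, hr, Complex.zero_im, sub_zero] at he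
    exact (mul_ne_zero hε.ne' (hq t (Ioo_subset_Icc_self ht)).2) he.symm
  · exact eventually_ne_zero_of_isTimelike hf hr h0 h1 h

/-- A real vector in the radical would be a kernel vector of the complex Hessian matrix, since the
Hessian is real on real vectors. -/
theorem exists_realHessian_ne_zero (hf : AnalyticAt ℂ f (realPoint x))
    (hr : ∀ x, (f (realPoint x)).im = 0) (h : (complexHessian f (realPoint x)).det ≠ 0)
    {u : R3} (hu : u ≠ 0) : ∃ v, realHessian f x u v ≠ 0 := by
  by_contra! hcon
  refine h (Matrix.exists_mulVec_eq_zero_iff.1 ⟨realPoint u, ?_, ?_⟩)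
  · intro h1
    apply hu
    ext k
    have := congrFun h1 k
    simpa using this
  · ext k
    have h1 : ∀ l, complexHessian f (realPoint x) k l =
        fderiv ℂ (fderiv ℂ f) (realPoint x) (Pi.single l 1) (Pi.single k 1) := by
      intro l
      have h2 := hf.fderiv.differentiableAt.hasFDerivAt.clm_apply
        (hasFDerivAt_const (Pi.single k 1 : C3) (realPoint x))
      rw [complexHessian, Matrix.of_apply, h2.fderiv]
      simp
    have h2 : realPoint (Pi.single k 1) = Pi.single k 1 := by
      ext l
      by_cases h : l = k
      · subst h; simp
      · simp [h]
    have h3 : realPoint u = ∑ l, (u l : ℂ) • (Pi.single l 1 : C3) := by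
      ext l
      simp [Finset.sum_apply, Pi.single_apply]
    have h4 := hessian_eq_ofReal hf hr u (Pi.single k 1)
    rw [hcon, h2, h3, map_sum, sum_apply] at h4
    simp only [Matrix.mulVec, dotProduct, h1, realPoint_apply, Pi.zero_apply]
    simpa [mul_comm] using h4

/-- At a regular or conical point, the directions that locally avoid `{f = 0}` are transversal. -/
theorem TransversalDirection.of_eventually (hf : AnalyticAt ℂ f (realPoint x))
    (hr : ∀ x, (f (realPoint x)).im = 0)
    (hreg : f (realPoint x) = 0 → fderiv ℂ f (realPoint x) ≠ 0 ∨
      (complexHessian f (realPoint x)).det ≠ 0)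
    (hw : ∀ᶠ q : R3 × ℝ in 𝓝 x ×ˢ 𝓝[>] 0, f (complexPoint q.1 (q.2 • y)) ≠ 0) :
    TransversalDirection f x y := by
  by_cases h0 : f (realPoint x) = 0
  swap
  · exact Or.inl h0
  right
  by_cases h1 : fderiv ℂ f (realPoint x) = 0
  · exact Or.inr ⟨h1, isTimelike_realHessian hf hr h0 h1
      (fun u hu => exists_realHessian_ne_zero hf hr ((hreg h0).resolve_left (by simpa using h1)) hu)
      hw⟩
  · refine Or.inl ⟨h1, fun h => fderiv_realPoint_ne_zero hf h0 h1 hw ?_⟩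
    exact Complex.ext h (im_fderiv_realPoint hf hr y)

end Directions

/-! ### Allowed directions for the whole family of singularities. -/

/-- A locally finite family of hypersurfaces `{g_j = 0}` in the tube, real on real space. -/
structure IsRealSingularityFamily {J : Type*} (δ : ℝ) (g : J → C3 → ℂ) : Prop where
  pos : 0 < δ
  analytic : ∀ j, AnalyticOnNhd ℂ (g j) (realTube δ)
  locallyFinite : ∀ ξ ∈ realTube δ, ∃ V ∈ 𝓝 ξ, {j | ∃ ζ ∈ V ∩ realTube δ, g j ζ = 0}.Finite
  real : ∀ j x, (g j (realPoint x)).im = 0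

/-- Uniformly near `(x, y)`, small displacements of real points in imaginary direction avoid the
singularities. -/
def StronglyAllowed {J : Type*} (δ : ℝ) (g : J → C3 → ℂ) (x y : R3) : Prop :=
  ∀ᶠ p : (R3 × R3) × ℝ in 𝓝 (x, y) ×ˢ 𝓝[>] 0, complexPoint p.1.1 (p.2 • p.1.2) ∈ singularityFree δ g

/-- The direction `w` can be deformed at `x`, through strongly allowed directions, to a desired
one. -/
def HasDesiredDirection {J : Type*} (δ : ℝ) (g : J → C3 → ℂ) (G : C3 → ℂ) (x w : R3) : Prop :=
  ∃ y, JoinedIn {y | StronglyAllowed δ g x y} w y ∧ DesiredDirection G x y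

section Allowed

variable {J : Type*} {δ : ℝ} {g : J → C3 → ℂ} {x y : R3}

theorem isOpen_stronglyAllowed : IsOpen {q : R3 × R3 | StronglyAllowed δ g q.1 q.2} := by
  refine isOpen_iff_mem_nhds.2 fun q hq => ?_
  obtain ⟨A, hA, B, hB, h⟩ := eventually_prod_iff.1 (show StronglyAllowed δ g q.1 q.2 from hq)
  filter_upwards [eventually_eventually_nhds.2 hA] with q' hq'
  exact eventually_prod_iff.2 ⟨A, hq', B, hB, h⟩

theorem StronglyAllowed.eventually_fst (h : StronglyAllowed δ g x y) :
    ∀ᶠ q : R3 × ℝ in 𝓝 x ×ˢ 𝓝[>] 0, complexPoint q.1 (q.2 • y) ∈ singularityFree δ g := by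
  have h1 : Tendsto (fun q : R3 × ℝ => ((q.1, y), q.2)) (𝓝 x ×ˢ 𝓝[>] 0)
      (𝓝 (x, y) ×ˢ 𝓝[>] 0) := by
    refine Tendsto.prodMk ?_ tendsto_snd
    have : Continuous fun x : R3 => (x, y) := by fun_prop
    exact (this.tendsto x).comp tendsto_fst
  exact h1.eventually h

theorem StronglyAllowed.smul (h : StronglyAllowed δ g x y) {t : ℝ} (ht : 0 < t) :
    StronglyAllowed δ g x (t • y) := by
  have h1 : Tendsto (fun p : (R3 × R3) × ℝ => ((p.1.1, t⁻¹ • p.1.2), p.2 * t))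
      (𝓝 (x, t • y) ×ˢ 𝓝[>] 0) (𝓝 (x, y) ×ˢ 𝓝[>] 0) := by
    refine Tendsto.prodMk ?_ (tendsto_nhdsWithin_iff.2 ⟨?_, ?_⟩)
    · have : Continuous fun q : R3 × R3 => (q.1, t⁻¹ • q.2) := by fun_prop
      have h2 := this.tendsto (x, t • y)
      simp only [smul_smul, inv_mul_cancel₀ ht.ne', one_smul] at h2
      exact h2.comp tendsto_fst
    · have : Continuous fun s : ℝ => s * t := by fun_prop
      have h2 := (this.tendsto 0).mono_left (nhdsWithin_le_nhds (s := Ioi 0))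
      rw [zero_mul] at h2
      exact h2.comp tendsto_snd
    · have h2 : ∀ᶠ p : (R3 × R3) × ℝ in 𝓝 (x, t • y) ×ˢ 𝓝[>] 0, 0 < p.2 :=
        tendsto_snd.eventually self_mem_nhdsWithin
      filter_upwards [h2] with p hp
      exact mul_pos hp ht
  filter_upwards [h1.eventually h] with p hp
  simpa [smul_smul, mul_assoc, ht.ne'] using hp

/-- Local finiteness leaves only finitely many components near `x`, so the uniform neighbourhoods
for the single components can be intersected. -/
theorem stronglyAllowed_of_transversal (hs : IsRealSingularityFamily δ g)
    (h : ∀ j, TransversalDirection (g j) x y) : StronglyAllowed δ g x y := by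
  have hx := realPoint_mem_realTube hs.pos x
  obtain ⟨V, hV, hfin⟩ := hs.locallyFinite _ hx
  have h1 : ∀ᶠ p : (R3 × R3) × ℝ in 𝓝 (x, y) ×ˢ 𝓝[>] 0,
      complexPoint p.1.1 (p.2 • p.1.2) ∈ V ∩ realTube δ :=
    ((tendsto_complexPoint_smul x y).mono_left (Filter.prod_mono le_rfl nhdsWithin_le_nhds)).eventually
      (inter_mem hV ((isOpen_realTube δ).mem_nhds hx))
  have h2 := (eventually_all_finite hfin).2 fun j _ =>
    (h j).eventually (hs.analytic j _ hx) (hs.real j)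
  filter_upwards [h1, h2] with p hp hp'
  refine ⟨hp.2, fun j hj => ?_⟩
  exact hp' j ⟨_, hp, hj⟩ hj

theorem transversal_of_eventually (hs : IsRealSingularityFamily δ g)
    (hx : RegularOrConicalAt g x)
    (h : ∀ᶠ q : R3 × ℝ in 𝓝 x ×ˢ 𝓝[>] 0, complexPoint q.1 (q.2 • y) ∈ singularityFree δ g) (j : J) :
    TransversalDirection (g j) x y := by
  have hx' := hx j
  rw [complexPoint_zero_right] at hx'
  exact TransversalDirection.of_eventually (hs.analytic j _ (realPoint_mem_realTube hs.pos x))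
    (hs.real j) hx' (h.mono fun q hq => hq.2 j)

/-- The components of the set of strongly allowed directions are convex. -/
theorem segment_subset_stronglyAllowed (hs : IsRealSingularityFamily δ g)
    (hx : RegularOrConicalAt g x) {y₁ y₂ : R3}
    (h : JoinedIn {y | StronglyAllowed δ g x y} y₁ y₂) :
    segment ℝ y₁ y₂ ⊆ {y | StronglyAllowed δ g x y} := by
  intro y hy
  refine stronglyAllowed_of_transversal hs fun j => ?_
  refine TransversalDirection.segment_subset (hs.analytic j _ (realPoint_mem_realTube hs.pos x))
    (h.mono fun y hy => ?_) hy
  exact transversal_of_eventually hs hx (StronglyAllowed.eventually_fst hy) j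

/-- Near a point only finitely many components matter, and nonvanishing of `g j`, of its gradient or
of its Hessian determinant is stable. The openness provides a neighbourhood of admissible points in
which the gluing takes place. -/
theorem isOpen_regularOrConicalAt (hs : IsRealSingularityFamily δ g) :
    IsOpen {x | RegularOrConicalAt g x} := by
  refine isOpen_iff_mem_nhds.2 fun x hx => ?_
  have hxt := realPoint_mem_realTube hs.pos x
  obtain ⟨V, hV, hfin⟩ := hs.locallyFinite _ hxt
  have hc : Tendsto realPoint (𝓝 x) (𝓝 (realPoint x)) := realPoint.continuous.tendsto x
  have h2 := (eventually_all_finite (l := 𝓝 x) hfin (p := fun j x => g j (realPoint x) = 0 →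
      fderiv ℂ (g j) (realPoint x) ≠ 0 ∨ (complexHessian (g j) (realPoint x)).det ≠ 0)).2 fun j _ => by
    have ha := hs.analytic j _ hxt
    by_cases h0 : g j (realPoint x) = 0
    swap
    · filter_upwards [hc.eventually (ha.continuousAt.eventually_ne h0)] with x' h1 h2
      exact absurd h2 h1
    have hx' := hx j
    rw [complexPoint_zero_right] at hx'
    rcases hx' h0 with h | h
    · filter_upwards [hc.eventually (ha.fderiv.continuousAt.eventually_ne h)] with x' h1 _
      exact Or.inl h1
    · have h3 : ContinuousAt (complexHessian (g j)) (realPoint x) := by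
        refine continuousAt_pi.2 fun k => continuousAt_pi.2 fun l => ?_
        have h4 : AnalyticAt ℂ (fun ζ => fderiv ℂ (g j) ζ (Pi.single k 1)) (realPoint x) :=
          ((ContinuousLinearMap.apply ℂ ℂ (Pi.single k 1 : C3)).analyticAt _).fun_comp ha.fderiv
        exact h4.fderiv.continuousAt.clm_apply continuousAt_const
      have h4 : ContinuousAt (fun ξ => (complexHessian (g j) ξ).det) (realPoint x) :=
        (Continuous.matrix_det continuous_id).continuousAt.comp h3
      filter_upwards [hc.eventually (h4.eventually_ne h)] with x' h1 _
      exact Or.inr h1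
  filter_upwards [h2, hc.eventually hV] with x' h3 h4 j
  rw [complexPoint_zero_right]
  exact fun h0 => h3 j ⟨_, ⟨h4, realPoint_mem_realTube hs.pos x'⟩, h0⟩ h0

/-- At an admissible point every direction of the path is transversal to every component, hence
strongly allowed. The local deformation thereby becomes a statement about directions at the single
point `x`, which is stable in `x`. -/
theorem IsLocalDeformation.joinedIn_desired (hs : IsRealSingularityFamily δ g)
    (hx : RegularOrConicalAt g x) {G : C3 → ℂ} (hG : AnalyticAt ℂ G (realPoint x))
    (hG0 : 0 ≤ (G (realPoint x)).im) {β : R3 → R3} {c : ℝ → R3}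
    (h : IsLocalDeformation δ g G β x c) :
    (∀ τ ∈ Icc (0 : ℝ) 1, JoinedIn {y | StronglyAllowed δ g x y} (c τ) (c 1)) ∧
      DesiredDirection G x (c 1) := by
  obtain ⟨U, hU, ε₀, hε₀, hUε⟩ := h.allowed_desired
  have h1 : U ×ˢ Ioc 0 ε₀ ∈ 𝓝 x ×ˢ 𝓝[>] (0 : ℝ) := prod_mem_prod hU (Ioc_mem_nhdsGT hε₀)
  refine ⟨fun τ hτ => ?_, DesiredDirection.of_eventually hG hG0 ?_⟩
  · have h2 : ∀ τ ∈ Icc (0 : ℝ) 1, StronglyAllowed δ g x (c τ) := fun τ hτ =>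
      stronglyAllowed_of_transversal hs (transversal_of_eventually hs hx (by
        filter_upwards [h1] with q hq
        exact (hUε q.1 hq.1 q.2 hq.2).1 τ hτ))
    have h3 := ((isPathConnected_iff.2 ⟨⟨0, by simp⟩, fun a ha b hb =>
      JoinedIn.of_segment_subset ((convex_Icc (0 : ℝ) 1).segment_subset ha hb)⟩ :
        IsPathConnected (Icc (0 : ℝ) 1)).image' h.continuousOn)
    refine (h3.joinedIn _ (mem_image_of_mem c hτ) _ (mem_image_of_mem c (by simp))).mono ?_
    rintro _ ⟨σ, hσ, rfl⟩
    exact h2 σ hσ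
  · filter_upwards [h1] with q hq
    exact (hUε q.1 hq.1 q.2 hq.2).2

theorem HasDesiredDirection.of_not_special (hs : IsRealSingularityFamily δ g)
    (hx : RegularOrConicalAt g x) {G : C3 → ℂ} (hG : AnalyticAt ℂ G (realPoint x))
    (hG0 : 0 ≤ (G (realPoint x)).im) {β : R3 → R3} (h : x ∉ specialPoints δ g G β) :
    HasDesiredDirection δ g G x (β x) := by
  obtain ⟨c, hc⟩ := not_not.1 h
  have h1 := hc.joinedIn_desired hs hx hG hG0
  rw [← hc.initial]
  exact ⟨c 1, h1.1 0 (by simp), h1.2⟩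

/-- The same path works at nearby base points, by compactness of the parameter interval and
openness; a nearby starting direction is first joined to the old one by a short segment. -/
theorem JoinedIn.eventually_stronglyAllowed {w : R3}
    (h : JoinedIn {y | StronglyAllowed δ g x y} w y) :
    ∀ᶠ p : R3 × R3 in 𝓝 (x, w), JoinedIn {y | StronglyAllowed δ g p.1 y} p.2 y := by
  have hw : (x, w) ∈ {q : R3 × R3 | StronglyAllowed δ g q.1 q.2} := h.source_mem
  obtain ⟨A, hA, B, hB, hAB⟩ := eventually_prod_iff.1
    (nhds_prod_eq (x := x) (y := w) ▸ isOpen_stronglyAllowed.eventually_mem hw)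
  obtain ⟨r, hr, hrB⟩ := Metric.eventually_nhds_iff_ball.1 hB
  obtain ⟨γ, hγ⟩ := h
  have h1 := isCompact_univ.eventually_forall_of_forall_eventually (x₀ := x)
    (P := fun x' (t : unitInterval) => StronglyAllowed δ g x' (γ t)) (fun t _ => by
      have hc : Continuous fun z : R3 × unitInterval => (z.1, γ z.2) := by fun_prop
      exact (hc.tendsto (x, t)).eventually (isOpen_stronglyAllowed.eventually_mem (hγ t)))
  rw [nhds_prod_eq]
  refine eventually_prod_iff.2 ⟨_, hA.and h1, _, Metric.ball_mem_nhds w hr, ?_⟩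
  rintro x' ⟨hx', hγ'⟩ w' hw'
  have h2 : JoinedIn {y | StronglyAllowed δ g x' y} w' w := JoinedIn.of_segment_subset fun z hz =>
    hAB hx' (hrB _ ((convex_ball w r).segment_subset hw' (Metric.mem_ball_self hr) hz))
  exact h2.trans ⟨γ, fun t => hγ' t (mem_univ t)⟩

/-- Compactness in `s` gives one range of scales that serves the whole segment and all nearby base
points. -/
theorem eventually_forall_segment_allowed {b v : R3 → R3} (hb : Continuous b) (hv : Continuous v)
    (h : ∀ s ∈ Icc (0 : ℝ) 1, StronglyAllowed δ g x (b x + s • v x)) :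
    ∀ᶠ q : R3 × ℝ in 𝓝 x ×ˢ 𝓝[>] 0, ∀ s ∈ Icc (0 : ℝ) 1,
      complexPoint q.1 (q.2 • (b q.1 + s • v q.1)) ∈ singularityFree δ g := by
  have h1 : ∀ᶠ p in (𝓝 x ×ˢ 𝓝[>] (0 : ℝ)) ×ˢ 𝓝ˢ (Icc (0 : ℝ) 1),
      complexPoint p.1.1 (p.1.2 • (b p.1.1 + p.2 • v p.1.1)) ∈ singularityFree δ g := by
    refine isCompact_Icc.mem_prod_nhdsSet_of_forall fun s hs => ?_
    have h2 : Tendsto (fun p : (R3 × ℝ) × ℝ => ((p.1.1, b p.1.1 + p.2 • v p.1.1), p.1.2))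
        ((𝓝 x ×ˢ 𝓝[>] (0 : ℝ)) ×ˢ 𝓝 s) (𝓝 (x, b x + s • v x) ×ˢ 𝓝[>] 0) := by
      refine Tendsto.prodMk ?_ (tendsto_snd.comp tendsto_fst)
      have hc : Continuous fun q : R3 × ℝ => (q.1, b q.1 + q.2 • v q.1) := by fun_prop
      have h3 := hc.tendsto (x, s)
      rw [nhds_prod_eq (x := x)] at h3
      exact h3.comp ((tendsto_fst.comp tendsto_fst).prodMk tendsto_snd)
    exact h2.eventually (h s hs)
  filter_upwards [h1.curry] with q hq s hs
  exact hq.self_of_nhdsSet s hs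

end Allowed

/-! ### Gluing local deformations. -/

theorem exists_contDiff_forall_mem_convex {F : Type*} [NormedAddCommGroup F] [NormedSpace ℝ F]
    {t : R3 → Set F} (ht : ∀ x, Convex ℝ (t x))
    (hloc : ∀ x, ∃ U ∈ 𝓝 x, ∃ f : R3 → F, ContDiff ℝ ∞ f ∧ ∀ y ∈ U, f y ∈ t y) :
    ∃ f : R3 → F, ContDiff ℝ ∞ f ∧ ∀ x, f x ∈ t x := by
  obtain ⟨f, hf⟩ := exists_contMDiffMap_forall_mem_convex_of_local (n := ⊤)
    (modelWithCornersSelf ℝ R3) ht fun x => by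
      obtain ⟨U, hU, f, hf, hft⟩ := hloc x
      exact ⟨U, hU, f, (contMDiff_iff_contDiff.2 hf).contMDiffOn, hft⟩
  exact ⟨f, contMDiff_iff_contDiff.1 f.contMDiff, hf⟩

section Glue

variable {J : Type*} {δ : ℝ} {g : J → C3 → ℂ} {G : C3 → ℂ} {β : R3 → R3} {K L O W : Set R3}

/-- Local displacements to desired directions are glued, by a partition of unity. -/
theorem exists_glued_direction (hs : IsRealSingularityFamily δ g)
    (hG : ∀ x, AnalyticAt ℂ G (realPoint x)) (hβ : ContDiff ℝ ∞ β) (hK : IsClosed K)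
    (hL : IsClosed L) (hO : IsOpen O) (hLO : L ⊆ O) (hW : IsOpen W) (hKW : K ⊆ W)
    (hWadm : ∀ x ∈ W, RegularOrConicalAt g x)
    (hgood : ∀ x ∈ K, HasDesiredDirection δ g G x (β x))
    (hOK : ∀ x ∈ O ∩ K, DesiredDirection G x (β x)) :
    ∃ v : R3 → R3, ContDiff ℝ ∞ v ∧ (∀ x ∈ L, v x = 0) ∧
      (∀ x, v x ≠ 0 → x ∈ W ∧ JoinedIn {y | StronglyAllowed δ g x y} (β x) (β x + v x)) ∧
      ∀ x ∈ K, DesiredDirection G x (β x + v x) := by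
  -- The requirement is that `β x + v` stays in the component of `β x`, not only that it is allowed:
  -- two averaged displacements must end in one and the same convex component.
  have hconv : ∀ x, Convex ℝ {v : R3 | (x ∈ L → v = 0) ∧
      (v ≠ 0 → x ∈ W ∧ JoinedIn {y | StronglyAllowed δ g x y} (β x) (β x + v)) ∧
      (x ∈ K → DesiredDirection G x (β x + v))} := by
    rintro x v₁ ⟨h1, h2, h3⟩ v₂ ⟨h1', h2', h3'⟩ a b ha hb hab
    have hsum : β x + (a • v₁ + b • v₂) = a • (β x + v₁) + b • (β x + v₂) := by
      rw [smul_add, smul_add, add_add_add_comm, ← add_smul, hab, one_smul]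
    refine ⟨fun hx => by simp [h1 hx, h1' hx], fun hne => ?_, fun hx => ?_⟩
    · have hmem : x ∈ W ∧ JoinedIn {y | StronglyAllowed δ g x y} (β x) (β x) := by
        by_cases hv₁ : v₁ = 0
        · have hv₂ : v₂ ≠ 0 := by rintro rfl; simp [hv₁] at hne
          exact ⟨(h2' hv₂).1, JoinedIn.refl (h2' hv₂).2.source_mem⟩
        · exact ⟨(h2 hv₁).1, JoinedIn.refl (h2 hv₁).2.source_mem⟩
      have hj : ∀ v : R3, (v ≠ 0 → x ∈ W ∧
          JoinedIn {y | StronglyAllowed δ g x y} (β x) (β x + v)) →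
          JoinedIn {y | StronglyAllowed δ g x y} (β x) (β x + v) := by
        intro v hv
        by_cases h0 : v = 0
        · simpa [h0] using hmem.2
        · exact (hv h0).2
      have hj₁ := hj v₁ h2
      have hj₁₂ := hj₁.symm.trans (hj v₂ h2')
      have hseg := segment_subset_stronglyAllowed hs (hWadm x hmem.1) hj₁₂
      refine ⟨hmem.1, hj₁.trans (JoinedIn.of_segment_subset ?_)⟩
      refine ((convex_segment _ _).segment_subset (left_mem_segment ℝ _ _) ?_).trans hseg
      rw [hsum]
      exact ⟨a, b, ha, hb, hab, rfl⟩
    · rw [hsum]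
      exact convex_desiredDirection G x (h3 hx) (h3' hx) ha hb hab
  obtain ⟨v, hv, hvt⟩ := exists_contDiff_forall_mem_convex hconv fun x => by
    by_cases hxK : x ∈ K
    · by_cases hxO : x ∈ O
      · refine ⟨O, hO.mem_nhds hxO, fun _ => 0, contDiff_const, fun y hy => ⟨fun _ => rfl, ?_, ?_⟩⟩
        · exact fun h => absurd rfl h
        · intro hyK
          simpa using hOK y ⟨hy, hyK⟩
      · obtain ⟨y, hy1, hy2⟩ := hgood x hxK
        have h1 : Tendsto (fun x' => (x', β x')) (𝓝 x) (𝓝 (x, β x)) :=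
          (continuous_id.prodMk hβ.continuous).tendsto x
        have h2 : Tendsto (fun x' => (x', y)) (𝓝 x) (𝓝 (x, y)) :=
          (continuous_id.prodMk continuous_const).tendsto x
        have h3 := h1.eventually hy1.eventually_stronglyAllowed
        have h4 := h2.eventually ((isOpen_desiredDirection hG).eventually_mem hy2)
        have h5 := (hL.isOpen_compl.eventually_mem fun h => hxO (hLO h))
        have h6 := hW.eventually_mem (hKW hxK)
        -- Locally every displacement is sent to the one fixed desired direction `y`, which stays
        -- desired and reachable near `x`.
        refine ⟨_, h3.and (h4.and (h5.and h6)), fun x' => y - β x', contDiff_const.sub hβ, ?_⟩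
        rintro x' ⟨h7, h8, h9, h10⟩
        refine ⟨fun h => absurd h h9, fun _ => ⟨h10, ?_⟩, fun _ => ?_⟩
        · simpa using h7
        · simpa using h8
    · refine ⟨Kᶜ, hK.isOpen_compl.mem_nhds hxK, fun _ => 0, contDiff_const, fun y hy =>
        ⟨fun _ => rfl, fun h => absurd rfl h, fun h => absurd h hy⟩⟩
  exact ⟨v, hv, fun x hx => (hvt x).1 hx, fun x hx => (hvt x).2.1 hx, fun x hx => (hvt x).2.2 hx⟩

/-- A smooth scale, below which the displacements are allowed, and desired over `K`. -/
theorem exists_glued_scale (hG : ∀ x, AnalyticAt ℂ G (realPoint x))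
    (hG0 : ∀ x, 0 ≤ (G (realPoint x)).im) {v : R3 → R3} (hβ : ContDiff ℝ ∞ β)
    (hv : ContDiff ℝ ∞ v)
    (hβX : ∀ x, ∀ t ∈ Ioc (0 : ℝ) 1, complexPoint x (t • β x) ∈ singularityFree δ g)
    (hK : IsClosed K) {u : Set R3} (hu : IsOpen u) (hLu : L ⊆ u) (hL : IsClosed L)
    (hvu : ∀ x ∈ u, v x = 0) (hKW : K ⊆ W) (hvW : ∀ x ∉ W, v x = 0)
    (hseg : ∀ x ∈ closure W, ∀ s ∈ Icc (0 : ℝ) 1, StronglyAllowed δ g x (β x + s • v x))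
    (hdes : ∀ x ∈ K, DesiredDirection G x (β x + v x))
    (huK : ∀ x ∈ u ∩ K, ∀ t ∈ Ioc (0 : ℝ) 1, 0 < (G (complexPoint x (t • β x))).im) :
    ∃ e : R3 → ℝ, ContDiff ℝ ∞ e ∧ (∀ x ∈ L, e x = 1) ∧ ∀ x, 0 < e x ∧ e x ≤ 1 ∧
      ∀ ε ∈ Ioc 0 (e x), (∀ s ∈ Icc (0 : ℝ) 1,
        complexPoint x (ε • (β x + s • v x)) ∈ singularityFree δ g) ∧
        (x ∈ K → 0 < (G (complexPoint x (ε • (β x + v x)))).im) := by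
  have hconv : ∀ x, Convex ℝ {e : ℝ | (x ∈ L → e = 1) ∧ 0 < e ∧ e ≤ 1 ∧
      ∀ ε ∈ Ioc 0 e, (∀ s ∈ Icc (0 : ℝ) 1,
        complexPoint x (ε • (β x + s • v x)) ∈ singularityFree δ g) ∧
        (x ∈ K → 0 < (G (complexPoint x (ε • (β x + v x)))).im)} := by
    intro x
    -- A scale between two admissible ones is admissible, since the conditions for the larger one
    -- cover all smaller `ε`.
    refine OrdConnected.convex (ordConnected_iff.2 ?_)
    rintro e₁ ⟨h1, h2, h3, -⟩ e₂ ⟨h1', h2', h3', h4'⟩ - e ⟨h5, h6⟩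
    refine ⟨fun hx => le_antisymm (h6.trans h3') ((h1 hx).symm.le.trans h5), h2.trans_le h5,
      h6.trans h3', fun ε hε => h4' ε ⟨hε.1, hε.2.trans h6⟩⟩
  obtain ⟨e, he, het⟩ := exists_contDiff_forall_mem_convex hconv fun x => by
    by_cases hxu : x ∈ u
    · refine ⟨u, hu.mem_nhds hxu, fun _ => 1, contDiff_const, fun y hy =>
        ⟨fun _ => rfl, one_pos, le_rfl, fun ε hε => ⟨fun s _ => ?_, fun hyK => ?_⟩⟩⟩
      · simpa [hvu y hy] using hβX y ε hε
      · simpa [hvu y hy] using huK y ⟨hy, hyK⟩ ε hε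
    have hxL : ∀ᶠ y in 𝓝 x, y ∉ L := hL.isOpen_compl.eventually_mem fun h => hxu (hLu h)
    by_cases hxW : x ∈ closure W
    · have h1 := eventually_forall_segment_allowed hβ.continuous hv.continuous (hseg x hxW)
      have h2 : ∀ᶠ q : R3 × ℝ in 𝓝 x ×ˢ 𝓝[>] 0,
          q.1 ∈ K → 0 < (G (complexPoint q.1 (q.2 • (β q.1 + v q.1)))).im := by
        by_cases hxK : x ∈ K
        · have h3 : Tendsto (fun q : R3 × ℝ => ((q.1, β q.1 + v q.1), q.2)) (𝓝 x ×ˢ 𝓝[>] 0)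
              (𝓝 (x, β x + v x) ×ˢ 𝓝[>] 0) := by
            refine Tendsto.prodMk ?_ tendsto_snd
            exact ((continuous_id.prodMk (hβ.continuous.add hv.continuous)).tendsto x).comp
              tendsto_fst
          filter_upwards [h3.eventually ((hdes x hxK).eventually (hG x) hG0)] with q hq _
          exact hq
        · have h3 : ∀ᶠ q : R3 × ℝ in 𝓝 x ×ˢ 𝓝[>] 0, q.1 ∉ K :=
            tendsto_fst.eventually (hK.isOpen_compl.eventually_mem hxK)
          filter_upwards [h3] with q hq hq'
          exact absurd hq' hq
      obtain ⟨A, hA, B, hB, hAB⟩ := eventually_prod_iff.1 (h1.and h2)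
      obtain ⟨r, hr, hrB⟩ := mem_nhdsGT_iff_exists_Ioc_subset.1 hB
      have hr : 0 < r := hr
      refine ⟨_, hA.and hxL, fun _ => min r 1, contDiff_const, ?_⟩
      rintro y ⟨hy, hyL⟩
      refine ⟨fun h => absurd h hyL, by positivity, min_le_right _ _, fun ε hε => ?_⟩
      have := hAB hy (hrB ⟨hε.1, hε.2.trans (min_le_left _ _)⟩)
      exact this
    · refine ⟨_, isClosed_closure.isOpen_compl.mem_nhds hxW, fun _ => 1, contDiff_const,
        fun y hy => ⟨fun _ => rfl, one_pos, le_rfl, fun ε hε => ⟨fun s _ => ?_, fun hyK => ?_⟩⟩⟩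
      · simpa [hvW y fun h => hy (subset_closure h)] using hβX y ε hε
      · exact absurd (subset_closure (hKW hyK)) hy
  exact ⟨e, he, fun x hx => (het x).1 hx, fun x => (het x).2⟩

/-- Gluing of local deformations: `{x + i β(x)}` is deformed, without moving the part over `L`, to a
domain that is desired over `K`. -/
theorem exists_glued_deformation (hs : IsRealSingularityFamily δ g)
    (hG : ∀ x, AnalyticAt ℂ G (realPoint x)) (hG0 : ∀ x, 0 ≤ (G (realPoint x)).im)
    (hβ : ContDiff ℝ ∞ β)
    (hβX : ∀ x, ∀ t ∈ Ioc (0 : ℝ) 1, complexPoint x (t • β x) ∈ singularityFree δ g)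
    (hK : IsClosed K) (hL : IsClosed L) (hO : IsOpen O) (hLO : L ⊆ O)
    (hadm : ∀ x ∈ K, RegularOrConicalAt g x)
    (hgood : ∀ x ∈ K, HasDesiredDirection δ g G x (β x))
    (hOK : ∀ x ∈ O ∩ K, DesiredDirection G x (β x) ∧
      ∀ t ∈ Ioc (0 : ℝ) 1, 0 < (G (complexPoint x (t • β x))).im) :
    ∃ H : R3 → ℝ → R3, ContDiff ℝ ∞ (fun p : R3 × ℝ => H p.1 p.2) ∧ (∀ x, H x 0 = β x) ∧
      (∀ x, ∀ τ ∈ Icc (0 : ℝ) 1, complexPoint x (H x τ) ∈ singularityFree δ g) ∧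
      (∀ x ∈ L, ∀ τ, H x τ = β x) ∧
      (∀ x, ∀ t ∈ Ioc (0 : ℝ) 1, complexPoint x (t • H x 1) ∈ singularityFree δ g) ∧
      (∀ x ∈ K, DesiredDirection G x (H x 1) ∧
        ∀ t ∈ Ioc (0 : ℝ) 1, 0 < (G (complexPoint x (t • H x 1))).im) ∧
      ∀ x, RegularOrConicalAt g x → HasDesiredDirection δ g G x (β x) →
        HasDesiredDirection δ g G x (H x 1) := by
  obtain ⟨u, hu, hLu, huO⟩ := normal_exists_closure_subset hL hO hLO
  have hGo : IsOpen ({x | RegularOrConicalAt g x} ∩ {x | StronglyAllowed δ g x (β x)}) :=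
    (isOpen_regularOrConicalAt hs).inter
      (isOpen_stronglyAllowed.preimage (continuous_id.prodMk hβ.continuous))
  obtain ⟨W, hW, hKW, hWG⟩ := normal_exists_closure_subset hK hGo fun x hx =>
    ⟨hadm x hx, (hgood x hx).choose_spec.1.source_mem⟩
  obtain ⟨v, hv, hvL, hvW, hvK⟩ := exists_glued_direction hs hG hβ hK isClosed_closure hO huO hW hKW
    (fun x hx => (hWG (subset_closure hx)).1) hgood (fun x hx => (hOK x hx).1)
  have hjoin : ∀ x ∈ closure W, JoinedIn {y | StronglyAllowed δ g x y} (β x) (β x + v x) := by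
    intro x hx
    by_cases h0 : v x = 0
    · simpa [h0] using JoinedIn.refl (F := {y | StronglyAllowed δ g x y}) (hWG hx).2
    · exact (hvW x h0).2
  have hseg : ∀ x ∈ closure W, ∀ s ∈ Icc (0 : ℝ) 1, StronglyAllowed δ g x (β x + s • v x) := by
    intro x hx s hs'
    refine segment_subset_stronglyAllowed hs (hWG hx).1 (hjoin x hx) ?_
    rw [segment_eq_image']
    exact ⟨s, hs', by simp⟩
  have hvW' : ∀ x ∉ W, v x = 0 := fun x hx => by
    by_contra h
    exact hx (hvW x h).1
  obtain ⟨e, he, heL, hee⟩ := exists_glued_scale hG hG0 hβ hv hβX hK hu hLu hL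
    (fun x hx => hvL x (subset_closure hx)) hKW hvW' hseg hvK
    (fun x hx => (hOK x ⟨huO (subset_closure hx.1), hx.2⟩).2)
  have hχ0 : ∀ τ, 0 ≤ Real.smoothTransition τ := Real.smoothTransition.nonneg
  have hχ1 : ∀ τ, Real.smoothTransition τ ≤ 1 := Real.smoothTransition.le_one
  -- For `τ ≤ 1/2` the displacement `β` shrinks to `e β`, which is allowed because `t β` is. After
  -- that it moves straight to `e (β + v)`, inside the range of scales provided by `e`.
  refine ⟨fun x τ => (1 + Real.smoothTransition (2 * τ) * (e x - 1)) •
    (β x + Real.smoothTransition (2 * τ - 1) • v x), ?_, ?_, ?_, ?_, ?_, ?_, ?_⟩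
  · have h1 : ContDiff ℝ ∞ Real.smoothTransition := Real.smoothTransition.contDiff
    fun_prop
  · intro x
    simp [Real.smoothTransition.zero_of_nonpos]
  · intro x τ hτ
    obtain ⟨he0, he1, hε⟩ := hee x
    beta_reduce
    rcases le_or_gt τ (1 / 2) with h | h
    · rw [Real.smoothTransition.zero_of_nonpos (x := 2 * τ - 1) (by linarith), zero_smul, add_zero]
      refine hβX x _ ⟨?_, ?_⟩
      · nlinarith [hχ0 (2 * τ), hχ1 (2 * τ)]
      · nlinarith [hχ0 (2 * τ), hχ1 (2 * τ)]
    · rw [Real.smoothTransition.one_of_one_le (x := 2 * τ) (by linarith), one_mul,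
        add_sub_cancel]
      exact (hε (e x) ⟨he0, le_rfl⟩).1 _ ⟨hχ0 _, hχ1 _⟩
  · intro x hx τ
    simp [heL x hx, hvL x (subset_closure (hLu hx))]
  all_goals
    have hχ2 : Real.smoothTransition (2 * 1) = 1 :=
      Real.smoothTransition.one_of_one_le (by norm_num)
    have hχ3 : Real.smoothTransition (2 * 1 - 1) = 1 :=
      Real.smoothTransition.one_of_one_le (by norm_num)
    simp only [hχ2, hχ3, one_mul, add_sub_cancel, one_smul]
  · intro x t ht
    obtain ⟨he0, he1, hε⟩ := hee x
    have := (hε (t * e x) ⟨mul_pos ht.1 he0, mul_le_of_le_one_left he0.le ht.2⟩).1 1 (by simp)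
    simpa [mul_smul] using this
  · intro x hx
    obtain ⟨he0, he1, hε⟩ := hee x
    refine ⟨(hvK x hx).smul he0, fun t ht => ?_⟩
    have := (hε (t * e x) ⟨mul_pos ht.1 he0, mul_le_of_le_one_left he0.le ht.2⟩).2 hx
    rwa [mul_smul] at this
  · rintro x hx ⟨y, hy1, hy2⟩
    have he0 := (hee x).1
    have h1 : JoinedIn {y | StronglyAllowed δ g x y} (β x) (β x + v x) := by
      by_cases h0 : v x = 0
      · simpa [h0] using JoinedIn.refl hy1.source_mem
      · exact (hvW x h0).2
    -- From `e (β + v)` scale back to `β + v`, return to `β` through allowed directions, and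
    -- continue to the desired direction reachable from there.
    refine ⟨y, JoinedIn.trans (JoinedIn.of_segment_subset ?_) (h1.symm.trans hy1), hy2⟩
    rintro _ ⟨a, b, ha, hb, hab, rfl⟩
    rw [smul_smul, ← add_smul]
    refine StronglyAllowed.smul h1.target_mem ?_
    rcases ha.eq_or_lt with rfl | ha
    · obtain rfl : b = 1 := by linarith
      simp
    · positivity

end Glue

/-! ### Stokes' theorem for holomorphic three-forms. -/

/-- The determinant with rows `u`, `v`, `w`. -/
def tripleProduct (u v w : C3) : ℂ :=
  u 0 * (v 1 * w 2 - v 2 * w 1) - u 1 * (v 0 * w 2 - v 2 * w 0) + u 2 * (v 0 * w 1 - v 1 * w 0)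

theorem HasDerivAt.mul_tripleProduct {ψ : ℝ → ℂ} {u v w : ℝ → C3} {ψ' : ℂ} {u' v' w' : C3} {t : ℝ}
    (hψ : HasDerivAt ψ ψ' t) (hu : HasDerivAt u u' t) (hv : HasDerivAt v v' t)
    (hw : HasDerivAt w w' t) :
    HasDerivAt (fun t => ψ t * tripleProduct (u t) (v t) (w t))
      (ψ' * tripleProduct (u t) (v t) (w t) + ψ t * (tripleProduct u' (v t) (w t) +
        tripleProduct (u t) v' (w t) + tripleProduct (u t) (v t) w')) t := by
  have hu := hasDerivAt_pi.1 hu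
  have hv := hasDerivAt_pi.1 hv
  have hw := hasDerivAt_pi.1 hw
  have h1 := ((hv 1).mul (hw 2)).sub ((hv 2).mul (hw 1))
  have h2 := ((hv 0).mul (hw 2)).sub ((hv 2).mul (hw 0))
  have h3 := ((hv 0).mul (hw 1)).sub ((hv 1).mul (hw 0))
  have h := hψ.mul ((((hu 0).mul h1).sub ((hu 1).mul h2)).add ((hu 2).mul h3))
  refine h.congr_deriv ?_
  simp only [tripleProduct, Pi.mul_apply, Pi.sub_apply, Pi.add_apply]
  ring

/-- The cofactor `3`-form components of the pullback of `ψ dξ₁ ∧ dξ₂ ∧ dξ₃` to four real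
dimensions. -/
noncomputable def pullbackField (ψ : (Fin 4 → ℝ) → ℂ) (ξ : (Fin 4 → ℝ) → C3) (q : Fin 4 → ℝ) :
    Fin 4 → ℂ :=
  let A : Fin 4 → C3 := fun i => fderiv ℝ ξ q (Pi.single i 1)
  ![ψ q * tripleProduct (A 1) (A 2) (A 3), -(ψ q * tripleProduct (A 0) (A 2) (A 3)),
    ψ q * tripleProduct (A 0) (A 1) (A 3), -(ψ q * tripleProduct (A 0) (A 1) (A 2))]

theorem DifferentiableAt.tripleProduct {E : Type*} [NormedAddCommGroup E] [NormedSpace ℝ E]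
    {u v w : E → C3} {q : E} (hu : DifferentiableAt ℝ u q) (hv : DifferentiableAt ℝ v q)
    (hw : DifferentiableAt ℝ w q) :
    DifferentiableAt ℝ (fun q => tripleProduct (u q) (v q) (w q)) q := by
  have hu := differentiableAt_pi.1 hu
  have hv := differentiableAt_pi.1 hv
  have hw := differentiableAt_pi.1 hw
  have h := fun i j => ((hv i).mul (hw j)).sub ((hv j).mul (hw i))
  exact (((hu 0).mul (h 1 2)).sub ((hu 1).mul (h 0 2))).add ((hu 2).mul (h 0 1))

theorem Continuous.tripleProduct {E : Type*} [TopologicalSpace E] {u v w : E → C3}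
    (hu : Continuous u) (hv : Continuous v) (hw : Continuous w) :
    Continuous (fun q => tripleProduct (u q) (v q) (w q)) := by
  have hu := continuous_pi_iff.1 hu
  have hv := continuous_pi_iff.1 hv
  have hw := continuous_pi_iff.1 hw
  have h := fun i j => ((hv i).mul (hw j)).sub ((hv j).mul (hw i))
  exact (((hu 0).mul (h 1 2)).sub ((hu 1).mul (h 0 2))).add ((hu 2).mul (h 0 1))

theorem differentiableAt_pullbackField {ψ : (Fin 4 → ℝ) → ℂ} {ξ : (Fin 4 → ℝ) → C3}
    {q : Fin 4 → ℝ} (hξ : ContDiff ℝ ∞ ξ) (hψ : DifferentiableAt ℝ ψ q) :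
    DifferentiableAt ℝ (pullbackField ψ ξ) q := by
  have hA : ∀ i, DifferentiableAt ℝ (fun q => fderiv ℝ ξ q (Pi.single i 1)) q := fun i =>
    ((contDiff_infty_iff_fderiv.1 hξ).2.differentiable (by simp)).differentiableAt.clm_apply
      (differentiableAt_const _)
  have h := fun i j k => hψ.mul ((hA i).tripleProduct (hA j) (hA k))
  refine differentiableAt_pi.2 fun i => ?_
  fin_cases i
  exacts [h 1 2 3, (h 0 2 3).neg, h 0 1 3, (h 0 1 2).neg]

theorem continuous_pullbackField {ψ : (Fin 4 → ℝ) → ℂ} {ξ : (Fin 4 → ℝ) → C3}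
    (hξ : ContDiff ℝ ∞ ξ) (hψ : Continuous ψ) : Continuous (pullbackField ψ ξ) := by
  have hA : ∀ i, Continuous (fun q => fderiv ℝ ξ q (Pi.single i 1)) := fun i =>
    (contDiff_infty_iff_fderiv.1 hξ).2.continuous.clm_apply continuous_const
  have h := fun i j k => hψ.mul ((hA i).tripleProduct (hA j) (hA k))
  refine continuous_pi fun i => ?_
  fin_cases i
  exacts [h 1 2 3, (h 0 2 3).neg, h 0 1 3, (h 0 1 2).neg]

/-- The form `φ dξ₁ ∧ dξ₂ ∧ dξ₃` with holomorphic `φ` is closed. -/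
theorem divergence_pullbackField {ψ : (Fin 4 → ℝ) → ℂ} {ξ : (Fin 4 → ℝ) → C3}
    {q : Fin 4 → ℝ} (hξ : ContDiff ℝ ∞ ξ) {φ' : C3 →L[ℂ] ℂ}
    (hψ : HasFDerivAt ψ ((φ'.restrictScalars ℝ).comp (fderiv ℝ ξ q)) q) :
    ∑ i, fderiv ℝ (pullbackField ψ ξ) q (Pi.single i 1) i = 0 := by
  set e : Fin 4 → Fin 4 → ℝ := fun i => Pi.single i 1 with he
  set A : Fin 4 → C3 := fun i => fderiv ℝ ξ q (e i) with hA
  set B : Fin 4 → Fin 4 → C3 := fun i j => fderiv ℝ (fderiv ℝ ξ) q (e i) (e j) with hB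
  have hsymm : ∀ i j, B i j = B j i := fun i j =>
    (hξ.contDiffAt.isSymmSndFDerivAt
      (by rw [minSmoothness_of_isRCLikeNormedField]; exact WithTop.coe_le_coe.2 (le_top : (2 : ℕ∞) ≤ ⊤))).eq (e i) (e j)
  have hline : ∀ i, HasDerivAt (fun t : ℝ => q + t • e i) (e i) 0 := fun i => by
    simpa using ((hasDerivAt_id (0 : ℝ)).smul_const (e i)).const_add q
  have hq0 : ∀ i, q + (0 : ℝ) • e i = q := fun i => by simp
  have hAd : ∀ i j, HasDerivAt (fun t : ℝ => fderiv ℝ ξ (q + t • e i) (e j)) (B i j) 0 := by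
    intro i j
    have h1 := (contDiff_infty_iff_fderiv.1 hξ).2
    have h2 : HasFDerivAt (fderiv ℝ ξ) (fderiv ℝ (fderiv ℝ ξ) q) (q + (0 : ℝ) • e i) := by
      rw [hq0]
      exact (h1.differentiable (by simp)).differentiableAt.hasFDerivAt
    have h3 : HasDerivAt (fun t : ℝ => fderiv ℝ ξ (q + t • e i))
        (fderiv ℝ (fderiv ℝ ξ) q (e i)) 0 := h2.comp_hasDerivAt 0 (hline i)
    exact (h3.clm_apply (hasDerivAt_const 0 (e j))).congr_deriv (by rw [map_zero, add_zero])
  have hψd : ∀ i, HasDerivAt (fun t : ℝ => ψ (q + t • e i)) (φ' (A i)) 0 := by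
    intro i
    have h2 := hψ
    rw [← hq0 i] at h2
    refine (h2.comp_hasDerivAt 0 (hline i)).congr_deriv ?_
    rw [hq0]
    rfl
  have hfd : ∀ i, HasDerivAt (fun t : ℝ => pullbackField ψ ξ (q + t • e i) i)
      (fderiv ℝ (pullbackField ψ ξ) q (e i) i) 0 := by
    intro i
    have h1 := (differentiableAt_pullbackField hξ hψ.differentiableAt).hasFDerivAt
    rw [← hq0 i] at h1
    have h2 := hasDerivAt_pi.1 (h1.comp_hasDerivAt 0 (hline i)) i
    rw [hq0] at h2
    exact h2
  have h0 := (hfd 0).unique ((hψd 0).mul_tripleProduct (hAd 0 1) (hAd 0 2) (hAd 0 3))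
  have h1 := (hfd 1).unique ((hψd 1).mul_tripleProduct (hAd 1 0) (hAd 1 2) (hAd 1 3)).neg
  have h2 := (hfd 2).unique ((hψd 2).mul_tripleProduct (hAd 2 0) (hAd 2 1) (hAd 2 3))
  have h3 := (hfd 3).unique ((hψd 3).mul_tripleProduct (hAd 3 0) (hAd 3 1) (hAd 3 2)).neg
  rw [Fin.sum_univ_four]
  change fderiv ℝ (pullbackField ψ ξ) q (e 0) 0 + fderiv ℝ (pullbackField ψ ξ) q (e 1) 1 +
    fderiv ℝ (pullbackField ψ ξ) q (e 2) 2 + fderiv ℝ (pullbackField ψ ξ) q (e 3) 3 = 0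
  rw [h0, h1, h2, h3]
  simp only [hq0]
  -- Symmetry of second derivatives cancels the terms with `B` in pairs. What remains is a `4 × 4`
  -- determinant with columns `φ' (A i)` and the three coordinates of `A i`; its first column is a
  -- combination of the others.
  rw [hsymm 1 0, hsymm 2 0, hsymm 3 0, hsymm 2 1, hsymm 3 1, hsymm 3 2]
  have hφ : ∀ i, φ' (A i) = A i 0 * φ' (Pi.single 0 1) + A i 1 * φ' (Pi.single 1 1) +
      A i 2 * φ' (Pi.single 2 1) := by
    intro i
    have h4 : A i = A i 0 • Pi.single 0 1 + A i 1 • Pi.single 1 1 + A i 2 • Pi.single 2 1 := by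
      ext k; fin_cases k <;> simp
    conv_lhs => rw [h4]
    simp only [map_add, map_smul, smul_eq_mul]
  have hA' : ∀ i, fderiv ℝ ξ q (e i) = A i := fun i => rfl
  simp only [hφ, hA', tripleProduct]
  ring

theorem IsMultivaluedHolomorphic.continuous {X : Set C3} {Y : Type*} [TopologicalSpace Y]
    {p : Y → X} (hp : Continuous p) {Φ : Y → ℂ} (hΦ : IsMultivaluedHolomorphic p Φ) :
    Continuous Φ := by
  refine continuous_iff_continuousAt.2 fun y => ?_
  obtain ⟨φ, hφ, h⟩ := hΦ y
  have h1 : ContinuousAt (fun y => φ (p y : C3)) y :=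
    hφ.continuousAt.comp (f := fun y => (p y : C3)) (continuous_subtype_val.comp hp).continuousAt
  exact h1.congr (h.mono fun _ h => h.symm)

theorem fderiv_single_eq {E : Type*} [NormedAddCommGroup E] [NormedSpace ℝ E] {n : ℕ}
    {ξ : (Fin n → ℝ) → E} {q : Fin n → ℝ} {i : Fin n} {v : E} (hξ : DifferentiableAt ℝ ξ q)
    (hv : HasDerivAt (fun t : ℝ => ξ (q + t • (Pi.single i 1 : Fin n → ℝ))) v 0) :
    fderiv ℝ ξ q (Pi.single i 1) = v := by
  have h1 : HasDerivAt (fun t : ℝ => q + t • (Pi.single i 1 : Fin n → ℝ)) (Pi.single i 1) 0 := by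
    simpa using ((hasDerivAt_id (0 : ℝ)).smul_const (Pi.single i 1 : Fin n → ℝ)).const_add q
  have h2 : HasFDerivAt ξ (fderiv ℝ ξ q) (q + (0 : ℝ) • (Pi.single i 1 : Fin n → ℝ)) := by
    rw [zero_smul, add_zero]
    exact hξ.hasFDerivAt
  exact HasDerivAt.unique (h2.comp_hasDerivAt 0 h1) hv

/-- Stokes' theorem: the integral of a multivalued holomorphic `3`-form over the part of
`{x + i H(x, τ)}` over a box does not depend on `τ` if `H(x, τ)` does not depend on `τ` over the
boundary of the box. -/
theorem integral_box_deformation {X : Set C3} {Y : Type*} [TopologicalSpace Y]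
    {p : Y → X} (hp : Continuous p) {Φ : Y → ℂ} (hΦ : IsMultivaluedHolomorphic p Φ)
    {H : R3 → ℝ → R3} (hH : ContDiff ℝ ∞ (fun q : R3 × ℝ => H q.1 q.2))
    {l : R3 × unitInterval → Y} (hl : Continuous l)
    (hpl : ∀ x (τ : unitInterval), (p (l (x, τ)) : C3) = complexPoint x (H x τ))
    {a b : R3} (hab : a ≤ b)
    (hface : ∀ x ∈ Icc a b, (∃ k, x k = a k ∨ x k = b k) → ∀ τ, H x τ = H x 0) :
    ∫ x in Icc a b, Φ (l (x, 1)) * graphJacobian (fun x => H x 1) x =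
      ∫ x in Icc a b, Φ (l (x, 0)) * graphJacobian (fun x => H x 0) x := by
  set ξ : (Fin 4 → ℝ) → C3 := fun q =>
    realPoint (fun k => q k.succ) + Complex.I • realPoint (H (fun k => q k.succ) (q 0)) with hξ
  have hξc : ContDiff ℝ ∞ ξ := by
    have h1 : ContDiff ℝ ∞ fun q : Fin 4 → ℝ => (fun k : Fin 3 => q k.succ) := by fun_prop
    have h2 : ContDiff ℝ ∞ fun q : Fin 4 → ℝ => H (fun k => q k.succ) (q 0) :=
      hH.comp (h1.prodMk (contDiff_apply ℝ ℝ 0))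
    exact (realPoint.contDiff.comp h1).add ((realPoint.contDiff.comp h2).const_smul Complex.I)
  have hξd : ∀ q i v, HasDerivAt (fun t : ℝ => ξ (q + t • (Pi.single i 1 : Fin 4 → ℝ))) v 0 →
      fderiv ℝ ξ q (Pi.single i 1) = v := fun q i v hv =>
    fderiv_single_eq (hξc.differentiable (by simp)).differentiableAt hv
  have hA0 : ∀ q : Fin 4 → ℝ, (fun k : Fin 3 => q k.succ) ∈ Icc a b →
      (∃ k : Fin 3, q k.succ = a k ∨ q k.succ = b k) →
      fderiv ℝ ξ q (Pi.single 0 1) = 0 := by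
    intro q hqI hq
    refine hξd q 0 0 ?_
    have : (fun t : ℝ => ξ (q + t • (Pi.single 0 1 : Fin 4 → ℝ))) = fun _ => ξ q := by
      funext t
      have h1 : (fun k : Fin 3 => (q + t • (Pi.single 0 1 : Fin 4 → ℝ)) k.succ) =
          fun k => q k.succ := by
        funext k; simp
      simp only [hξ, h1]
      rw [hface _ hqI hq, hface _ hqI hq (q 0)]
    rw [this]
    exact hasDerivAt_const _ _
  have hAk : ∀ (q : Fin 4 → ℝ) (j k : Fin 3), fderiv ℝ ξ q (Pi.single j.succ 1) k =
      (if k = j then (1 : ℂ) else 0) + Complex.I *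
        ((fderiv ℝ (fun x => H x (q 0)) (fun k => q k.succ) (Pi.single j 1) k : ℝ) : ℂ) := by
    intro q j k
    have h1 : HasDerivAt (fun t : ℝ => (fun k : Fin 3 => q k.succ) + t • (Pi.single j 1 : R3))
        (Pi.single j 1) 0 := by
      simpa using ((hasDerivAt_id (0 : ℝ)).smul_const (Pi.single j 1 : R3)).const_add
        (fun k : Fin 3 => q k.succ)
    have h2 : ContDiff ℝ ∞ (fun x => H x (q 0)) := hH.comp (contDiff_id.prodMk contDiff_const)
    have h3 : HasFDerivAt (fun x => H x (q 0))
        (fderiv ℝ (fun x => H x (q 0)) (fun k => q k.succ))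
        ((fun k : Fin 3 => q k.succ) + (0 : ℝ) • (Pi.single j 1 : R3)) := by
      rw [zero_smul, add_zero]
      exact (h2.differentiable (by simp)).differentiableAt.hasFDerivAt
    have h4 := (realPoint.hasFDerivAt.comp_hasDerivAt (0 : ℝ) h1).add
      ((realPoint.hasFDerivAt.comp_hasDerivAt (0 : ℝ) (h3.comp_hasDerivAt (0 : ℝ) h1)).const_smul
        Complex.I)
    rw [hξd q j.succ _ (h4.congr_of_eventuallyEq (Eventually.of_forall fun t => ?_))]
    · simp only [Pi.add_apply, realPoint_apply, Pi.smul_apply, Pi.single_apply, smul_eq_mul]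
      split_ifs <;> simp
    · have h5 : (fun k : Fin 3 => (q + t • (Pi.single j.succ 1 : Fin 4 → ℝ)) k.succ) =
          (fun k : Fin 3 => q k.succ) + t • (Pi.single j 1 : R3) := by
        funext k
        simp [Pi.single_apply]
      have h6 : (q + t • (Pi.single j.succ 1 : Fin 4 → ℝ)) 0 = q 0 := by simp
      simp only [hξ, h5, h6]
      rfl
  -- The lift exists only for `τ ∈ [0, 1]`, so `τ` is projected to that interval. This keeps `ψ`
  -- continuous everywhere; differentiability is needed only in the interior.
  set ψ : (Fin 4 → ℝ) → ℂ := fun q =>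
    Φ (l (fun k => q k.succ, projIcc 0 1 zero_le_one (q 0))) with hψ
  have hmap : Continuous fun q : Fin 4 → ℝ =>
      ((fun k : Fin 3 => q k.succ), projIcc (0 : ℝ) 1 zero_le_one (q 0)) :=
    Continuous.prodMk (by fun_prop) (continuous_projIcc.comp (continuous_apply 0))
  have hψc : Continuous ψ := (hΦ.continuous hp).comp (hl.comp hmap)
  have hψd : ∀ q : Fin 4 → ℝ, q 0 ∈ Ioo (0 : ℝ) 1 → ∃ φ' : C3 →L[ℂ] ℂ,
      HasFDerivAt ψ ((φ'.restrictScalars ℝ).comp (fderiv ℝ ξ q)) q := by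
    intro q hq
    obtain ⟨φ, hφ, h⟩ := hΦ (l (fun k => q k.succ, projIcc 0 1 zero_le_one (q 0)))
    have hpξ : ∀ q : Fin 4 → ℝ, q 0 ∈ Icc (0 : ℝ) 1 →
        (p (l (fun k => q k.succ, projIcc 0 1 zero_le_one (q 0))) : C3) = ξ q := by
      intro q hq
      rw [hpl, complexPoint_eq, projIcc_of_mem _ hq]
    rw [hpξ q (Ioo_subset_Icc_self hq)] at hφ
    refine ⟨fderiv ℂ φ (ξ q), ?_⟩
    have h1 := ((hφ.differentiableAt.hasFDerivAt).restrictScalars ℝ).comp q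
      (hξc.differentiable (by simp)).differentiableAt.hasFDerivAt
    refine h1.congr_of_eventuallyEq ?_
    filter_upwards [((hl.comp hmap).tendsto q).eventually h,
      (isOpen_Ioo.preimage (continuous_apply (0 : Fin 4))).eventually_mem hq] with q' h2 h3
    rw [Function.comp_apply, ← hpξ q' (Ioo_subset_Icc_self h3)]
    exact h2
  set f := pullbackField ψ ξ with hf
  have hfc : Continuous f := continuous_pullbackField hξc hψc
  set a' : Fin 4 → ℝ := Fin.cons 0 a with ha'
  set b' : Fin 4 → ℝ := Fin.cons 1 b with hb'
  have hint : ∀ q ∈ univ.pi fun i => Ioo (a' i) (b' i), q 0 ∈ Ioo (0 : ℝ) 1 := fun q hq => by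
    simpa [ha', hb'] using hq 0 (mem_univ 0)
  classical
  -- Set to zero off the open box, where no derivative is claimed, so that the divergence vanishes
  -- identically.
  set f' : (Fin 4 → ℝ) → (Fin 4 → ℝ) →L[ℝ] Fin 4 → ℂ := fun q =>
    if q ∈ univ.pi fun i => Ioo (a' i) (b' i) then fderiv ℝ f q else 0 with hf'
  have hdiv : ∀ q, ∑ i, f' q (Pi.single i 1) i = 0 := by
    intro q
    by_cases hq : q ∈ univ.pi fun i => Ioo (a' i) (b' i)
    · obtain ⟨φ', hφ'⟩ := hψd q (hint q hq)
      simp only [hf', if_pos hq]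
      exact divergence_pullbackField hξc hφ'
    · simp only [hf', if_neg hq]
      simp
  have key := integral_divergence_of_hasFDerivAt_off_countable a' b'
    (by
      intro i
      refine Fin.cases ?_ (fun k => ?_) i
      · simp [ha', hb']
      · simpa [ha', hb'] using hab k)
    f f' ∅ countable_empty hfc.continuousOn (by
      rintro q ⟨hq, -⟩
      obtain ⟨φ', hφ'⟩ := hψd q (hint q hq)
      simp only [hf', if_pos hq]
      exact (differentiableAt_pullbackField hξc hφ'.differentiableAt).hasFDerivAt)
    (by simp only [hdiv]; exact integrableOn_zero)
  simp only [hdiv, integral_zero] at key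
  rw [Fin.sum_univ_succ, Finset.sum_eq_zero (s := Finset.univ (α := Fin 3)), add_zero] at key
  swap
  · intro k _
    -- Every component except the one normal to `τ` contains `∂ξ/∂τ` as a factor of the determinant,
    -- and this vector vanishes over the boundary of the box.
    have hfz : ∀ q : Fin 4 → ℝ, q ∈ Icc a' b' → (q k.succ = a k ∨ q k.succ = b k) →
        f q k.succ = 0 := by
      intro q hqI hq
      have h0 := hA0 q ⟨fun j => by simpa [ha'] using hqI.1 j.succ,
        fun j => by simpa [hb'] using hqI.2 j.succ⟩ ⟨k, hq⟩
      fin_cases k <;> simp [hf, pullbackField, tripleProduct, h0]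
    have hab'' : a' k.succ ≤ b' k.succ := by simpa [ha', hb'] using hab k
    have h1 : ∀ x ∈ Icc (a' ∘ k.succ.succAbove) (b' ∘ k.succ.succAbove),
        f (k.succ.insertNth (b' k.succ) x) k.succ = 0 := fun x hx =>
      hfz _ (Fin.insertNth_mem_Icc.2 ⟨right_mem_Icc.2 hab'', hx⟩) (by right; simp [hb'])
    have h2 : ∀ x ∈ Icc (a' ∘ k.succ.succAbove) (b' ∘ k.succ.succAbove),
        f (k.succ.insertNth (a' k.succ) x) k.succ = 0 := fun x hx =>
      hfz _ (Fin.insertNth_mem_Icc.2 ⟨left_mem_Icc.2 hab'', hx⟩) (by left; simp [ha'])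
    rw [setIntegral_eq_zero_of_forall_eq_zero h1, setIntegral_eq_zero_of_forall_eq_zero h2,
      sub_zero]
  have hab' : a' ∘ (0 : Fin 4).succAbove = a ∧ b' ∘ (0 : Fin 4).succAbove = b := by
    constructor <;> (ext k; simp [ha', hb'])
  have hval : ∀ (τ : unitInterval) (x : R3), f ((0 : Fin 4).insertNth (τ : ℝ) x) 0 =
      Φ (l (x, τ)) * graphJacobian (fun x => H x τ) x := by
    intro τ x
    have hx : (fun k : Fin 3 => ((0 : Fin 4).insertNth (τ : ℝ) x : Fin 4 → ℝ) k.succ) = x := by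
      funext k; simp
    have h0 : ((0 : Fin 4).insertNth (τ : ℝ) x : Fin 4 → ℝ) 0 = τ := by simp
    have hA := fun j k => hAk ((0 : Fin 4).insertNth (τ : ℝ) x) j k
    simp only [hx, h0] at hA
    have hψ0 : ψ ((0 : Fin 4).insertNth (τ : ℝ) x) = Φ (l (x, τ)) := by
      simp only [hψ, hx, h0, projIcc_val]
    have h1 : f ((0 : Fin 4).insertNth (τ : ℝ) x) 0 = Φ (l (x, τ)) *
        tripleProduct (fderiv ℝ ξ ((0 : Fin 4).insertNth (τ : ℝ) x) (Pi.single (0 : Fin 3).succ 1))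
          (fderiv ℝ ξ ((0 : Fin 4).insertNth (τ : ℝ) x) (Pi.single (1 : Fin 3).succ 1))
          (fderiv ℝ ξ ((0 : Fin 4).insertNth (τ : ℝ) x) (Pi.single (2 : Fin 3).succ 1)) := by
      rw [← hψ0]
      rfl
    rw [h1]
    congr 1
    simp only [tripleProduct, hA, graphJacobian, Matrix.det_fin_three, Matrix.of_apply]
    ring
  have hb0 : b' 0 = ((1 : unitInterval) : ℝ) := by simp [hb']
  have ha0 : a' 0 = ((0 : unitInterval) : ℝ) := by simp [ha']
  rw [hab'.1, hab'.2, hb0, ha0] at key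
  simp only [hval] at key
  have := sub_eq_zero.1 key.symm
  simpa using this

/-! ### Deformations with a lift to the covering, and invariance of the integral. -/

/-- A smooth deformation `{x + i H(x, τ)}` together with a lift `l` to the covering space that
starts at the branch `s`. -/
structure IsLiftedDeformation {X : Set C3} {Y : Type*} [TopologicalSpace Y] (p : Y → X)
    (s : R3 → Y) (H : R3 → ℝ → R3) (l : R3 × unitInterval → Y) : Prop where
  smooth : ContDiff ℝ ∞ (fun q : R3 × ℝ => H q.1 q.2)
  continuous : Continuous l
  initial : ∀ x, l (x, 0) = s x
  lifts : ∀ x (τ : unitInterval), (p (l (x, τ)) : C3) = complexPoint x (H x τ)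

/-- The multivalued holomorphic function `F exp(i Λ G)`. -/
noncomputable def expAmplitude {X : Set C3} {Y : Type*} (p : Y → X) (F : Y → ℂ) (G : C3 → ℂ)
    (Λ : ℝ) (y : Y) : ℂ :=
  F y * Complex.exp (Complex.I * (Λ : ℂ) * G (p y : C3))

section Lifts

variable {X : Set C3} {Y : Type*} {p : Y → X} {F : Y → ℂ} {G : C3 → ℂ}
  {s : R3 → Y} {H K : R3 → ℝ → R3} {l m : R3 × unitInterval → Y}

theorem graphIntegrand_eq {η : R3 → R3} {x : R3} (hs : (p (s x) : C3) = complexPoint x (η x))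
    (Λ : ℝ) : graphIntegrand F G η s Λ x = expAmplitude p F G Λ (s x) * graphJacobian η x := by
  rw [graphIntegrand, expAmplitude, hs]

theorem graphIntegrand_congr {η η' : R3 → R3} {s' : R3 → Y} {x : R3} (hη : η =ᶠ[𝓝 x] η')
    (hs : s x = s' x) (Λ : ℝ) : graphIntegrand F G η s Λ x = graphIntegrand F G η' s' Λ x := by
  simp only [graphIntegrand, graphJacobian, hs, hη.fderiv_eq, hη.self_of_nhds]

variable [TopologicalSpace Y]

theorem IsMultivaluedHolomorphic.expAmplitude (hF : IsMultivaluedHolomorphic p F)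
    (hG : ∀ ξ ∈ X, AnalyticAt ℂ G ξ) (Λ : ℝ) :
    IsMultivaluedHolomorphic p (expAmplitude p F G Λ) := by
  intro y
  obtain ⟨φ, hφ, h⟩ := hF y
  have hGy := hG _ (p y).2
  refine ⟨fun ξ => φ ξ * Complex.exp (Complex.I * (Λ : ℂ) * G ξ), by fun_prop, ?_⟩
  filter_upwards [h] with y' hy'
  simp only [_root_.expAmplitude, hy']

theorem IsLiftedDeformation.lifts_one (h : IsLiftedDeformation p s H l) (x : R3) :
    (p (l (x, 1)) : C3) = complexPoint x (H x 1) := by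
  simpa using h.lifts x 1

theorem IsLiftedDeformation.lifts_zero (h : IsLiftedDeformation p s H l) (x : R3) :
    (p (s x) : C3) = complexPoint x (H x 0) := by
  simpa [h.initial] using h.lifts x 0

/-- Homotopy lifting: the branch of `F` is carried along the deformation. -/
theorem exists_isLiftedDeformation (hp : IsCoveringMap p) (hs : Continuous s)
    (hH : ContDiff ℝ ∞ (fun q : R3 × ℝ => H q.1 q.2))
    (hHX : ∀ x, ∀ τ ∈ Icc (0 : ℝ) 1, complexPoint x (H x τ) ∈ X)
    (hsH : ∀ x, (p (s x) : C3) = complexPoint x (H x 0)) :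
    ∃ l, IsLiftedDeformation p s H l := by
  let Hc : C(unitInterval × R3, X) := ⟨fun q => ⟨complexPoint q.2 (H q.2 q.1), hHX q.2 q.1 q.1.2⟩, by
    refine Continuous.subtype_mk ?_ _
    have h1 : Continuous fun q : unitInterval × R3 => H q.2 q.1 :=
      hH.continuous.comp (f := fun q : unitInterval × R3 => (q.2, (q.1 : ℝ))) (by fun_prop)
    exact continuous_complexPoint.comp (continuous_snd.prodMk h1)⟩
  have h0 : ∀ x, Hc (0, x) = p ((⟨s, hs⟩ : C(R3, Y)) x) := fun x => Subtype.ext (by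
    simp [Hc, hsH])
  refine ⟨fun q => hp.liftHomotopy Hc ⟨s, hs⟩ h0 (q.2, q.1), hH,
    (hp.liftHomotopy Hc ⟨s, hs⟩ h0).continuous.comp continuous_swap,
    fun x => hp.liftHomotopy_zero Hc ⟨s, hs⟩ h0 x, fun x τ => ?_⟩
  have := congrFun (hp.liftHomotopy_lifts Hc ⟨s, hs⟩ h0) (τ, x)
  exact congrArg Subtype.val this

/-- A lift of a constant path is constant. So the branch does not change over the points where the
domain does not move. -/
theorem IsLiftedDeformation.eq_of_const (hp : IsCoveringMap p) (h : IsLiftedDeformation p s H l)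
    {x : R3} (hx : ∀ τ, H x τ = H x 0) (τ : unitInterval) : l (x, τ) = s x := by
  rw [← h.initial]
  refine hp.const_of_comp (g := fun τ => l (x, τ)) (h.continuous.comp (by fun_prop))
    (fun a b => ?_) τ 0
  refine Subtype.ext ?_
  rw [h.lifts, h.lifts, hx, hx b]

theorem IsLiftedDeformation.continuous_end (h : IsLiftedDeformation p s H l) :
    Continuous fun x => l (x, 1) := h.continuous.comp (by fun_prop)

theorem IsLiftedDeformation.contDiff_end (h : IsLiftedDeformation p s H l) (τ : ℝ) :
    ContDiff ℝ ∞ fun x => H x τ := h.smooth.comp (contDiff_id.prodMk contDiff_const)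

/-- Concatenation of deformations. -/
theorem IsLiftedDeformation.trans (h : IsLiftedDeformation p s H l)
    (h' : IsLiftedDeformation p (fun x => l (x, 1)) K m) (hKH : ∀ x, K x 0 = H x 1) :
    ∃ H' l', IsLiftedDeformation p s H' l' ∧ (∀ x, H' x 0 = H x 0) ∧ (∀ x, H' x 1 = K x 1) ∧
      ∀ x, l' (x, 1) = m (x, 1) := by
  have hχ : ContDiff ℝ ∞ Real.smoothTransition := Real.smoothTransition.contDiff
  have hχ0 : ∀ {t : ℝ}, t ≤ 0 → Real.smoothTransition t = 0 := Real.smoothTransition.zero_of_nonpos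
  have hχ1 : ∀ {t : ℝ}, 1 ≤ t → Real.smoothTransition t = 1 := Real.smoothTransition.one_of_one_le
  set χ : ℝ → unitInterval := fun t =>
    ⟨Real.smoothTransition t, Real.smoothTransition.nonneg t, Real.smoothTransition.le_one t⟩ with hχd
  have hχc : Continuous χ := hχ.continuous.subtype_mk _
  have hχ0' : ∀ {t : ℝ}, t ≤ 0 → χ t = 0 := fun ht => Subtype.ext (hχ0 ht)
  have hχ1' : ∀ {t : ℝ}, 1 ≤ t → χ t = 1 := fun ht => Subtype.ext (hχ1 ht)
  -- At each `τ` one of the two motions rests at the common position `H x 1`; subtracting it leaves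
  -- the moving one.
  refine ⟨fun x τ => H x (Real.smoothTransition (2 * τ)) + K x (Real.smoothTransition (2 * τ - 1)) -
      H x 1, fun q => if (q.2 : ℝ) ≤ 1 / 2 then l (q.1, χ (2 * q.2)) else m (q.1, χ (2 * q.2 - 1)),
    ⟨?_, ?_, ?_, ?_⟩, ?_, ?_, ?_⟩
  · have h1 : ContDiff ℝ ∞ fun q : R3 × ℝ => H q.1 (Real.smoothTransition (2 * q.2)) :=
      h.smooth.comp (f := fun q : R3 × ℝ => (q.1, Real.smoothTransition (2 * q.2))) (by fun_prop)
    have h2 : ContDiff ℝ ∞ fun q : R3 × ℝ => K q.1 (Real.smoothTransition (2 * q.2 - 1)) :=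
      h'.smooth.comp (f := fun q : R3 × ℝ => (q.1, Real.smoothTransition (2 * q.2 - 1)))
        (by fun_prop)
    exact (h1.add h2).sub ((h.contDiff_end 1).comp contDiff_fst)
  · refine Continuous.if_le ?_ ?_ (by fun_prop) continuous_const ?_
    · exact h.continuous.comp (by fun_prop)
    · exact h'.continuous.comp (by fun_prop)
    · rintro ⟨x, τ⟩ hτ
      simp only at hτ ⊢
      rw [hχ1' (by linarith), hχ0' (by linarith), h'.initial]
  · intro x
    have h1 : (((0 : unitInterval) : ℝ) ≤ 1 / 2) := by norm_num
    have h2 : χ (2 * ((0 : unitInterval) : ℝ)) = 0 := hχ0' (by simp)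
    simp only [h1, if_true, h2, h.initial]
  · intro x τ
    by_cases hτ : (τ : ℝ) ≤ 1 / 2
    · simp only [hτ, if_true, h.lifts]
      rw [hχ0 (t := 2 * (τ : ℝ) - 1) (by linarith), hKH, add_sub_cancel_right]
    · simp only [hτ, if_false, h'.lifts]
      rw [hχ1 (t := 2 * (τ : ℝ)) (by linarith), add_sub_cancel_left]
  · intro x
    simp [hχ0, hKH]
  · intro x
    have h1 : Real.smoothTransition (2 * 1) = 1 := hχ1 (by norm_num)
    have h2 : Real.smoothTransition (2 * 1 - 1) = 1 := hχ1 (by norm_num)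
    simp only [h1, h2, add_sub_cancel_left]
  · intro x
    have h1 : ¬ (((1 : unitInterval) : ℝ) ≤ 1 / 2) := by norm_num
    have h2 : χ (2 * ((1 : unitInterval) : ℝ) - 1) = 1 := hχ1' (by norm_num)
    simp only [h1, if_false, h2]

theorem continuous_graphJacobian {η : R3 → R3} (hη : ContDiff ℝ ∞ η) :
    Continuous (graphJacobian η) := by
  refine Continuous.matrix_det (continuous_pi fun k => continuous_pi fun l => ?_)
  have h1 : Continuous fun x => fderiv ℝ η x (Pi.single l 1) k :=
    (continuous_apply k).comp
      ((hη.continuous_fderiv (by simp)).clm_apply continuous_const)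
  exact continuous_const.add (continuous_const.mul (Complex.continuous_ofReal.comp h1))

theorem norm_graphJacobian_le {η : R3 → R3} {x : R3} {B : ℝ} (hB : ‖fderiv ℝ η x‖ ≤ B) :
    ‖graphJacobian η x‖ ≤ 6 * (1 + B) ^ 3 := by
  have hB0 : 0 ≤ B := (norm_nonneg _).trans hB
  have h1 : ∀ k l, ‖(if k = l then (1 : ℂ) else 0) +
      Complex.I * ((fderiv ℝ η x (Pi.single l 1) k : ℝ) : ℂ)‖ ≤ 1 + B := by
    intro k l
    refine (norm_add_le _ _).trans (add_le_add ?_ ?_)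
    · split_ifs <;> simp
    · rw [norm_mul, Complex.norm_I, one_mul, Complex.norm_real]
      refine (norm_le_pi_norm _ k).trans (((fderiv ℝ η x).le_opNorm _).trans ?_)
      simpa [Pi.norm_single] using hB
  have h2 : ‖graphJacobian η x‖ ≤ Nat.factorial (Fintype.card (Fin 3)) •
      (1 + B) ^ Fintype.card (Fin 3) :=
    Matrix.det_le (abv := NormedField.toAbsoluteValue ℂ) (x := 1 + B) (A := Matrix.of fun k l =>
    (if k = l then (1 : ℂ) else 0) + Complex.I * ((fderiv ℝ η x (Pi.single l 1) k : ℝ) : ℂ))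
    (fun k l => h1 k l)
  simpa [Nat.factorial] using h2

theorem continuous_graphIntegrand (hp : IsCoveringMap p)
    (hF : IsMultivaluedHolomorphic p F) (hG : ∀ ξ ∈ X, AnalyticAt ℂ G ξ)
    {η : R3 → R3} (hη : ContDiff ℝ ∞ η) (hs : Continuous s)
    (hsη : ∀ x, (p (s x) : C3) = complexPoint x (η x)) (Λ : ℝ) :
    Continuous (graphIntegrand F G η s Λ) := by
  have h1 : graphIntegrand F G η s Λ = fun x => expAmplitude p F G Λ (s x) * graphJacobian η x :=
    funext fun x => graphIntegrand_eq (hsη x) Λ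
  rw [h1]
  exact (((hF.expAmplitude hG Λ).continuous hp.continuous).comp hs).mul
    (continuous_graphJacobian hη)

theorem IsLiftedDeformation.graphIntegral_Icc (hp : IsCoveringMap p)
    (hF : IsMultivaluedHolomorphic p F) (hG : ∀ ξ ∈ X, AnalyticAt ℂ G ξ)
    (h : IsLiftedDeformation p s H l) {a b : R3}
    (hab : a ≤ b) (hface : ∀ x ∈ Icc a b, (∃ k, x k = a k ∨ x k = b k) → ∀ τ, H x τ = H x 0) (Λ : ℝ) :
    graphIntegral F G (fun x => H x 1) (fun x => l (x, 1)) (Icc a b) Λ =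
      graphIntegral F G (fun x => H x 0) s (Icc a b) Λ := by
  have := integral_box_deformation hp.continuous (hF.expAmplitude hG Λ) h.smooth
    h.continuous h.lifts hab hface
  simp only [graphIntegral]
  simp only [h.initial] at this
  convert this using 2
  · ext x
    exact graphIntegrand_eq (h.lifts_one x) Λ
  · ext x
    exact graphIntegrand_eq (h.lifts_zero x) Λ

/-- In the sup norm balls are boxes, so Stokes' theorem for boxes applies to them directly. -/
theorem IsLiftedDeformation.graphIntegral_closedBall (hp : IsCoveringMap p)
    (hF : IsMultivaluedHolomorphic p F) (hG : ∀ ξ ∈ X, AnalyticAt ℂ G ξ)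
    (h : IsLiftedDeformation p s H l) {c : R3}
    {r : ℝ} (hr : 0 ≤ r) (hface : ∀ x ∈ Metric.sphere c r, ∀ τ, H x τ = H x 0) (Λ : ℝ) :
    graphIntegral F G (fun x => H x 1) (fun x => l (x, 1)) (Metric.closedBall c r) Λ =
      graphIntegral F G (fun x => H x 0) s (Metric.closedBall c r) Λ := by
  have hb : Metric.closedBall c r = Icc (fun k => c k - r) (fun k => c k + r) := by
    rw [closedBall_pi _ hr, ← pi_univ_Icc]
    simp_rw [Real.closedBall_eq_Icc]
  rw [hb]
  refine IsLiftedDeformation.graphIntegral_Icc hp hF hG h (fun k => ?_)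
    (fun x hx ⟨k, hk⟩ => hface x ?_) Λ
  · simp only
    linarith
  · rw [← hb] at hx
    refine le_antisymm hx (le_trans ?_ (dist_le_pi_dist x c k))
    rw [Real.dist_eq]
    rcases hk with hk | hk <;> rw [hk]
    · rw [sub_sub_cancel_left, abs_neg, abs_of_nonneg hr]
    · rw [add_sub_cancel_left, abs_of_nonneg hr]

/-- Stokes' theorem for a deformation with compact support. -/
theorem IsLiftedDeformation.integral_graphIntegrand (hp : IsCoveringMap p)
    (hF : IsMultivaluedHolomorphic p F) (hG : ∀ ξ ∈ X, AnalyticAt ℂ G ξ)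
    (h : IsLiftedDeformation p s H l)
    (hs : Continuous s) {r : ℝ} (hr : ∀ x, r ≤ ‖x‖ → ∀ τ, H x τ = H x 0) {Λ : ℝ}
    (hint : Integrable (graphIntegrand F G (fun x => H x 0) s Λ)) :
    Integrable (graphIntegrand F G (fun x => H x 1) (fun x => l (x, 1)) Λ) ∧
      ∫ x, graphIntegrand F G (fun x => H x 1) (fun x => l (x, 1)) Λ x =
        ∫ x, graphIntegrand F G (fun x => H x 0) s Λ x := by
  set W₁ := graphIntegrand F G (fun x => H x 1) (fun x => l (x, 1)) Λ with hW₁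
  set W₀ := graphIntegrand F G (fun x => H x 0) s Λ with hW₀
  have hc₁ : Continuous W₁ := continuous_graphIntegrand hp hF hG (h.contDiff_end 1)
    h.continuous_end h.lifts_one Λ
  have hc₀ : Continuous W₀ := continuous_graphIntegrand hp hF hG (h.contDiff_end 0) hs
    h.lifts_zero Λ
  set a : R3 := fun _ => -(|r| + 1) with ha
  set b : R3 := fun _ => |r| + 1 with hb
  have heq : ∀ x ∉ Icc a b, W₁ x = W₀ x := by
    intro x hx
    have h1 : r < ‖x‖ := by
      by_contra! hle
      refine hx ⟨fun k => ?_, fun k => ?_⟩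
      all_goals
        have h2 := (norm_le_pi_norm x k).trans hle
        rw [Real.norm_eq_abs, abs_le] at h2
        have := le_abs_self r
        simp only [ha, hb]
        linarith
    refine graphIntegrand_congr ?_ (h.eq_of_const hp (hr x h1.le) 1) Λ
    filter_upwards [(isOpen_lt continuous_const continuous_norm).eventually_mem h1] with y hy
    exact hr y (le_of_lt hy) 1
  have hi₁ : Integrable W₁ := by
    -- The two integrands differ only over a compact set, so integrability passes from one to the
    -- other.
    have h1 : Integrable (fun x => W₁ x - W₀ x) := by
      refine (hc₁.sub hc₀).integrable_of_hasCompactSupport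
        (HasCompactSupport.intro (isCompact_Icc (a := a) (b := b)) fun x hx => ?_)
      rw [Pi.sub_apply, heq x hx, sub_self]
    exact (h1.add hint).congr (Eventually.of_forall fun x => by simp)
  refine ⟨hi₁, ?_⟩
  rw [← integral_add_compl (measurableSet_Icc (a := a) (b := b)) hi₁,
    ← integral_add_compl (measurableSet_Icc (a := a) (b := b)) hint]
  congr 1
  · refine IsLiftedDeformation.graphIntegral_Icc hp hF hG h (fun k => ?_)
      (fun x _ ⟨k, hk⟩ => hr x ?_) Λ
    · simp only [ha, hb]
      linarith [abs_nonneg r]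
    · refine le_trans ?_ (norm_le_pi_norm x k)
      have h2 : |x k| = |r| + 1 := by
        rcases hk with hk | hk <;> simp only [hk, ha, hb, abs_neg] <;>
        exact abs_of_nonneg (by positivity)
      rw [Real.norm_eq_abs, h2]
      linarith [le_abs_self r]
  · exact setIntegral_congr_fun measurableSet_Icc.compl fun x hx => heq x hx

end Lifts

/-! ### The deformation near infinity. -/

/-- A smooth cutoff function with values in `[0, 1]`, vanishing on the ball of radius `r`, with
derivative bounded by `C`. -/
structure IsOuterCutoff (r C : ℝ) (θ : R3 → ℝ) : Prop where
  smooth : ContDiff ℝ ∞ θ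
  mem : ∀ x, θ x ∈ Icc (0 : ℝ) 1
  zero : ∀ x, ‖x‖ ≤ r → θ x = 0
  bound : ∀ x, ‖fderiv ℝ θ x‖ ≤ C

theorem isOuterCutoff_zero (r : ℝ) : IsOuterCutoff r 0 fun _ => 0 :=
  ⟨contDiff_const, fun _ => by simp, fun _ _ => rfl, fun x => by simp⟩

theorem ContDiffBump.exists_norm_fderiv_le (f : ContDiffBump (0 : R3)) :
    ∃ C, 0 ≤ C ∧ ∀ x, ‖fderiv ℝ f x‖ ≤ C := by
  have hf : ContDiff ℝ 1 f := f.contDiff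
  obtain ⟨C, hC⟩ := (hf.continuous_fderiv one_ne_zero)
    |>.bounded_above_of_compact_support (f.hasCompactSupport.fderiv (𝕜 := ℝ))
  exact ⟨C, (norm_nonneg _).trans (hC 0), hC⟩

theorem exists_isOuterCutoff {r : ℝ} (hr : 0 < r) :
    ∃ C θ, 0 ≤ C ∧ IsOuterCutoff r C θ ∧ ∀ x, r + 1 ≤ ‖x‖ → θ x = 1 := by
  let f : ContDiffBump (0 : R3) := ⟨r, r + 1, hr, by linarith⟩
  obtain ⟨C, hC0, hC⟩ := f.exists_norm_fderiv_le
  refine ⟨C, fun x => 1 - f x, hC0, ⟨contDiff_const.sub f.contDiff,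
    fun x => ⟨sub_nonneg.2 f.le_one, sub_le_self _ f.nonneg⟩, fun x hx => ?_, fun x => ?_⟩,
    fun x hx => ?_⟩
  · beta_reduce
    rw [f.one_of_mem_closedBall (by simpa [f] using hx), sub_self]
  · rw [fderiv_const_sub, norm_neg]
    exact hC x
  · beta_reduce
    rw [f.zero_of_le_dist (by simpa [f] using hx), sub_zero]

/-- Cutting an outer cutoff function off at infinity, with a uniform bound of the derivatives. -/
theorem IsOuterCutoff.exists_seq {r C : ℝ} {θ : R3 → ℝ} (hθ : IsOuterCutoff r C θ) :
    ∃ (C' : ℝ) (θn : ℕ → R3 → ℝ), (∀ n, IsOuterCutoff r C' (θn n)) ∧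
      (∀ n, ∃ R, ∀ x, R ≤ ‖x‖ → θn n x = 0) ∧
      ∀ x, ∀ᶠ n in atTop, θn n =ᶠ[𝓝 x] θ := by
  let f : ContDiffBump (0 : R3) := ⟨1, 2, one_pos, one_lt_two⟩
  obtain ⟨D, hD0, hD⟩ := f.exists_norm_fderiv_le
  have hc : ∀ n : ℕ, (0 : ℝ) < n + 1 := fun n => by positivity
  have hχ : ∀ n : ℕ, ContDiff ℝ ∞ fun x : R3 => f (((n : ℝ) + 1)⁻¹ • x) := fun n =>
    f.contDiff.comp (contDiff_id.const_smul _)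
  -- The bump function is stretched by `n + 1 ≥ 1`, which only decreases its derivative; hence one
  -- bound serves all `n`.
  refine ⟨C + D, fun n x => θ x * f (((n : ℝ) + 1)⁻¹ • x), fun n => ⟨hθ.smooth.mul (hχ n),
    fun x => ⟨mul_nonneg (hθ.mem x).1 f.nonneg, mul_le_one₀ (hθ.mem x).2 f.nonneg f.le_one⟩,
    fun x hx => by simp only [hθ.zero x hx, zero_mul], fun x => ?_⟩, fun n => ?_, fun x => ?_⟩
  · rw [fderiv_fun_mul (hθ.smooth.differentiable (by simp) x) ((hχ n).differentiable (by simp) x)]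
    have h1 : ‖fderiv ℝ (fun x : R3 => f (((n : ℝ) + 1)⁻¹ • x)) x‖ ≤ D := by
      rw [fderiv_comp_smul, norm_smul, norm_inv, Real.norm_of_nonneg (hc n).le]
      refine (mul_le_of_le_one_left (norm_nonneg _) (inv_le_one_of_one_le₀ ?_)).trans (hD _)
      have : (0 : ℝ) ≤ n := n.cast_nonneg
      linarith
    refine (norm_add_le _ _).trans ?_
    rw [norm_smul, norm_smul, Real.norm_of_nonneg (hθ.mem x).1, Real.norm_of_nonneg f.nonneg,
      add_comm]
    exact add_le_add ((mul_le_of_le_one_left (norm_nonneg _) f.le_one).trans (hθ.bound x))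
      ((mul_le_of_le_one_left (norm_nonneg _) (hθ.mem x).2).trans h1)
  · refine ⟨2 * (n + 1), fun x hx => ?_⟩
    beta_reduce
    rw [f.zero_of_le_dist, mul_zero]
    rw [dist_zero_right, norm_smul, norm_inv, Real.norm_of_nonneg (hc n).le]
    rw [inv_mul_eq_div, le_div_iff₀ (hc n)]
    exact hx
  · obtain ⟨N, hN⟩ := exists_nat_gt ‖x‖
    filter_upwards [eventually_ge_atTop N] with n hn
    have h1 : ‖x‖ < (n : ℝ) + 1 := hN.trans_le (by
      have : (N : ℝ) ≤ n := by exact_mod_cast hn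
      linarith)
    filter_upwards [(isOpen_lt continuous_norm continuous_const).eventually_mem h1] with y hy
    have h2 : ‖y‖ < (n : ℝ) + 1 := hy
    rw [f.one_of_mem_closedBall, mul_one]
    rw [mem_closedBall_zero_iff, norm_smul, norm_inv, Real.norm_of_nonneg (hc n).le]
    rw [inv_mul_eq_div, div_le_iff₀ (hc n)]
    simpa [f] using h2.le

/-- A lifted family of displacements `h x τ`, `‖x‖ ≥ R`, with bounded first derivatives, which
starts at `Γ`. -/
structure IsFamilyNearInfinity {X : Set C3} {Y : Type*} [TopologicalSpace Y] (p : Y → X)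
    (η₀ : R3 → R3) (s₀ : R3 → Y) (R M : ℝ) (h : R3 → ℝ → R3) (l : R3 × unitInterval → Y) :
    Prop where
  smooth₀ : ContDiff ℝ ∞ η₀
  continuous₀ : Continuous s₀
  lifts₀ : ∀ x, (p (s₀ x) : C3) = complexPoint x (η₀ x)
  smooth : ContDiff ℝ ∞ (fun q : R3 × ℝ => h q.1 q.2)
  continuousOn : ContinuousOn l {q | R ≤ ‖q.1‖}
  initial : ∀ x, R ≤ ‖x‖ → h x 0 = η₀ x
  initial_lift : ∀ x, R ≤ ‖x‖ → l (x, 0) = s₀ x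
  lifts : ∀ x, R ≤ ‖x‖ → ∀ τ : unitInterval, (p (l (x, τ)) : C3) = complexPoint x (h x τ)
  bound : ∀ x, R ≤ ‖x‖ → ∀ τ ∈ Icc (0 : ℝ) 1,
    ‖fderiv ℝ (fun q : R3 × ℝ => h q.1 q.2) (x, τ)‖ ≤ M

/-- The deformation along `h` up to the parameter value `θ x`. -/
def cutoffDeformation (η₀ : R3 → R3) (h : R3 → ℝ → R3) (θ : R3 → ℝ) (x : R3) (τ : ℝ) : R3 :=
  -- The family `h` is tied to `η₀` only for `‖x‖ ≥ R`. Adding the increment of `h` to `η₀` gives a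
  -- globally smooth formula that equals `η₀` wherever `θ` vanishes.
  η₀ x + (h x (τ * θ x) - h x 0)

-- The lift `l` is controlled only for `‖x‖ ≥ R`, so the original branch is kept on the ball of
-- radius `r`. The pieces match on the sphere because an outer cutoff still vanishes there.
open Classical in
noncomputable def cutoffLift {Y : Type*} (r : ℝ) (s₀ : R3 → Y) (l : R3 × unitInterval → Y)
    (θ : R3 → ℝ) (q : R3 × unitInterval) : Y :=
  if ‖q.1‖ ≤ r then s₀ q.1 else l (q.1, projIcc 0 1 zero_le_one (q.2 * θ q.1))

theorem cutoffLift_congr {Y : Type*} {s₀ : R3 → Y} {l : R3 × unitInterval → Y} {r : ℝ}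
    {θ θ' : R3 → ℝ} {x : R3} (hx : θ x = θ' x) :
    cutoffLift r s₀ l θ (x, 1) = cutoffLift r s₀ l θ' (x, 1) := by
  simp only [cutoffLift, hx]

section Tame

variable {X : Set C3} {Y : Type*} {p : Y → X} {F : Y → ℂ} {G : C3 → ℂ}
  {η₀ : R3 → R3} {s₀ : R3 → Y} {R M r C : ℝ} {h : R3 → ℝ → R3} {l : R3 × unitInterval → Y}
  {θ θ' : R3 → ℝ}

theorem graphIntegrand_cutoff_congr {x : R3} (hx : θ =ᶠ[𝓝 x] θ') (Λ : ℝ) :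
    graphIntegrand F G (fun x => cutoffDeformation η₀ h θ x 1)
        (fun x => cutoffLift r s₀ l θ (x, 1)) Λ x =
      graphIntegrand F G (fun x => cutoffDeformation η₀ h θ' x 1)
        (fun x => cutoffLift r s₀ l θ' (x, 1)) Λ x := by
  refine graphIntegrand_congr ?_ (cutoffLift_congr (θ := θ) (θ' := θ') hx.self_of_nhds) Λ
  filter_upwards [hx] with y hy
  simp only [cutoffDeformation, hy]

variable [TopologicalSpace Y]

theorem cutoffDeformation_zero (x : R3) : cutoffDeformation η₀ h θ x 0 = η₀ x := by
  simp [cutoffDeformation]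

theorem cutoffDeformation_eq_of_zero {x : R3} (hx : θ x = 0) (τ : ℝ) :
    cutoffDeformation η₀ h θ x τ = η₀ x := by
  simp [cutoffDeformation, hx]

theorem IsFamilyNearInfinity.cutoffDeformation_eq (H : IsFamilyNearInfinity p η₀ s₀ R M h l)
    {x : R3} (hx : R ≤ ‖x‖) (τ : ℝ) : cutoffDeformation η₀ h θ x τ = h x (τ * θ x) := by
  rw [cutoffDeformation, H.initial x hx, add_sub_cancel]

theorem IsFamilyNearInfinity.isLiftedDeformation (H : IsFamilyNearInfinity p η₀ s₀ R M h l)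
    (hr : R ≤ r) (hθ : IsOuterCutoff r C θ) :
    IsLiftedDeformation p s₀ (cutoffDeformation η₀ h θ) (cutoffLift r s₀ l θ) := by
  have hz : ∀ x, R ≤ ‖x‖ → l (x, projIcc 0 1 zero_le_one (0 : ℝ)) = s₀ x := fun x hx => by
    rw [projIcc_left]; exact H.initial_lift x hx
  refine ⟨?_, ?_, fun x => ?_, fun x τ => ?_⟩
  · have hθs := hθ.smooth
    have h1 : ContDiff ℝ ∞ fun q : R3 × ℝ => h q.1 (q.2 * θ q.1) :=
      H.smooth.comp (f := fun q : R3 × ℝ => (q.1, q.2 * θ q.1)) (by fun_prop)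
    have h2 : ContDiff ℝ ∞ fun q : R3 × ℝ => h q.1 0 :=
      H.smooth.comp (f := fun q : R3 × ℝ => (q.1, (0 : ℝ))) (by fun_prop)
    exact (H.smooth₀.comp contDiff_fst).add (h1.sub h2)
  · refine continuous_if_le (by fun_prop) continuous_const
      (H.continuous₀.comp continuous_fst).continuousOn ?_ fun q hq => ?_
    · have hθc := hθ.smooth.continuous
      refine H.continuousOn.comp (f := fun q : R3 × unitInterval =>
        (q.1, projIcc (0 : ℝ) 1 zero_le_one (q.2 * θ q.1))) ?_ fun q hq => hr.trans hq
      exact (Continuous.prodMk continuous_fst (continuous_projIcc.comp (by fun_prop))).continuousOn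
    · rw [hθ.zero _ hq.le, mul_zero, hz _ (hr.trans hq.ge)]
  · rw [cutoffLift]
    split_ifs with hx
    · rfl
    · simp only [Icc.coe_zero, zero_mul]
      exact hz x (hr.trans (not_le.1 hx).le)
  · rw [cutoffLift]
    split_ifs with hx
    · rw [cutoffDeformation_eq_of_zero (hθ.zero x hx)]
      exact H.lifts₀ x
    · have hx' := hr.trans (not_le.1 hx).le
      rw [H.lifts x hx', H.cutoffDeformation_eq hx', projIcc_of_mem]
      exact ⟨mul_nonneg τ.2.1 (hθ.mem x).1, mul_le_one₀ τ.2.2 (hθ.mem x).1 (hθ.mem x).2⟩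

theorem IsFamilyNearInfinity.graphIntegrand_cutoff_zero
    (H : IsFamilyNearInfinity p η₀ s₀ R M h l) (hr : R ≤ r) (Λ : ℝ) :
    graphIntegrand F G (fun x => cutoffDeformation η₀ h (fun _ => 0) x 1)
        (fun x => cutoffLift r s₀ l (fun _ => 0) (x, 1)) Λ = graphIntegrand F G η₀ s₀ Λ := by
  ext x
  refine graphIntegrand_congr (Eventually.of_forall fun y => cutoffDeformation_eq_of_zero rfl 1)
    ?_ Λ
  rw [cutoffLift]
  split_ifs with hx
  · rfl
  · simp only [mul_zero, projIcc_left]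
    exact H.initial_lift x (hr.trans (not_le.1 hx).le)

/-- The cut-off domain is `Γ` inside the ball and `x ↦ h x (θ x)` outside. There tameness bounds the
amplitude, and the derivative bounds of `h` and `θ` bound the Jacobian. The majorant depends on `θ`
only through `C`. -/
theorem IsFamilyNearInfinity.norm_graphIntegrand_le (H : IsFamilyNearInfinity p η₀ s₀ R M h l)
    (hr : R < r) (hC : 0 ≤ C) (hθ : IsOuterCutoff r C θ) {Λ : ℝ} {b : R3 → ℝ}
    (hb : ∀ x, R ≤ ‖x‖ → ∀ τ : unitInterval,
      ‖F (l (x, τ)) * Complex.exp (Complex.I * (Λ : ℂ) * G (complexPoint x (h x τ)))‖ ≤ b x)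
    (x : R3) :
    ‖graphIntegrand F G (fun x => cutoffDeformation η₀ h θ x 1)
        (fun x => cutoffLift r s₀ l θ (x, 1)) Λ x‖ ≤
      (Metric.closedBall 0 r).indicator (fun x => ‖graphIntegrand F G η₀ s₀ Λ x‖) x +
        ‖b x‖ * (6 * (1 + |M| * (1 + C)) ^ 3) := by
  have hK : 0 ≤ 6 * (1 + |M| * (1 + C)) ^ 3 := by positivity
  by_cases hx : ‖x‖ < r
  · have h1 : θ =ᶠ[𝓝 x] fun _ => 0 := by
      filter_upwards [(isOpen_lt continuous_norm continuous_const).eventually_mem hx] with y hy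
      exact hθ.zero y (le_of_lt hy)
    rw [graphIntegrand_cutoff_congr h1, H.graphIntegrand_cutoff_zero hr.le,
      indicator_of_mem (by simpa using hx.le)]
    exact le_add_of_nonneg_right (by positivity)
  · have hx' : r ≤ ‖x‖ := not_lt.1 hx
    have hRx : R < ‖x‖ := hr.trans_le hx'
    have h0 : 0 ≤ (Metric.closedBall 0 r).indicator
        (fun x => ‖graphIntegrand F G η₀ s₀ Λ x‖) x := indicator_nonneg (fun _ _ => norm_nonneg _) x
    refine le_trans ?_ (le_add_of_nonneg_left h0)
    have hev : (fun x => cutoffDeformation η₀ h θ x 1) =ᶠ[𝓝 x] fun x => h x (θ x) := by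
      filter_upwards [(isOpen_lt continuous_const continuous_norm).eventually_mem hRx] with y hy
      rw [H.cutoffDeformation_eq (le_of_lt hy), one_mul]
    have hl : cutoffLift r s₀ l θ (x, 1) = l (x, ⟨θ x, hθ.mem x⟩) := by
      rw [cutoffLift]
      split_ifs with hxr
      · have h1 : (⟨θ x, hθ.mem x⟩ : unitInterval) = 0 := Subtype.ext (hθ.zero x hxr)
        rw [h1, H.initial_lift x hRx.le]
      · simp only [Icc.coe_one, one_mul, projIcc_of_mem _ (hθ.mem x)]
    rw [graphIntegrand_congr (s' := fun x => l (x, ⟨θ x, hθ.mem x⟩)) hev hl, graphIntegrand,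
      norm_mul]
    refine mul_le_mul ((hb x hRx.le ⟨θ x, hθ.mem x⟩).trans (le_abs_self _))
      (norm_graphJacobian_le ?_) (norm_nonneg _) (norm_nonneg _)
    have h1 : HasFDerivAt (fun x : R3 => (x, θ x))
        ((ContinuousLinearMap.id ℝ R3).prod (fderiv ℝ θ x)) x :=
      (hasFDerivAt_id x).prodMk (hθ.smooth.differentiable (by simp) x).hasFDerivAt
    have h2 := ((H.smooth.differentiable (by simp) (x, θ x)).hasFDerivAt.comp x h1).fderiv
    have h3 : fderiv ℝ (fun x => h x (θ x)) x = (fderiv ℝ (fun q : R3 × ℝ => h q.1 q.2)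
        (x, θ x)).comp ((ContinuousLinearMap.id ℝ R3).prod (fderiv ℝ θ x)) := h2
    rw [h3]
    refine (ContinuousLinearMap.opNorm_comp_le _ _).trans (mul_le_mul
      ((H.bound x hRx.le _ (hθ.mem x)).trans (le_abs_self _)) ?_ (norm_nonneg _) (abs_nonneg _))
    refine ContinuousLinearMap.opNorm_le_bound _ (by positivity) fun v => ?_
    rw [ContinuousLinearMap.prod_apply, Prod.norm_def]
    refine max_le ?_ (((fderiv ℝ θ x).le_opNorm v).trans ?_)
    · simp only [ContinuousLinearMap.id_apply]
      nlinarith [norm_nonneg v]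
    · nlinarith [norm_nonneg v, hθ.bound x]

/-- The deformation is approximated by compactly supported ones, for which Stokes' theorem applies.
Their integrands have a common integrable majorant and at each point are eventually equal to the
limiting one, so dominated convergence transfers the equality. -/
theorem IsFamilyNearInfinity.integral_graphIntegrand (H : IsFamilyNearInfinity p η₀ s₀ R M h l)
    (hp : IsCoveringMap p) (hF : IsMultivaluedHolomorphic p F)
    (hG : ∀ ξ ∈ X, AnalyticAt ℂ G ξ) (hr : R < r) (hC : 0 ≤ C) (hθ : IsOuterCutoff r C θ) {Λ : ℝ}
    {b : R3 → ℝ} (hbi : Integrable b)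
    (hb : ∀ x, R ≤ ‖x‖ → ∀ τ : unitInterval,
      ‖F (l (x, τ)) * Complex.exp (Complex.I * (Λ : ℂ) * G (complexPoint x (h x τ)))‖ ≤ b x) :
    Integrable (graphIntegrand F G η₀ s₀ Λ) ∧
      Integrable (graphIntegrand F G (fun x => cutoffDeformation η₀ h θ x 1)
        (fun x => cutoffLift r s₀ l θ (x, 1)) Λ) ∧
      ∫ x, graphIntegrand F G (fun x => cutoffDeformation η₀ h θ x 1)
        (fun x => cutoffLift r s₀ l θ (x, 1)) Λ x = ∫ x, graphIntegrand F G η₀ s₀ Λ x := by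
  have hW₀ : Continuous (graphIntegrand F G η₀ s₀ Λ) :=
    continuous_graphIntegrand hp hF hG H.smooth₀ H.continuous₀ H.lifts₀ Λ
  have hW : ∀ {C θ}, IsOuterCutoff r C θ → Continuous (graphIntegrand F G
      (fun x => cutoffDeformation η₀ h θ x 1) (fun x => cutoffLift r s₀ l θ (x, 1)) Λ) := by
    intro C θ hθ
    have h1 := H.isLiftedDeformation hr.le hθ
    exact continuous_graphIntegrand hp hF hG (h1.contDiff_end 1) h1.continuous_end h1.lifts_one Λ
  have hbd : ∀ C : ℝ, Integrable fun x => (Metric.closedBall 0 r).indicator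
      (fun x => ‖graphIntegrand F G η₀ s₀ Λ x‖) x + ‖b x‖ * (6 * (1 + |M| * (1 + C)) ^ 3) := by
    intro C
    refine Integrable.add ?_ (hbi.norm.mul_const _)
    rw [integrable_indicator_iff measurableSet_closedBall]
    exact hW₀.norm.continuousOn.integrableOn_compact (isCompact_closedBall 0 r)
  have hint : ∀ {C θ}, 0 ≤ C → IsOuterCutoff r C θ → Integrable (graphIntegrand F G
      (fun x => cutoffDeformation η₀ h θ x 1) (fun x => cutoffLift r s₀ l θ (x, 1)) Λ) :=
    fun {C θ} hC hθ => (hbd C).mono' (hW hθ).aestronglyMeasurable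
      (Eventually.of_forall fun x => H.norm_graphIntegrand_le hr hC hθ hb x)
  have hint₀ : Integrable (graphIntegrand F G η₀ s₀ Λ) := by
    have := hint le_rfl (isOuterCutoff_zero r)
    rwa [H.graphIntegrand_cutoff_zero hr.le] at this
  refine ⟨hint₀, hint hC hθ, ?_⟩
  obtain ⟨C', θn, hθn, hcpt, hlim⟩ := hθ.exists_seq
  have hC' : 0 ≤ C' := (norm_nonneg _).trans ((hθn 0).bound 0)
  have heq : ∀ n, ∫ x, graphIntegrand F G (fun x => cutoffDeformation η₀ h (θn n) x 1)
      (fun x => cutoffLift r s₀ l (θn n) (x, 1)) Λ x = ∫ x, graphIntegrand F G η₀ s₀ Λ x := by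
    intro n
    obtain ⟨T, hT⟩ := hcpt n
    have hz : (fun x => cutoffDeformation η₀ h (θn n) x 0) = η₀ :=
      funext cutoffDeformation_zero
    have h1 := ((H.isLiftedDeformation hr.le (hθn n)).integral_graphIntegrand hp hF hG
      H.continuous₀ (r := T) (fun x hx τ => by
        rw [cutoffDeformation_eq_of_zero (hT x hx), cutoffDeformation_zero])
      (Λ := Λ) (by rw [hz]; exact hint₀)).2
    rwa [hz] at h1
  have hT := tendsto_integral_of_dominated_convergence (μ := volume) _
    (fun n => (hW (hθn n)).aestronglyMeasurable) (hbd C')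
    (fun n => Eventually.of_forall fun x => H.norm_graphIntegrand_le hr hC' (hθn n) hb x)
    (Eventually.of_forall fun x => tendsto_const_nhds.congr' (by
      filter_upwards [hlim x] with n hn
      exact (graphIntegrand_cutoff_congr hn Λ).symm))
  simp only [heq] at hT
  exact (tendsto_nhds_unique hT tendsto_const_nhds)

end Tame

/-! ### Exponential smallness where `Im G` is bounded below. -/

section Exponential

variable {Y : Type*} {F : Y → ℂ} {G : C3 → ℂ} {η : R3 → R3} {s : R3 → Y}

/-- Since `|exp(iΛG)| = exp(-Λ Im G)`, raising `Λ₁` to `Λ` gains `exp(-c (Λ - Λ₁))`. The integrand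
at one value `Λ₁` thus serves as majorant, and no separate bound on `F` is needed. -/
theorem norm_graphIntegrand_le_mul_exp {c Λ Λ₁ : ℝ} (hΛ : Λ₁ ≤ Λ) {x : R3}
    (hx : c ≤ (G (complexPoint x (η x))).im) :
    ‖graphIntegrand F G η s Λ x‖ ≤
      ‖graphIntegrand F G η s Λ₁ x‖ * Real.exp (-c * (Λ - Λ₁)) := by
  have h1 : ∀ Λ : ℝ, ‖graphIntegrand F G η s Λ x‖ = ‖F (s x)‖ *
      Real.exp (-(Λ * (G (complexPoint x (η x))).im)) * ‖graphJacobian η x‖ := by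
    intro Λ
    rw [graphIntegrand, norm_mul, norm_mul, Complex.norm_exp]
    simp
  rw [h1, h1]
  have h2 : -(Λ * (G (complexPoint x (η x))).im) ≤
      -(Λ₁ * (G (complexPoint x (η x))).im) + -c * (Λ - Λ₁) := by
    nlinarith [mul_le_mul_of_nonneg_left hx (sub_nonneg.2 hΛ)]
  calc _ = ‖F (s x)‖ * ‖graphJacobian η x‖ * Real.exp (-(Λ * (G (complexPoint x (η x))).im)) := by
        ring
    _ ≤ _ := mul_le_mul_of_nonneg_left (Real.exp_le_exp.2 h2) (by positivity)
    _ = _ := by rw [Real.exp_add]; ring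

/-- Where `Im G` is bounded below by `c > 0`, the integral is `O(e^{-c Λ})`. -/
theorem isBigO_graphIntegral {A : Set R3} (hA : MeasurableSet A) {c Λ₁ : ℝ}
    (hc : ∀ x ∈ A, c ≤ (G (complexPoint x (η x))).im)
    (hint : Integrable (graphIntegrand F G η s Λ₁)) :
    (fun Λ => graphIntegral F G η s A Λ) =O[atTop] fun Λ => Real.exp (-c * Λ) := by
  refine Asymptotics.IsBigO.of_bound
    ((∫ x in A, ‖graphIntegrand F G η s Λ₁ x‖) * Real.exp (c * Λ₁)) ?_
  filter_upwards [eventually_ge_atTop Λ₁] with Λ hΛ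
  have h1 : ‖graphIntegral F G η s A Λ‖ ≤
      ∫ x in A, ‖graphIntegrand F G η s Λ₁ x‖ * Real.exp (-c * (Λ - Λ₁)) := by
    refine norm_integral_le_of_norm_le (hint.norm.integrableOn.mul_const _) ?_
    filter_upwards [ae_restrict_mem hA] with x hx
    exact norm_graphIntegrand_le_mul_exp hΛ (hc x hx)
  rw [integral_mul_const] at h1
  rw [Real.norm_of_nonneg (Real.exp_pos _).le, mul_assoc, ← Real.exp_add]
  refine h1.trans_eq ?_
  congr 2
  ring

/-- The common part cancels, and the two set differences contribute exponentially little. -/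
theorem exponentiallyClose_graphIntegral {A B : Set R3} (hA : MeasurableSet A)
    (hB : MeasurableSet B) {c Λ₁ : ℝ} (hc0 : 0 < c)
    (hAB : ∀ x ∈ A \ B, c ≤ (G (complexPoint x (η x))).im)
    (hBA : ∀ x ∈ B \ A, c ≤ (G (complexPoint x (η x))).im)
    (hint : ∀ Λ ≥ Λ₁, Integrable (graphIntegrand F G η s Λ)) :
    ExponentiallyClose (graphIntegral F G η s A) (graphIntegral F G η s B) := by
  refine ⟨c, hc0, ((isBigO_graphIntegral (hA.diff hB) hAB (hint Λ₁ le_rfl)).sub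
    (isBigO_graphIntegral (hB.diff hA) hBA (hint Λ₁ le_rfl))).congr' ?_ (EventuallyEq.refl _ _)⟩
  filter_upwards [eventually_ge_atTop Λ₁] with Λ hΛ
  simp only [graphIntegral]
  have h1 := integral_inter_add_sdiff hB (hint Λ hΛ).integrableOn (s := A)
  have h2 := integral_inter_add_sdiff hA (hint Λ hΛ).integrableOn (s := B)
  rw [inter_comm] at h2
  rw [← h1, ← h2]
  ring

theorem exists_forall_le_of_isClosed {f : R3 → ℝ} (hf : Continuous f) {K : Set R3}
    (hK : IsClosed K) (hpos : ∀ x ∈ K, 0 < f x) {c R : ℝ} (hc : 0 < c)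
    (hR : ∀ x, R ≤ ‖x‖ → c ≤ f x) : ∃ c' > 0, ∀ x ∈ K, c' ≤ f x := by
  have hcpt : IsCompact (K ∩ Metric.closedBall 0 R) := (isCompact_closedBall _ _).inter_left hK
  obtain ⟨a, ha, h⟩ : ∃ a > 0, ∀ x ∈ K ∩ Metric.closedBall 0 R, a ≤ f x := by
    rcases (K ∩ Metric.closedBall 0 R).eq_empty_or_nonempty with h | h
    · exact ⟨1, one_pos, by simp [h]⟩
    · obtain ⟨x, hx, hmin⟩ := hcpt.exists_isMinOn h hf.continuousOn
      exact ⟨f x, hpos x hx.1, fun y hy => hmin hy⟩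
  refine ⟨min a c, lt_min ha hc, fun x hx => ?_⟩
  rcases le_total R ‖x‖ with h1 | h1
  · exact (min_le_right _ _).trans (hR x h1)
  · exact (min_le_left _ _).trans (h x ⟨hx, by simpa using h1⟩)

theorem continuous_im_complexPoint {X : Set C3} (hG : ∀ ξ ∈ X, AnalyticAt ℂ G ξ)
    (hη : Continuous η) (hX : ∀ x, complexPoint x (η x) ∈ X) :
    Continuous fun x => (G (complexPoint x (η x))).im :=
  Complex.continuous_im.comp (continuous_iff_continuousAt.2 fun x =>
    (hG _ (hX x)).continuousAt.comp (f := fun x => complexPoint x (η x))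
      (continuous_complexPoint.comp (continuous_id.prodMk hη)).continuousAt)

end Exponential

/-! ### The base deformation. -/

section Deformation

variable {J : Type*} {δ : ℝ} {g : J → C3 → ℂ} {Y : Type*} [TopologicalSpace Y]
  {p : Y → singularityFree δ g} {F : Y → ℂ} {G : C3 → ℂ} {η₀ : R3 → R3} {s₀ : R3 → Y}
  {S : Finset R3}

/-- A deformation of `Γ` which is desired off given balls about the special points and can still
be deformed to a desired one at every other point, with the same integral. -/
structure IsBaseDeformation (p : Y → singularityFree δ g) (F : Y → ℂ) (G : C3 → ℂ) (η₀ : R3 → R3)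
    (s₀ : R3 → Y) (S : Finset R3) (r R c Λ₀ : ℝ) (H : R3 → ℝ → R3)
    (l : R3 × unitInterval → Y) : Prop where
  isLifted : IsLiftedDeformation p s₀ H l
  initial : ∀ x, H x 0 = η₀ x
  allowed : ∀ x, ∀ t ∈ Ioc (0 : ℝ) 1, complexPoint x (t • H x 1) ∈ singularityFree δ g
  -- Required also inside the balls, so that the domain can later be made desired closer to the
  -- special points.
  good : ∀ x ∉ S, HasDesiredDirection δ g G x (H x 1)
  desired : ∀ x ∉ ⋃ ν ∈ S, Metric.ball ν r, DesiredDirection G x (H x 1) ∧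
    ∀ t ∈ Ioc (0 : ℝ) 1, 0 < (G (complexPoint x (t • H x 1))).im
  pos : 0 < c
  lower : ∀ x, R ≤ ‖x‖ → c ≤ (G (complexPoint x (H x 1))).im
  integrable₀ : ∀ Λ ≥ Λ₀, Integrable (graphIntegrand F G η₀ s₀ Λ)
  integrable : ∀ Λ ≥ Λ₀,
    Integrable (graphIntegrand F G (fun x => H x 1) (fun x => l (x, 1)) Λ)
  integral_eq : ∀ Λ ≥ Λ₀, ∫ x, graphIntegrand F G (fun x => H x 1) (fun x => l (x, 1)) Λ x =
    ∫ x, graphIntegrand F G η₀ s₀ Λ x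

theorem isClosed_compl_iUnion_ball (S : Finset R3) (r : ℝ) :
    IsClosed (⋃ ν ∈ S, Metric.ball ν r)ᶜ :=
  (isOpen_biUnion fun _ _ => Metric.isOpen_ball).isClosed_compl

theorem notMem_of_notMem_iUnion_ball {r : ℝ} (hr : 0 < r) {x : R3}
    (hx : x ∉ ⋃ ν ∈ S, Metric.ball ν r) : x ∉ S := fun h =>
  hx (mem_biUnion h (Metric.mem_ball_self hr))

/-- The domain is first moved along the tame family near infinity and then, by gluing, made desired
off the balls. The second motion has compact support, so both leave the integral unchanged. -/
theorem exists_isBaseDeformation (hs : IsRealSingularityFamily δ g) (hp : IsCoveringMap p)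
    (hF : IsMultivaluedHolomorphic p F) (hG : AnalyticOnNhd ℂ G (realTube δ))
    (hG0 : ∀ x, 0 ≤ (G (realPoint x)).im) (hη₀ : ContDiff ℝ ∞ η₀)
    (hη₀X : ∀ x, ∀ t ∈ Ioc (0 : ℝ) 1, complexPoint x (t • η₀ x) ∈ singularityFree δ g)
    (hs₀ : Continuous s₀) (hs₀p : ∀ x, (p (s₀ x) : C3) = complexPoint x (η₀ x))
    (hS : (S : Set R3) = specialPoints δ g G η₀) (hadm : ∀ x ∉ S, RegularOrConicalAt g x)
    (htame : TameAtInfinity δ g p F G η₀ s₀) {r : ℝ} (hr : 0 < r) :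
    ∃ R c Λ₀ H l, IsBaseDeformation p F G η₀ s₀ S r R c Λ₀ H l := by
  obtain ⟨R, h, l, hh, hloc, hT, ⟨c, hc, hcb⟩, ⟨M, hM⟩, hl, hlift, Λ₀, hb⟩ := htame
  have hGr : ∀ x, AnalyticAt ℂ G (realPoint x) := fun x => hG _ (realPoint_mem_realTube hs.pos x)
  have hGX : ∀ ξ ∈ singularityFree δ g, AnalyticAt ℂ G ξ := fun ξ hξ => hG ξ hξ.1
  have hfam : IsFamilyNearInfinity p η₀ s₀ R M h l := ⟨hη₀, hs₀, hs₀p, hh, hl,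
    fun x hx => (hloc x hx).initial, fun x hx => (hlift x hx).1, fun x hx => (hlift x hx).2, hM⟩
  set R₁ := |R| + 1 with hR₁
  have hRR₁ : R < R₁ := (le_abs_self R).trans_lt (lt_add_one _)
  obtain ⟨C, θ, hC, hθ, hθ1⟩ := exists_isOuterCutoff (r := R₁) (by positivity)
  set A := cutoffDeformation η₀ h θ with hA
  have hAl : IsLiftedDeformation p s₀ A (cutoffLift R₁ s₀ l θ) := hfam.isLiftedDeformation hRR₁.le hθ
  have hA1 : ∀ x, R ≤ ‖x‖ → A x 1 = h x (θ x) := fun x hx => by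
    rw [hA, hfam.cutoffDeformation_eq hx, one_mul]
  have hAη : ∀ x, ‖x‖ < R → A x 1 = η₀ x := fun x hx =>
    cutoffDeformation_eq_of_zero (hθ.zero x (hx.trans hRR₁).le) 1
  have hAX : ∀ x, ∀ t ∈ Ioc (0 : ℝ) 1, complexPoint x (t • A x 1) ∈ singularityFree δ g := by
    intro x t ht
    rcases le_or_gt R ‖x‖ with hx | hx
    · rw [hA1 x hx]
      exact (hT x hx t ht).1 _ (hθ.mem x)
    · rw [hAη x hx]
      exact hη₀X x t ht
  have hAgood : ∀ x ∉ S, HasDesiredDirection δ g G x (A x 1) := by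
    intro x hxS
    rcases le_or_gt R ‖x‖ with hx | hx
    · rw [hA1 x hx]
      have h1 := (hloc x hx).joinedIn_desired hs (hadm x hxS) (hGr x) (hG0 x)
      exact ⟨h x 1, h1.1 _ (hθ.mem x), h1.2⟩
    · rw [hAη x hx]
      refine HasDesiredDirection.of_not_special hs (hadm x hxS) (hGr x) (hG0 x) ?_
      rw [← hS]
      exact hxS
  have hAfar : ∀ x, R₁ + 1 ≤ ‖x‖ → R ≤ ‖x‖ ∧ A x 1 = h x 1 := fun x hx => by
    have h1 : R ≤ ‖x‖ := by linarith
    exact ⟨h1, by rw [hA1 x h1, hθ1 x hx]⟩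
  have hnot : ∀ x ∈ (⋃ ν ∈ S, Metric.ball ν r)ᶜ, x ∉ S := fun x hx =>
    notMem_of_notMem_iUnion_ball hr hx
  -- Beyond `R₁ + 1` the cutoff equals one and the domain is already desired, so it can stay fixed
  -- beyond `R₁ + 2`. In the transition shell it has the direction `h x (θ x)`, which is still
  -- joined to `h x 1`.
  obtain ⟨B, hBs, hB0, hBX, hBL, hBt, hBd, hBg⟩ := exists_glued_deformation hs hGr hG0
    (hAl.contDiff_end 1) hAX (isClosed_compl_iUnion_ball S r)
    (L := {x | R₁ + 2 ≤ ‖x‖}) (O := {x | R₁ + 1 < ‖x‖})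
    (isClosed_le continuous_const continuous_norm) (isOpen_lt continuous_const continuous_norm)
    (fun x (hx : R₁ + 2 ≤ ‖x‖) => show R₁ + 1 < ‖x‖ by linarith) (fun x hx => hadm x (hnot x hx))
    (fun x hx => hAgood x (hnot x hx)) (by
      rintro x ⟨hx, hxK⟩
      obtain ⟨h1, h2⟩ := hAfar x (le_of_lt hx)
      rw [h2]
      exact ⟨((hloc x h1).joinedIn_desired hs (hadm x (hnot x hxK)) (hGr x) (hG0 x)).2,
        fun t ht => (hT x h1 t ht).2⟩)
  obtain ⟨m, hm⟩ := exists_isLiftedDeformation hp hAl.continuous_end hBs hBX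
    (fun x => by rw [hB0]; exact hAl.lifts_one x)
  obtain ⟨H, l', hH, hH0, hH1, hl'1⟩ := hAl.trans hm hB0
  have hH1' : (fun x => H x 1) = fun x => B x 1 := funext hH1
  have hl'1' : (fun x => l' (x, 1)) = fun x => m (x, 1) := funext hl'1
  have hB0' : (fun x => B x 0) = fun x => A x 1 := funext hB0
  have hint : ∀ Λ ≥ Λ₀, Integrable (graphIntegrand F G η₀ s₀ Λ) ∧
      Integrable (graphIntegrand F G (fun x => B x 1) (fun x => m (x, 1)) Λ) ∧
      ∫ x, graphIntegrand F G (fun x => B x 1) (fun x => m (x, 1)) Λ x =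
        ∫ x, graphIntegrand F G η₀ s₀ Λ x := by
    intro Λ hΛ
    obtain ⟨b, hbi, hbb⟩ := hb Λ hΛ
    obtain ⟨h1, h2, h3⟩ := hfam.integral_graphIntegrand hp hF hGX hRR₁ hC hθ hbi hbb
    have h4 := hm.integral_graphIntegrand hp hF hGX hAl.continuous_end (r := R₁ + 2)
      (fun x hx τ => (hBL x hx τ).trans (hB0 x).symm) (Λ := Λ) (by rw [hB0']; exact h2)
    rw [hB0'] at h4
    exact ⟨h1, h4.1, h4.2.trans h3⟩
  refine ⟨R₁ + 2, c, Λ₀, H, l', hH, fun x => (hH0 x).trans (cutoffDeformation_zero x), ?_, ?_, ?_,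
    hc, fun x hx => ?_, fun Λ hΛ => (hint Λ hΛ).1, ?_, ?_⟩
  · simpa only [hH1] using hBt
  · intro x hx
    rw [hH1]
    exact hBg x (hadm x hx) (hAgood x hx)
  · simpa only [hH1, mem_compl_iff] using hBd
  · obtain ⟨h1, h2⟩ := hAfar x (le_trans (by linarith) hx)
    rw [hH1, hBL x hx, h2]
    exact hcb x h1
  · rw [hH1', hl'1']
    exact fun Λ hΛ => (hint Λ hΛ).2.1
  · rw [hH1', hl'1']
    exact fun Λ hΛ => (hint Λ hΛ).2.2

theorem exists_desired_deformation (hs : IsRealSingularityFamily δ g)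
    (hG : ∀ x, AnalyticAt ℂ G (realPoint x)) (hG0 : ∀ x, 0 ≤ (G (realPoint x)).im)
    (hη₀ : ContDiff ℝ ∞ η₀)
    (hη₀X : ∀ x, ∀ t ∈ Ioc (0 : ℝ) 1, complexPoint x (t • η₀ x) ∈ singularityFree δ g)
    {K : Set R3} (hK : IsClosed K)
    (h : ∀ x ∈ K, RegularOrConicalAt g x ∧ x ∉ specialPoints δ g G η₀) :
    ∃ η, IsAllowedDeformation δ g η₀ η ∧ IsDesiredOn G η K := by
  obtain ⟨H, h1, h2, h3, -, -, h4, -⟩ := exists_glued_deformation hs hG hG0 hη₀ hη₀X hK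
    isClosed_empty isOpen_empty Subset.rfl (fun x hx => (h x hx).1)
    (fun x hx => HasDesiredDirection.of_not_special hs (h x hx).1 (hG x) (hG0 x) (h x hx).2)
    (by simp)
  exact ⟨H, ⟨h1, h2, h3⟩, fun x hx => by simpa using (h4 x hx).2 1 (by simp)⟩

end Deformation

/-! ### Localization at the special points. -/

section Locality

variable {J : Type*} {δ : ℝ} {g : J → C3 → ℂ} {Y : Type*} [TopologicalSpace Y]
  {p : Y → singularityFree δ g} {F : Y → ℂ} {G : C3 → ℂ} {η₀ : R3 → R3} {s₀ : R3 → Y}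
  {S : Finset R3} {r R c Λ₀ : ℝ} {H : R3 → ℝ → R3} {l : R3 × unitInterval → Y}

theorem IsLiftedDeformation.isAllowedDeformation (h : IsLiftedDeformation p s₀ H l)
    (h0 : ∀ x, H x 0 = η₀ x) : IsAllowedDeformation δ g η₀ H :=
  ⟨h.smooth, h0, fun x τ hτ => by
    rw [← h.lifts x ⟨τ, hτ⟩]
    exact (p _).2⟩

theorem IsBaseDeformation.mem (h : IsBaseDeformation p F G η₀ s₀ S r R c Λ₀ H l) (x : R3) :
    complexPoint x (H x 1) ∈ singularityFree δ g := by
  rw [← h.isLifted.lifts_one]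
  exact (p _).2

/-- Shrinking the balls, without changing the deformation far from the special points. -/
theorem IsBaseDeformation.exists_shrink (h : IsBaseDeformation p F G η₀ s₀ S r R c Λ₀ H l)
    (hs : IsRealSingularityFamily δ g) (hp : IsCoveringMap p)
    (hF : IsMultivaluedHolomorphic p F) (hG : AnalyticOnNhd ℂ G (realTube δ))
    (hG0 : ∀ x, 0 ≤ (G (realPoint x)).im) (hadm : ∀ x ∉ S, RegularOrConicalAt g x)
    {r₁ r' : ℝ} (hr : 0 < r) (hrr₁ : r < r₁) (hr' : 0 < r')
    (hdisj : (S : Set R3).PairwiseDisjoint fun ν => Metric.closedBall ν r₁) :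
    ∃ R' H' l', IsBaseDeformation p F G η₀ s₀ S r' R' c Λ₀ H' l' ∧
      ∀ ν ∈ S, ∀ Λ, graphIntegral F G (fun x => H' x 1) (fun x => l' (x, 1))
        (Metric.closedBall ν r₁) Λ =
      graphIntegral F G (fun x => H x 1) (fun x => l (x, 1)) (Metric.closedBall ν r₁) Λ := by
  have hGr : ∀ x, AnalyticAt ℂ G (realPoint x) := fun x => hG _ (realPoint_mem_realTube hs.pos x)
  have hGX : ∀ ξ ∈ singularityFree δ g, AnalyticAt ℂ G ξ := fun ξ hξ => hG ξ hξ.1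
  have hnot : ∀ x ∈ (⋃ ν ∈ S, Metric.ball ν r')ᶜ, x ∉ S := fun x hx =>
    notMem_of_notMem_iUnion_ball hr' hx
  have hO : {x : R3 | ∀ ν ∈ S, r < dist x ν} = ⋂ ν ∈ S, {x | r < dist x ν} := by ext; simp
  have hL : {x : R3 | ∀ ν ∈ S, r₁ ≤ dist x ν} = ⋂ ν ∈ S, {x | r₁ ≤ dist x ν} := by ext; simp
  -- The old domain is desired at distance greater than `r` from all special points, so it can be
  -- kept at distance at least `r₁ > r`. In particular the spheres of radius `r₁` do not move, which
  -- fixes the integrals over the balls they bound.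
  obtain ⟨B, hBs, hB0, hBX, hBL, hBt, hBd, hBg⟩ := exists_glued_deformation hs hGr hG0
    (h.isLifted.contDiff_end 1) h.allowed (isClosed_compl_iUnion_ball S r')
    (L := {x | ∀ ν ∈ S, r₁ ≤ dist x ν}) (O := {x | ∀ ν ∈ S, r < dist x ν})
    (hL ▸ isClosed_biInter fun ν _ => isClosed_le continuous_const (by fun_prop))
    (hO ▸ isOpen_biInter_finset fun ν _ => isOpen_lt continuous_const (by fun_prop))
    (fun x hx ν hν => hrr₁.trans_le (hx ν hν)) (fun x hx => hadm x (hnot x hx))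
    (fun x hx => h.good x (hnot x hx)) (fun x hx => h.desired x fun hxb => by
      obtain ⟨ν, hν, hxν⟩ := mem_iUnion₂.1 hxb
      exact lt_asymm (hx.1 ν hν) hxν)
  obtain ⟨m, hm⟩ := exists_isLiftedDeformation hp h.isLifted.continuous_end hBs hBX
    (fun x => by rw [hB0]; exact h.isLifted.lifts_one x)
  obtain ⟨H', l', hH, hH0, hH1, hl'1⟩ := h.isLifted.trans hm hB0
  have hH1' : (fun x => H' x 1) = fun x => B x 1 := funext hH1
  have hl'1' : (fun x => l' (x, 1)) = fun x => m (x, 1) := funext hl'1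
  have hB0' : (fun x => B x 0) = fun x => H x 1 := funext hB0
  -- Far out every point is at distance at least `r₁` from `S`, so the new motion has compact
  -- support.
  obtain ⟨T, hT⟩ : ∃ T : ℝ, ∀ x : R3, T ≤ ‖x‖ → ∀ ν ∈ S, r₁ ≤ dist x ν := by
    refine ⟨∑ ν ∈ S, ‖ν‖ + r₁, fun x hx ν hν => ?_⟩
    have h1 : ‖ν‖ ≤ ∑ ν ∈ S, ‖ν‖ :=
      Finset.single_le_sum (f := fun ν : R3 => ‖ν‖) (fun _ _ => norm_nonneg _) hν
    have h2 := norm_sub_norm_le x ν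
    rw [dist_eq_norm]
    linarith
  have hint : ∀ Λ ≥ Λ₀,
      Integrable (graphIntegrand F G (fun x => B x 1) (fun x => m (x, 1)) Λ) ∧
      ∫ x, graphIntegrand F G (fun x => B x 1) (fun x => m (x, 1)) Λ x =
        ∫ x, graphIntegrand F G η₀ s₀ Λ x := by
    intro Λ hΛ
    have h4 := hm.integral_graphIntegrand hp hF hGX h.isLifted.continuous_end (r := T)
      (fun x hx τ => (hBL x (hT x hx) τ).trans (hB0 x).symm) (Λ := Λ)
      (by rw [hB0']; exact h.integrable Λ hΛ)
    rw [hB0'] at h4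
    exact ⟨h4.1, h4.2.trans (h.integral_eq Λ hΛ)⟩
  refine ⟨max R T, H', l', ⟨hH, fun x => (hH0 x).trans (h.initial x), ?_, ?_, ?_, h.pos,
    fun x hx => ?_, h.integrable₀, ?_, ?_⟩, fun ν hν Λ => ?_⟩
  · simpa only [hH1] using hBt
  · intro x hx
    rw [hH1]
    exact hBg x (hadm x hx) (h.good x hx)
  · simpa only [hH1, mem_compl_iff] using hBd
  · rw [hH1, hBL x (hT x ((le_max_right _ _).trans hx))]
    exact h.lower x ((le_max_left _ _).trans hx)
  · rw [hH1', hl'1']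
    exact fun Λ hΛ => (hint Λ hΛ).1
  · rw [hH1', hl'1']
    exact fun Λ hΛ => (hint Λ hΛ).2
  · rw [hH1', hl'1', hm.graphIntegral_closedBall hp hF hGX (hr.trans hrr₁).le, hB0']
    intro x hx τ
    rw [hB0]
    refine hBL x (fun ν' hν' => ?_) τ
    rcases eq_or_ne ν' ν with rfl | hne
    · exact hx.ge
    · by_contra! hlt
      exact disjoint_left.1 (hdisj hν' hν hne) (Metric.mem_closedBall.2 hlt.le)
        (Metric.sphere_subset_closedBall hx)

theorem IsBaseDeformation.exists_lower_bound
    (h : IsBaseDeformation p F G η₀ s₀ S r R c Λ₀ H l) (hG : AnalyticOnNhd ℂ G (realTube δ)) :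
    ∃ c' > 0, ∀ x ∉ ⋃ ν ∈ S, Metric.ball ν r, c' ≤ (G (complexPoint x (H x 1))).im :=
  exists_forall_le_of_isClosed
    (continuous_im_complexPoint (fun ξ hξ => hG ξ hξ.1) (h.isLifted.contDiff_end 1).continuous h.mem)
    (isClosed_compl_iUnion_ball S r)
    (fun x hx => by simpa using (h.desired x hx).2 1 (by simp)) h.pos h.lower

theorem exists_pairwiseDisjoint_closedBall (S : Finset R3) :
    ∃ r > 0, (S : Set R3).PairwiseDisjoint fun ν => Metric.closedBall ν r := by
  have h1 : ∀ᶠ r : ℝ in 𝓝[>] 0, ∀ q ∈ S ×ˢ S, q.1 ≠ q.2 → 2 * r < dist q.1 q.2 := by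
    rw [Filter.eventually_all_finset]
    intro q _
    by_cases hq : q.1 = q.2
    · simp [hq]
    · have h2 : (0 : ℝ) < dist q.1 q.2 / 2 := half_pos (dist_pos.2 hq)
      filter_upwards [Ioo_mem_nhdsGT h2] with r hr _
      linarith [hr.2]
  obtain ⟨r, hr, hr0⟩ := (h1.and self_mem_nhdsWithin).exists
  refine ⟨r, hr0, fun a ha b hb hab => Metric.closedBall_disjoint_closedBall ?_⟩
  linarith [hr (a, b) (Finset.mk_mem_product ha hb) hab]

/-- The functions `u ν` come from one base deformation and are chosen before the neighbourhoods `N`.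
The shrunken deformations vary with `N` but have the same ball integrals. -/
theorem principleOfLocality_of_tame (hs : IsRealSingularityFamily δ g) (hp : IsCoveringMap p)
    (hF : IsMultivaluedHolomorphic p F) (hG : AnalyticOnNhd ℂ G (realTube δ))
    (hG0 : ∀ x, 0 ≤ (G (realPoint x)).im) (hη₀ : ContDiff ℝ ∞ η₀)
    (hη₀X : ∀ x, ∀ t ∈ Ioc (0 : ℝ) 1, complexPoint x (t • η₀ x) ∈ singularityFree δ g)
    (hs₀ : Continuous s₀) (hs₀p : ∀ x, (p (s₀ x) : C3) = complexPoint x (η₀ x))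
    (hS : (S : Set R3) = specialPoints δ g G η₀) (hadm : ∀ x ∉ S, RegularOrConicalAt g x)
    (htame : TameAtInfinity δ g p F G η₀ s₀) : PrincipleOfLocality δ g p F G η₀ s₀ S := by
  obtain ⟨r₁, hr₁, hdisj⟩ := exists_pairwiseDisjoint_closedBall S
  have hr : 0 < r₁ / 2 := half_pos hr₁
  obtain ⟨R, c, Λ₀, H, l, h⟩ :=
    exists_isBaseDeformation hs hp hF hG hG0 hη₀ hη₀X hs₀ hs₀p hS hadm htame hr
  -- The base domain is desired off the balls of radius `r₁ / 2`; the margin up to `r₁` allows later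
  -- deformations to leave the boundary of the integration balls alone.
  refine ⟨fun ν => graphIntegral F G (fun x => H x 1) (fun x => l (x, 1))
    (Metric.closedBall ν r₁), eventually_atTop.2 ⟨Λ₀, h.integrable₀⟩, ?_, fun N hN hNd => ?_⟩
  · obtain ⟨c', hc', hlow⟩ := h.exists_lower_bound hG
    have hmeas : MeasurableSet (⋃ ν ∈ S, Metric.closedBall ν r₁) :=
      Finset.measurableSet_biUnion S fun ν _ => Metric.isClosed_closedBall.measurableSet
    refine ⟨c', hc', (isBigO_graphIntegral hmeas.compl (fun x hx => hlow x fun hx' => hx ?_)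
      (h.integrable Λ₀ le_rfl)).congr' ?_ (EventuallyEq.refl _ _)⟩
    · exact iUnion₂_mono (fun ν _ => Metric.ball_subset_closedBall.trans
        (Metric.closedBall_subset_closedBall (half_le_self hr₁.le))) hx'
    · filter_upwards [eventually_ge_atTop Λ₀] with Λ hΛ
      have h1 := integral_add_compl hmeas (h.integrable Λ hΛ)
      rw [integral_biUnion_finset S (fun ν _ => Metric.isClosed_closedBall.measurableSet)
        hdisj fun ν _ => (h.integrable Λ hΛ).integrableOn, h.integral_eq Λ hΛ] at h1
      simp only [graphIntegral, setIntegral_univ]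
      rw [← h1, add_sub_cancel_left]
  · obtain ⟨r', hr', hr'N⟩ : ∃ r' > 0, ∀ ν ∈ S, Metric.closedBall ν r' ⊆ N ν ∩
        Metric.closedBall ν r₁ := by
      have h1 : ∀ᶠ r' : ℝ in 𝓝[>] 0, ∀ ν ∈ S, Metric.closedBall ν r' ⊆ N ν ∩
          Metric.closedBall ν r₁ := by
        rw [Filter.eventually_all_finset]
        intro ν hν
        exact (eventually_closedBall_subset (inter_mem
          ((hN ν hν).1.mem_nhds (hN ν hν).2) (Metric.closedBall_mem_nhds ν hr₁))).filter_mono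
          nhdsWithin_le_nhds
      obtain ⟨r', h2, h3⟩ := (h1.and self_mem_nhdsWithin).exists
      exact ⟨r', h3, h2⟩
    have hsub : ∀ ν ∈ S, Metric.ball ν r' ⊆ N ν ∩ Metric.closedBall ν r₁ := fun ν hν =>
      Metric.ball_subset_closedBall.trans (hr'N ν hν)
    obtain ⟨R', H', l', h', heq⟩ :=
      h.exists_shrink hs hp hF hG hG0 hadm hr (half_lt_self hr₁) hr' hdisj
    obtain ⟨c', hc', hlow⟩ := h'.exists_lower_bound hG
    refine ⟨H', l', h'.isLifted.isAllowedDeformation h'.initial, fun x hx => ?_,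
      h'.isLifted.continuous, h'.isLifted.initial, h'.isLifted.lifts,
      eventually_atTop.2 ⟨Λ₀, h'.integrable⟩, fun ν hν => ?_⟩
    · have h1 : x ∉ ⋃ ν ∈ S, Metric.ball ν r' := fun hx' =>
        hx (iUnion₂_mono (fun ν hν => (hsub ν hν).trans inter_subset_left) hx')
      exact hc'.trans_le (hlow x h1)
    · have h1 : graphIntegral F G (fun x => H x 1) (fun x => l (x, 1)) (Metric.closedBall ν r₁) =
          graphIntegral F G (fun x => H' x 1) (fun x => l' (x, 1)) (Metric.closedBall ν r₁) :=
        funext fun Λ => (heq ν hν Λ).symm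
      beta_reduce
      rw [h1]
      refine exponentiallyClose_graphIntegral Metric.isClosed_closedBall.measurableSet
        (hN ν hν).1.measurableSet hc' (fun x hx => hlow x fun hx' => ?_)
        (fun x hx => hlow x fun hx' => ?_) h'.integrable
      -- A point of either set difference lies in none of the `r'`-balls. The one about `ν` is
      -- contained in both sets, and one about another `ν'` is contained in sets disjoint from both.
      all_goals
        obtain ⟨ν', hν', hxν'⟩ := mem_iUnion₂.1 hx'
        have h2 := hsub ν' hν' hxν'
        rcases eq_or_ne ν' ν with rfl | hne
      · exact hx.2 h2.1
      · exact disjoint_left.1 (hdisj hν' hν hne) h2.2 hx.1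
      · exact hx.2 h2.2
      · exact disjoint_left.1 (hNd hν' hν hne) h2.1 hx.1

end Locality

theorem mainTheorem8 {J : Type*} (δ : ℝ) (hδ : 0 < δ)
    -- the singularities `σ_j = {g_j = 0}`
    (g : J → C3 → ℂ) (hg : ∀ j, AnalyticOnNhd ℂ (g j) (realTube δ))
    (hg_fin : ∀ ξ ∈ realTube δ, ∃ V ∈ 𝓝 ξ, {j | ∃ ζ ∈ V ∩ realTube δ, g j ζ = 0}.Finite)
    (hg_real : ∀ j x, (g j (complexPoint x 0)).im = 0)
    -- the multivalued amplitude `F` and the phase function `G z`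
    {Y : Type*} [TopologicalSpace Y] (p : Y → singularityFree δ g) (hp : IsCoveringMap p)
    (F : Y → ℂ) (hF : IsMultivaluedHolomorphic p F)
    (G : R3 → C3 → ℂ) (hG : ∀ z, AnalyticOnNhd ℂ (G z) (realTube δ))
    (hG_im : ∀ z x, 0 ≤ (G z (complexPoint x 0)).im)
    -- the initial domain `Γ = {x + i η₀(x)}`, close to real space, with a branch `s₀` over it
    (η₀ : R3 → R3) (hη₀ : ContDiff ℝ ∞ η₀)
    (hη₀_small : ∀ x, ∀ t ∈ Ioc (0 : ℝ) 1, complexPoint x (t • η₀ x) ∈ singularityFree δ g)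
    (s₀ : R3 → Y) (hs₀ : Continuous s₀) (hs₀_lift : ∀ x, (p (s₀ x) : C3) = complexPoint x (η₀ x)) :
    -- local deformations are glued into a global deformation
    (∀ (z : R3) (S : Finset R3) (N : R3 → Set R3),
      (∀ ν ∈ S, IsOpen (N ν) ∧ ν ∈ N ν) →
      (∀ x ∉ ⋃ ν ∈ S, N ν, RegularOrConicalAt g x ∧ x ∉ specialPoints δ g (G z) η₀) →
      ∃ η : R3 → ℝ → R3,
        IsAllowedDeformation δ g η₀ η ∧ IsDesiredOn (G z) η (⋃ ν ∈ S, N ν)ᶜ) ∧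
    -- the principle of locality, for an individual `z`
    (∀ (z : R3) (S : Finset R3), (S : Set R3) = specialPoints δ g (G z) η₀ →
      (∀ x ∉ S, RegularOrConicalAt g x) → TameAtInfinity δ g p F (G z) η₀ s₀ →
      PrincipleOfLocality δ g p F (G z) η₀ s₀ S) ∧
    -- the principle of locality, for almost all `z`
    ((∀ᵐ z : R3, (specialPoints δ g (G z) η₀).Finite ∧
        (∀ x ∉ specialPoints δ g (G z) η₀, RegularOrConicalAt g x) ∧
        TameAtInfinity δ g p F (G z) η₀ s₀) →
      ∀ᵐ z : R3, ∃ S : Finset R3, (S : Set R3) = specialPoints δ g (G z) η₀ ∧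
        PrincipleOfLocality δ g p F (G z) η₀ s₀ S) := by
  have hs : IsRealSingularityFamily δ g := ⟨hδ, hg, hg_fin, fun j x => by
    rw [← complexPoint_zero_right]
    exact hg_real j x⟩
  have hG0 : ∀ z x, 0 ≤ (G z (realPoint x)).im := fun z x => by
    rw [← complexPoint_zero_right]
    exact hG_im z x
  refine ⟨fun z S N hN h => ?_, fun z S hS hadm htame => ?_, fun h => ?_⟩
  · exact exists_desired_deformation hs (fun x => hG z _ (realPoint_mem_realTube hδ x)) (hG0 z) hη₀
      hη₀_small (isOpen_biUnion fun ν hν => (hN ν hν).1).isClosed_compl h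
  · exact principleOfLocality_of_tame hs hp hF (hG z) (hG0 z) hη₀ hη₀_small hs₀ hs₀_lift hS hadm
      htame
  · filter_upwards [h] with z ⟨hfin, hadm, htame⟩
    have hS : (hfin.toFinset : Set R3) = specialPoints δ g (G z) η₀ := hfin.coe_toFinset
    exact ⟨hfin.toFinset, hS, principleOfLocality_of_tame hs hp hF (hG z) (hG0 z) hη₀ hη₀_small
      hs₀ hs₀_lift hS (fun x hx => hadm x (by simpa using hx)) htame⟩
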